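/- **Setting.** A *Feynman graph* $\Gamma$ is a finite, possibly disconnected multigraph without isolated vertices (self-loops allowed) whose edges and vertices have types, together with a finite set of *scales*. A scale $s$ consists of a set of massive edges and a set of external vertices, not both empty. All external vertices of $s$ lie in one connected component of $\Gamma$, and there are either none or at least two of them (by momentum conservation a single external vertex is the same as none). Each connected component of $\Gamma$ carries masses and external momenta of at most one scale. A connected graph that depends on masses or momenta has one scale; in a disjoint union every factor keeps its own scales. $\Gamma$ is *scaleless* if it has no scale. Graphs are considered up to isomorphism. A *subgraph* $\gamma\subseteq\Gamma$ is a set of edges with their end points. It is *mass-momentum-spanning* (mm) for a scale $s$ if it contains all massive edges of $s$ and one of its connected components contains all external vertices of $s$ (if there are any). Regarded as a graph, $\gamma$ inherits exactly the scales for which it is mm. $\gamma$ is called mm if it is mm for all scales of $\Gamma$. The *contracted graph* $\Gamma/\gamma$ arises by contracting each connected component of $\gamma$ to a vertex; it keeps the scales for which $\gamma$ is not mm, with those massive edges that are not in $\gamma$, and with the images of the external vertices unless these have been contracted to one vertex ($\Gamma/\Gamma$ is the empty graph $\emptyset$). $\Gamma$ is *motic* if every proper mm subgraph of $\Gamma$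 has strictly fewer loops than $\Gamma$. Let $\mathcal M$ be the $\mathbb Q$-vector space with the motic graphs as basis. The product is disjoint union with unit $\mathbb I=\emptyset$, and $$\Delta(\Gamma)=\sum_{\gamma\subseteq\Gamma,\ \gamma\text{ motic}}\gamma\otimes\Gamma/\gamma,\qquad \epsilon(\Gamma)=1\text{ if }\Gamma=\emptyset,\ \ \epsilon(\Gamma)=0\text{ otherwise}.$$ Fix a dimension $D\in\mathbb R$ and real weights $\omega(v)$, $\omega(e)$ depending on the types of vertices and edges, where a vertex that arises by contraction has weight $0$. Put $\omega(\gamma)=D\cdot\#\mathrm{loops}(\gamma)+\sum_{v}\omega(v)-\sum_e\omega(e)$. (The scalar theory is $D=4$, $\omega(v)=0$, $\omega(e)=2$.) A graph is a *divergent UV-graph* if each of its connected components $\delta$ is 1PI with $\omega(\delta)\ge0$. It is *IR-divergent* if it is scaleless and each of its connected components $\delta$ has $\omega(\delta)\le0$. Let $\rho^{\mathrm{UV}}$ and $\rho^{\mathrm{IR}}$ be the linear maps on $\mathcal M$ that map a motic graph to itself if it is a divergent UV-graph, respectively IR-divergent, and to $0$ otherwise. They are regarded as maps to the subalgebras $\mathcal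 H^{\mathrm{UV}}$ and $\mathcal H^{\mathrm{IR}}$ that are generated by the motic graphs which they keep. Put $I_{\mathrm{UV}}=\ker\rho^{\mathrm{UV}}$, $I_{\mathrm{IR}}=\ker\rho^{\mathrm{IR}}$, $\Delta^{\mathrm{UV}}=(\rho^{\mathrm{UV}}\otimes\mathrm{id})\circ\Delta$ and $\Delta^{\mathrm{IR}}=(\mathrm{id}\otimes\rho^{\mathrm{IR}})\circ\Delta$. **Statement.** $\mathcal M$ with $\Delta$ and $\epsilon$ is a Hopf algebra (for a suitable antipode), and: 1. $I_{\mathrm{UV}}$ and $I_{\mathrm{IR}}$ are Hopf ideals of $\mathcal M$. 2. $\mathcal H^{\mathrm{UV}}$ and $\mathcal H^{\mathrm{IR}}$ are the linear spans of the motic graphs generating them. They have Hopf algebra structures (on their algebra structure as subalgebras of $\mathcal M$) such that $\rho^{\mathrm{UV}}$ and $\rho^{\mathrm{IR}}$ induce isomorphisms of Hopf algebras $\mathcal M/I_{\mathrm{UV}}\cong\mathcal H^{\mathrm{UV}}$ and $\mathcal M/I_{\mathrm{IR}}\cong\mathcal H^{\mathrm{IR}}$. 3. For these structures $\Delta^{\mathrm{UV}}:\mathcal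 M\to\mathcal H^{\mathrm{UV}}\otimes\mathcal M$ is a left coaction and $\Delta^{\mathrm{IR}}:\mathcal M\to\mathcal M\otimes\mathcal H^{\mathrm{IR}}$ is a right coaction (coassociative and counital). For a motic graph $\Gamma$, $\Delta^{\mathrm{UV}}(\Gamma)$ is the sum of $\gamma\otimes\Gamma/\gamma$ over the motic subgraphs $\gamma$ that are divergent UV-graphs, and $\Delta^{\mathrm{IR}}(\Gamma)$ is the sum of $\gamma\otimes\Gamma/\gamma$ over the motic mm subgraphs $\gamma$ such that every connected component $\delta$ of $\Gamma/\gamma$ has $\omega(\delta)\le0$. If all vertex weights are $0$, the IR statements in 1, 2 and 3 hold also when connected components are replaced by biconnected components (blocks), that is, when scaleless graphs are decomposed also at their cut vertices, in the definition of IR-divergent graphs and in the formula for $\Delta^{\mathrm{IR}}$. -/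

import Mathlib

open scoped TensorProduct

namespace Motic

/-- The data entering the superficial degree of divergence: a set of vertex types and a set of edge
types, each type with its weight (the mass dimension of its Feynman rule), and the dimension of
spacetime. `point` is the type of a vertex to which a subgraph has been contracted: it carries no
weight of its own, so it does not contribute to the degree of divergence. The scalar theory is the
case of a single vertex type of weight `0` and a single edge type of weight `2`, in dimension `4`. -/
structure PowerCounting where
  VType : Type
  EType : Type
  dim : ℝ
  vweight : VType → ℝ
  eweight : EType → ℝ
  point : VType
  vweight_point : vweight point = 0

section Incidence

variable {V E : Type}

/-- Two vertices are related when they are joined by a path of edges in `A` (or are equal). -/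
def conn (ends : E → Sym2 V) (A : Set E) : Setoid V :=
  Relation.EqvGen.setoid fun u v => ∃ e ∈ A, u ∈ ends e ∧ v ∈ ends e

/-- The vertices of the subgraph with edge set `A`: the end points of the edges in `A`. -/
def verts (ends : E → Sym2 V) (A : Set E) : Set V := {v | ∃ e ∈ A, v ∈ ends e}

/-- The connected components of the subgraph with edge set `A`. -/
def comps (ends : E → Sym2 V) (A : Set E) : Set (Quotient (conn ends A)) :=
  Quotient.mk (conn ends A) '' verts ends A

/-- The number of loops `#edges - #vertices + #components` of the subgraph with edge set `A`. -/
noncomputable def loops (ends : E → Sym2 V) (A : Set E) : ℤ :=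
  (A.ncard : ℤ) - (verts ends A).ncard + (comps ends A).ncard

theorem conn_mono {ends : E → Sym2 V} {A B : Set E} (h : A ⊆ B) {u v : V}
    (huv : conn ends A u v) : conn ends B u v :=
  Relation.EqvGen.mono (fun _ _ ⟨e, he, h'⟩ => ⟨e, h he, h'⟩) _ _ huv

theorem conn_map {V' E' : Type} {ends : E → Sym2 V} {ends' : E' → Sym2 V'} {A : Set E} {B : Set E'}
    (f : V → V') (h : ∀ e ∈ A, ∃ e' ∈ B, ∀ u ∈ ends e, f u ∈ ends' e') {u v : V}
    (huv : conn ends A u v) : conn ends' B (f u) (f v) := by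
  change Relation.EqvGen _ _ _ at huv
  induction huv with
  | rel x y hxy =>
    obtain ⟨e, he, hx, hy⟩ := hxy
    obtain ⟨e', he', h'⟩ := h e he
    exact .rel _ _ ⟨e', he', h' _ hx, h' _ hy⟩
  | refl x => exact .refl _
  | symm x y _ ih => exact .symm _ _ ih
  | trans x y z _ _ ih1 ih2 => exact .trans _ _ _ ih1 ih2

theorem eq_or_verts_of_conn {ends : E → Sym2 V} {A : Set E} {u v : V} (huv : conn ends A u v) :
    u = v ∨ (u ∈ verts ends A ∧ v ∈ verts ends A) := by
  change Relation.EqvGen _ _ _ at huv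
  induction huv with
  | rel x y hxy =>
    obtain ⟨e, he, hx, hy⟩ := hxy
    exact .inr ⟨⟨e, he, hx⟩, ⟨e, he, hy⟩⟩
  | refl x => exact .inl rfl
  | symm x y _ ih => exact ih.imp Eq.symm And.symm
  | trans x y z _ _ ih1 ih2 =>
    rcases ih1 with rfl | h1
    · exact ih2
    · rcases ih2 with rfl | h2
      · exact .inr h1
      · exact .inr ⟨h1.1, h2.2⟩

/-- Vertices outside the subgraph contribute as much to `#V` as to the number of classes. -/
theorem loops_eq [Finite V] (ends : E → Sym2 V) (A : Set E) :
    loops ends A = (A.ncard : ℤ) - Nat.card V + Nat.card (Quotient (conn ends A)) := by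
  classical
  have h1 := Set.ncard_add_ncard_compl (verts ends A)
  have h2 := Set.ncard_add_ncard_compl (comps ends A)
  have h3 : (comps ends A)ᶜ = Quotient.mk (conn ends A) '' (verts ends A)ᶜ := by
    ext x
    constructor
    · intro hx
      obtain ⟨v, rfl⟩ := Quotient.exists_rep x
      exact ⟨v, fun hv => hx ⟨v, hv, rfl⟩, rfl⟩
    · rintro ⟨v, hv, rfl⟩ ⟨w, hw, hwv⟩
      rcases eq_or_verts_of_conn (Quotient.exact hwv) with rfl | h
      · exact hv hw
      · exact hv h.2
  have h4 : ((comps ends A)ᶜ).ncard = ((verts ends A)ᶜ).ncard := by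
    rw [h3]
    refine Set.InjOn.ncard_image ?_
    intro v hv w hw hvw
    rcases eq_or_verts_of_conn (Quotient.exact hvw) with h | h
    · exact h
    · exact absurd h.1 hv
  unfold loops
  omega

end Incidence

/-- A Feynman graph, possibly disconnected.

The subgraphs of a graph are given by their sets of edges, so that isolated vertices do not count:
the vertices of the graph are the end points of its edges, and `V` is only an ambient set for them.

The masses and external momenta are collected in *scales*. A connected graph that depends on masses
or external momenta has one scale `s`: its set `mass s` of massive edges and its set `ext s` of
external vertices. In a disjoint union every factor keeps its own scale. A component without masses
and external momenta has no scale. Momentum conservation makes a single external vertex equivalent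
to none, so it does not occur. -/
structure FeynmanGraph (T : PowerCounting) where
  V : Type
  E : Type
  S : Type
  finite_V : Finite V
  finite_E : Finite E
  nonempty_V : Nonempty V
  ends : E → Sym2 V
  vtype : V → T.VType
  etype : E → T.EType
  mass : S → Set E
  ext : S → Set V
  /-- the external vertices of one scale lie in one connected component -/
  ext_conn : ∀ s, ∀ u ∈ ext s, ∀ v ∈ ext s, conn ends Set.univ u v
  ext_two : ∀ s, ∀ u ∈ ext s, ∃ v ∈ ext s, v ≠ u
  scale_nonempty : ∀ s, (mass s).Nonempty ∨ (ext s).Nonempty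
  /-- a connected component carries masses and momenta of at most one scale -/
  scale_unique : ∀ s t, ∀ u ∈ ext s ∪ verts ends (mass s), ∀ v ∈ ext t ∪ verts ends (mass t),
    conn ends Set.univ u v → s = t

namespace FeynmanGraph

attribute [instance] finite_V finite_E nonempty_V

variable {T : PowerCounting} (Γ : FeynmanGraph T)

/-- `A` is momentum-spanning for the scale `s`: one of its connected components contains all the
external vertices of `s` (of which there are none or at least two). -/
def MomentumSpanning (A : Set Γ.E) (s : Γ.S) : Prop :=
  ∀ u ∈ Γ.ext s, ∀ v ∈ Γ.ext s, conn Γ.ends A u v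

/-- `A` is mass-spanning for the scale `s`: it contains all the massive edges of `s`. -/
def MassSpanning (A : Set Γ.E) (s : Γ.S) : Prop := Γ.mass s ⊆ A

/-- `A` is mass-momentum-spanning for the scale `s`. -/
def Spanning (A : Set Γ.E) (s : Γ.S) : Prop := Γ.MassSpanning A s ∧ Γ.MomentumSpanning A s

variable {Γ} in
theorem Spanning.mono {A B : Set Γ.E} (h : A ⊆ B) {s : Γ.S} (hs : Γ.Spanning A s) :
    Γ.Spanning B s :=
  ⟨hs.1.trans h, fun u hu v hv => conn_mono h (hs.2 u hu v hv)⟩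

theorem ext_subset_verts (s : Γ.S) : Γ.ext s ⊆ verts Γ.ends Set.univ := by
  intro u hu
  obtain ⟨v, hv, hne⟩ := Γ.ext_two s u hu
  rcases eq_or_verts_of_conn (Γ.ext_conn s u hu v hv) with h | h
  · exact absurd h.symm hne
  · exact h.1

/-- The Feynman graph is motic: every proper subgraph which is mass-momentum-spanning
has strictly fewer loops. -/
def IsMotic : Prop :=
  ∀ B : Set Γ.E, B ≠ Set.univ → (∀ s, Γ.Spanning B s) →
    loops Γ.ends B < loops Γ.ends Set.univ

/-- The subgraph with edge set `A`, as a Feynman graph: it inherits the masses and the external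
momenta of a scale if and only if it is mass-momentum-spanning for that scale. -/
def sub (A : Set Γ.E) : FeynmanGraph T where
  V := Γ.V
  E := A
  S := {s // Γ.Spanning A s}
  finite_V := inferInstance
  finite_E := inferInstance
  nonempty_V := inferInstance
  ends e := Γ.ends e
  vtype := Γ.vtype
  etype e := Γ.etype e
  mass s := {e | (e : Γ.E) ∈ Γ.mass s}
  ext s := Γ.ext s
  ext_conn s u hu v hv :=
    conn_map (B := Set.univ) id (fun e he => ⟨⟨e, he⟩, Set.mem_univ _, fun _ h => h⟩)
      (s.2.2 u hu v hv)
  ext_two s := Γ.ext_two s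
  scale_nonempty s := (Γ.scale_nonempty s).imp (fun ⟨e, he⟩ => ⟨⟨e, s.2.1 he⟩, he⟩) id
  scale_unique := by
    rintro s t u hu v hv huv
    refine Subtype.ext (Γ.scale_unique s t u ?_ v ?_ ?_)
    · exact hu.imp id fun ⟨e, he, h⟩ => ⟨e, he, h⟩
    · exact hv.imp id fun ⟨e, he, h⟩ => ⟨e, he, h⟩
    · exact conn_map (ends := fun e : A => Γ.ends e) (ends' := Γ.ends) (B := Set.univ) id
        (fun e _ => ⟨(e : Γ.E), Set.mem_univ _, fun _ h => h⟩) huv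

/-- The end points of the edges outside `A` after the contraction of the components of `A`. -/
def contractEnds (A : Set Γ.E) (e : {e // e ∉ A}) : Sym2 (Quotient (conn Γ.ends A)) :=
  (Γ.ends e).map (Quotient.mk _)

theorem conn_contract (A : Set Γ.E) (B : Set {e // e ∉ A}) (u v : Γ.V) :
    conn (Γ.contractEnds A) B (Quotient.mk _ u) (Quotient.mk _ v) ↔
      conn Γ.ends (A ∪ Subtype.val '' B) u v := by
  constructor
  · intro h
    have key : ∀ x y, Relation.EqvGen (fun x y => ∃ e ∈ B, x ∈ Γ.contractEnds A e ∧
        y ∈ Γ.contractEnds A e) x y → ∀ u v, Quotient.mk _ u = x → Quotient.mk _ v = y →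
        conn Γ.ends (A ∪ Subtype.val '' B) u v := by
      intro x y hxy
      induction hxy with
      | rel x y hxy =>
        rintro u v rfl rfl
        obtain ⟨e, he, hx, hy⟩ := hxy
        obtain ⟨a, ha, hau⟩ := Sym2.mem_map.1 hx
        obtain ⟨b, hb, hbv⟩ := Sym2.mem_map.1 hy
        have h1 := conn_mono (Set.subset_union_left (t := Subtype.val '' B)) (Quotient.exact hau)
        have h2 := conn_mono (Set.subset_union_left (t := Subtype.val '' B)) (Quotient.exact hbv)
        have h3 : conn Γ.ends (A ∪ Subtype.val '' B) a b :=
          .rel _ _ ⟨e, .inr ⟨e, he, rfl⟩, ha, hb⟩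
        exact Setoid.trans' _ (Setoid.symm' _ h1) (Setoid.trans' _ h3 h2)
      | refl x =>
        rintro u v rfl huv
        exact conn_mono Set.subset_union_left (Quotient.exact huv.symm)
      | symm x y _ ih => exact fun u v hu hv => Setoid.symm' _ (ih v u hv hu)
      | trans x y z _ _ ih1 ih2 =>
        intro u v hu hv
        obtain ⟨w, hw⟩ := Quotient.exists_rep y
        exact Setoid.trans' _ (ih1 u w hu hw) (ih2 w v hw hv)
    exact key _ _ h u v rfl rfl
  · intro h
    change Relation.EqvGen _ _ _ at h
    induction h with
    | rel x y hxy =>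
      obtain ⟨e, he | ⟨e, he, rfl⟩, hx, hy⟩ := hxy
      · have : Quotient.mk (conn Γ.ends A) x = Quotient.mk _ y :=
          Quotient.sound (.rel _ _ ⟨e, he, hx, hy⟩)
        rw [this]
      · exact .rel _ _ ⟨e, he, Sym2.mem_map.2 ⟨x, hx, rfl⟩, Sym2.mem_map.2 ⟨y, hy, rfl⟩⟩
    | refl x => exact .refl _
    | symm x y _ ih => exact .symm _ _ ih
    | trans x y z _ _ ih1 ih2 => exact .trans _ _ _ ih1 ih2

open Classical in
/-- The contracted graph `Γ/γ`, where `γ` has edge set `A`: every connected component of `γ` is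
contracted to a vertex. The contracted graph keeps the scales for which `γ` is not
mass-momentum-spanning, with those massive edges that are not in `γ`. If `γ` is momentum-spanning,
all external vertices of the scale are contracted into one, so that none is left. -/
noncomputable def contract (A : Set Γ.E) : FeynmanGraph T where
  V := Quotient (conn Γ.ends A)
  E := {e // e ∉ A}
  S := {s // ¬ Γ.Spanning A s}
  finite_V := inferInstance
  finite_E := inferInstance
  nonempty_V := Γ.nonempty_V.map (Quotient.mk _)
  ends := Γ.contractEnds A
  vtype x := if x ∈ comps Γ.ends A then T.point else Γ.vtype x.out
  etype e := Γ.etype e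
  mass s := {e | (e : Γ.E) ∈ Γ.mass s}
  ext s := {x | ¬ Γ.MomentumSpanning A s ∧ ∃ u ∈ Γ.ext s, Quotient.mk _ u = x}
  ext_conn := by
    rintro s _ ⟨_, u, hu, rfl⟩ _ ⟨_, v, hv, rfl⟩
    exact (Γ.conn_contract A _ u v).2 (conn_mono
      (fun e _ => (_root_.em (e ∈ A)).imp id fun h => ⟨⟨e, h⟩, trivial, rfl⟩) (Γ.ext_conn s u hu v hv))
  ext_two := by
    rintro s _ ⟨h, u, hu, rfl⟩
    by_contra! hc
    refine h fun v hv w hw => ?_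
    have h1 := Quotient.exact (hc _ ⟨h, v, hv, rfl⟩)
    have h2 := Quotient.exact (hc _ ⟨h, w, hw, rfl⟩)
    exact Setoid.trans' _ h1 (Setoid.symm' _ h2)
  scale_nonempty := by
    rintro ⟨s, hs⟩
    by_cases hm : Γ.MomentumSpanning A s
    · have : ¬ Γ.mass s ⊆ A := fun h => hs ⟨h, hm⟩
      obtain ⟨e, he, heA⟩ := Set.not_subset.1 this
      exact .inl ⟨⟨e, heA⟩, he⟩
    · have : (Γ.ext s).Nonempty := by
        by_contra! h
        exact hm fun u hu => by simp [h] at hu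
      obtain ⟨u, hu⟩ := this
      exact .inr ⟨Quotient.mk _ u, hm, u, hu, rfl⟩
  scale_unique := by
    have key : ∀ s : {s // ¬ Γ.Spanning A s},
        ∀ x ∈ {x | ¬ Γ.MomentumSpanning A s ∧ ∃ u ∈ Γ.ext s, Quotient.mk (conn Γ.ends A) u = x} ∪
          verts (Γ.contractEnds A) {e | (e : Γ.E) ∈ Γ.mass s},
        ∃ u ∈ Γ.ext s ∪ verts Γ.ends (Γ.mass s), Quotient.mk (conn Γ.ends A) u = x := by
      rintro s x (⟨_, u, hu, rfl⟩ | ⟨e, he, hx⟩)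
      · exact ⟨u, .inl hu, rfl⟩
      · obtain ⟨a, ha, rfl⟩ := Sym2.mem_map.1 hx
        exact ⟨a, .inr ⟨e, he, ha⟩, rfl⟩
    intro s t x hx y hy hxy
    obtain ⟨u, hu, rfl⟩ := key s x hx
    obtain ⟨v, hv, rfl⟩ := key t y hy
    exact Subtype.ext (Γ.scale_unique s t u hu v hv
      (conn_mono (Set.subset_univ _) ((Γ.conn_contract A _ u v).1 hxy)))

theorem loops_contract (A : Set Γ.E) (B : Set {e // e ∉ A}) :
    loops (Γ.contractEnds A) B =
      loops Γ.ends (A ∪ Subtype.val '' B) - loops Γ.ends A := by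
  have e : Nat.card (Quotient (conn (Γ.contractEnds A) B)) =
      Nat.card (Quotient (conn Γ.ends (A ∪ Subtype.val '' B))) := by
    symm
    refine Nat.card_eq_of_bijective (Quotient.map' (Quotient.mk _)
      fun u v h => (Γ.conn_contract A B u v).2 h) ⟨?_, ?_⟩
    · intro x y
      induction x using Quotient.inductionOn
      induction y using Quotient.inductionOn
      intro h
      exact Quotient.sound ((Γ.conn_contract A B _ _).1 (Quotient.exact h))
    · intro x
      induction x using Quotient.inductionOn with | _ x => ?_
      induction x using Quotient.inductionOn with | _ x => ?_
      exact ⟨Quotient.mk _ x, rfl⟩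
  have hc : (A ∪ Subtype.val '' B).ncard = A.ncard + B.ncard := by
    rw [Set.ncard_union_eq, Set.ncard_image_of_injective _ Subtype.val_injective]
    rw [Set.disjoint_left]
    rintro x hx ⟨y, _, rfl⟩
    exact y.2 hx
  rw [loops_eq, loops_eq, loops_eq, e, hc]
  push_cast
  ring

theorem IsMotic.contract {Γ : FeynmanGraph T} (h : Γ.IsMotic) (A : Set Γ.E) :
    (Γ.contract A).IsMotic := by
  intro B hB hs
  have hu : A ∪ Subtype.val '' (Set.univ : Set {e // e ∉ A}) = Set.univ := by
    ext e; by_cases he : e ∈ A <;> simp [he]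
  have hlt : loops Γ.ends (A ∪ Subtype.val '' B) < loops Γ.ends Set.univ := by
    refine h _ ?_ ?_
    · intro hAB
      refine hB (Set.eq_univ_of_forall fun (e : {e // e ∉ A}) => ?_)
      have : (e : Γ.E) ∈ A ∪ Subtype.val '' B := hAB ▸ Set.mem_univ _
      rcases this with h | ⟨e', he', h⟩
      · exact absurd h e.2
      · exact Subtype.ext h ▸ he'
    · intro s
      by_cases hA : Γ.Spanning A s
      · exact hA.mono Set.subset_union_left
      · obtain ⟨h1, h2⟩ := hs ⟨s, hA⟩
        refine ⟨fun e he => ?_, ?_⟩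
        · by_cases heA : e ∈ A
          · exact .inl heA
          · exact .inr ⟨⟨e, heA⟩, h1 (show (⟨e, heA⟩ : {e // e ∉ A}) ∈ _ from he), rfl⟩
        · by_cases hm : Γ.MomentumSpanning A s
          · exact fun u hu v hv => conn_mono Set.subset_union_left (hm u hu v hv)
          · exact fun u hu v hv => (Γ.conn_contract A B u v).1
              (h2 _ ⟨hm, u, hu, rfl⟩ _ ⟨hm, v, hv, rfl⟩)
  have h1 := Γ.loops_contract A B
  have h2 := Γ.loops_contract A Set.univ
  rw [hu] at h2
  change loops (Γ.contractEnds A) B < loops (Γ.contractEnds A) Set.univ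
  omega

/-- The end points in the disjoint union of two graphs. -/
def sumEnds {V E V' E' : Type} (p : E → Sym2 V) (q : E' → Sym2 V') : E ⊕ E' → Sym2 (V ⊕ V') :=
  Sum.elim (fun e => (p e).map Sum.inl) (fun e => (q e).map Sum.inr)

theorem inl_mem_sumEnds {V E V' E' : Type} {p : E → Sym2 V} {q : E' → Sym2 V'} {e : E ⊕ E'}
    {u : V} : Sum.inl u ∈ sumEnds p q e ↔ ∃ a, e = Sum.inl a ∧ u ∈ p a := by
  rcases e with e | e <;> simp [sumEnds, Sym2.mem_map]

theorem inr_mem_sumEnds {V E V' E' : Type} {p : E → Sym2 V} {q : E' → Sym2 V'} {e : E ⊕ E'}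
    {u : V'} : Sum.inr u ∈ sumEnds p q e ↔ ∃ a, e = Sum.inr a ∧ u ∈ q a := by
  rcases e with e | e <;> simp [sumEnds, Sym2.mem_map]

theorem conn_sum {V E V' E' : Type} {p : E → Sym2 V} {q : E' → Sym2 V'} {B : Set (E ⊕ E')}
    {x y : V ⊕ V'} : conn (sumEnds p q) B x y ↔
      Sum.LiftRel (fun u v => conn p (Sum.inl ⁻¹' B) u v)
        (fun u v => conn q (Sum.inr ⁻¹' B) u v) x y := by
  constructor
  · intro h
    change Relation.EqvGen _ _ _ at h
    induction h with
    | rel x y h =>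
      obtain ⟨e, he, hx, hy⟩ := h
      rcases x with x | x <;> rcases y with y | y
      · rw [inl_mem_sumEnds] at hx hy
        obtain ⟨a, rfl, ha⟩ := hx
        obtain ⟨b, hb, hb'⟩ := hy
        cases hb
        exact .inl (.rel _ _ ⟨a, he, ha, hb'⟩)
      · rw [inl_mem_sumEnds] at hx
        rw [inr_mem_sumEnds] at hy
        obtain ⟨a, rfl, ha⟩ := hx
        obtain ⟨b, hb, hb'⟩ := hy
        cases hb
      · rw [inr_mem_sumEnds] at hx
        rw [inl_mem_sumEnds] at hy
        obtain ⟨a, rfl, ha⟩ := hx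
        obtain ⟨b, hb, hb'⟩ := hy
        cases hb
      · rw [inr_mem_sumEnds] at hx hy
        obtain ⟨a, rfl, ha⟩ := hx
        obtain ⟨b, hb, hb'⟩ := hy
        cases hb
        exact .inr (.rel _ _ ⟨a, he, ha, hb'⟩)
    | refl x =>
      rcases x with x | x
      · exact .inl (.refl _)
      · exact .inr (.refl _)
    | symm x y _ ih =>
      rcases ih with h | h
      · exact .inl (Setoid.symm' _ h)
      · exact .inr (Setoid.symm' _ h)
    | trans x y z _ _ ih1 ih2 =>
      rcases ih1 with h | h <;> rcases ih2 with h' | h'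
      · exact .inl (Setoid.trans' _ h h')
      · exact .inr (Setoid.trans' _ h h')
  · rintro (h | h)
    · exact conn_map Sum.inl (fun e he => ⟨Sum.inl e, he, fun u hu =>
        inl_mem_sumEnds.2 ⟨e, rfl, hu⟩⟩) h
    · exact conn_map Sum.inr (fun e he => ⟨Sum.inr e, he, fun u hu =>
        inr_mem_sumEnds.2 ⟨e, rfl, hu⟩⟩) h

theorem loops_sum {V E V' E' : Type} [Finite V] [Finite V'] [Finite E] [Finite E']
    (p : E → Sym2 V) (q : E' → Sym2 V') (B : Set (E ⊕ E')) :
    loops (sumEnds p q) B = loops p (Sum.inl ⁻¹' B) + loops q (Sum.inr ⁻¹' B) := by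
  have e : Nat.card (Quotient (conn (sumEnds p q) B)) =
      Nat.card (Quotient (conn p (Sum.inl ⁻¹' B)) ⊕ Quotient (conn q (Sum.inr ⁻¹' B))) := by
    symm
    refine Nat.card_eq_of_bijective (Sum.elim
      (Quotient.map' Sum.inl fun u v h => conn_sum.2 (.inl h))
      (Quotient.map' Sum.inr fun u v h => conn_sum.2 (.inr h))) ⟨?_, ?_⟩
    · rintro (x | x) (y | y) h <;> induction x using Quotient.inductionOn <;>
        induction y using Quotient.inductionOn <;> have h' := conn_sum.1 (Quotient.exact h) <;>
        rcases h' with h' | h'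
      · exact congrArg Sum.inl (Quotient.sound h')
      · exact congrArg Sum.inr (Quotient.sound h')
    · intro x
      induction x using Quotient.inductionOn with | _ x => ?_
      rcases x with x | x
      · exact ⟨.inl (Quotient.mk _ x), rfl⟩
      · exact ⟨.inr (Quotient.mk _ x), rfl⟩
  have hB : B = Sum.inl '' (Sum.inl ⁻¹' B) ∪ Sum.inr '' (Sum.inr ⁻¹' B) := by
    ext x; rcases x with x | x <;> simp
  have hc : B.ncard = (Sum.inl ⁻¹' B : Set E).ncard + (Sum.inr ⁻¹' B : Set E').ncard := by
    conv_lhs => rw [hB]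
    rw [Set.ncard_union_eq, Set.ncard_image_of_injective _ Sum.inl_injective,
      Set.ncard_image_of_injective _ Sum.inr_injective]
    rw [Set.disjoint_left]
    rintro x ⟨y, _, rfl⟩ ⟨z, _, h⟩
    cases h
  rw [loops_eq, loops_eq, loops_eq, e, hc, Nat.card_sum, Nat.card_sum]
  push_cast
  ring

/-- The disjoint union of two Feynman graphs. -/
def sum (Γ Γ' : FeynmanGraph T) : FeynmanGraph T where
  V := Γ.V ⊕ Γ'.V
  E := Γ.E ⊕ Γ'.E
  S := Γ.S ⊕ Γ'.S
  finite_V := inferInstance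
  finite_E := inferInstance
  nonempty_V := inferInstance
  ends := sumEnds Γ.ends Γ'.ends
  vtype := Sum.elim Γ.vtype Γ'.vtype
  etype := Sum.elim Γ.etype Γ'.etype
  mass := Sum.elim (fun s => Sum.inl '' Γ.mass s) (fun s => Sum.inr '' Γ'.mass s)
  ext := Sum.elim (fun s => Sum.inl '' Γ.ext s) (fun s => Sum.inr '' Γ'.ext s)
  ext_conn := by
    rintro (s | s) _ ⟨u, hu, rfl⟩ _ ⟨v, hv, rfl⟩
    · exact conn_sum.2 (.inl (Γ.ext_conn s u hu v hv))
    · exact conn_sum.2 (.inr (Γ'.ext_conn s u hu v hv))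
  ext_two := by
    rintro (s | s) _ ⟨u, hu, rfl⟩
    · obtain ⟨v, hv, h⟩ := Γ.ext_two s u hu
      exact ⟨_, ⟨v, hv, rfl⟩, by simpa using h⟩
    · obtain ⟨v, hv, h⟩ := Γ'.ext_two s u hu
      exact ⟨_, ⟨v, hv, rfl⟩, by simpa using h⟩
  scale_nonempty := by
    rintro (s | s)
    · exact (Γ.scale_nonempty s).imp (·.image _) (·.image _)
    · exact (Γ'.scale_nonempty s).imp (·.image _) (·.image _)
  scale_unique := by
    have hl : ∀ s : Γ.S, ∀ x ∈ Sum.inl '' Γ.ext s ∪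
        verts (sumEnds Γ.ends Γ'.ends) (Sum.inl '' Γ.mass s),
        ∃ u ∈ Γ.ext s ∪ verts Γ.ends (Γ.mass s), x = Sum.inl u := by
      rintro s x (⟨u, hu, rfl⟩ | ⟨_, ⟨e, he, rfl⟩, hx⟩)
      · exact ⟨u, .inl hu, rfl⟩
      · rcases x with x | x
        · obtain ⟨a, ha, h⟩ := inl_mem_sumEnds.1 hx
          cases ha
          exact ⟨x, .inr ⟨e, he, h⟩, rfl⟩
        · obtain ⟨a, ha, h⟩ := inr_mem_sumEnds.1 hx
          cases ha
    have hr : ∀ s : Γ'.S, ∀ x ∈ Sum.inr '' Γ'.ext s ∪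
        verts (sumEnds Γ.ends Γ'.ends) (Sum.inr '' Γ'.mass s),
        ∃ u ∈ Γ'.ext s ∪ verts Γ'.ends (Γ'.mass s), x = Sum.inr u := by
      rintro s x (⟨u, hu, rfl⟩ | ⟨_, ⟨e, he, rfl⟩, hx⟩)
      · exact ⟨u, .inl hu, rfl⟩
      · rcases x with x | x
        · obtain ⟨a, ha, h⟩ := inl_mem_sumEnds.1 hx
          cases ha
        · obtain ⟨a, ha, h⟩ := inr_mem_sumEnds.1 hx
          cases ha
          exact ⟨x, .inr ⟨e, he, h⟩, rfl⟩
    rintro (s | s) (t | t) x hx y hy hxy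
    · obtain ⟨u, hu, rfl⟩ := hl s x hx
      obtain ⟨v, hv, rfl⟩ := hl t y hy
      rcases conn_sum.1 hxy with h | h
      exact congrArg _ (Γ.scale_unique s t u hu v hv h)
    · obtain ⟨u, hu, rfl⟩ := hl s x hx
      obtain ⟨v, hv, rfl⟩ := hr t y hy
      cases conn_sum.1 hxy
    · obtain ⟨u, hu, rfl⟩ := hr s x hx
      obtain ⟨v, hv, rfl⟩ := hl t y hy
      cases conn_sum.1 hxy
    · obtain ⟨u, hu, rfl⟩ := hr s x hx
      obtain ⟨v, hv, rfl⟩ := hr t y hy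
      rcases conn_sum.1 hxy with h | h
      exact congrArg _ (Γ'.scale_unique s t u hu v hv h)

theorem IsMotic.sum {Γ Γ' : FeynmanGraph T} (h : Γ.IsMotic) (h' : Γ'.IsMotic) :
    (Γ.sum Γ').IsMotic := by
  intro B hB hs
  have hl : ∀ s, Γ.Spanning (Sum.inl ⁻¹' B) s := by
    intro s
    obtain ⟨h1, h2⟩ := hs (.inl s)
    refine ⟨fun e he => h1 ⟨e, he, rfl⟩, fun u hu v hv => ?_⟩
    rcases conn_sum.1 (h2 _ ⟨u, hu, rfl⟩ _ ⟨v, hv, rfl⟩) with h | h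
    exact h
  have hr : ∀ s, Γ'.Spanning (Sum.inr ⁻¹' B) s := by
    intro s
    obtain ⟨h1, h2⟩ := hs (.inr s)
    refine ⟨fun e he => h1 ⟨e, he, rfl⟩, fun u hu v hv => ?_⟩
    rcases conn_sum.1 (h2 _ ⟨u, hu, rfl⟩ _ ⟨v, hv, rfl⟩) with h | h
    exact h
  have e1 : loops (sumEnds Γ.ends Γ'.ends) B = _ := loops_sum Γ.ends Γ'.ends B
  have e2 : loops (sumEnds Γ.ends Γ'.ends) Set.univ = _ := loops_sum Γ.ends Γ'.ends Set.univ
  rw [Set.preimage_univ, Set.preimage_univ] at e2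
  change loops (sumEnds Γ.ends Γ'.ends) B < loops (sumEnds Γ.ends Γ'.ends) Set.univ
  have l1 := h (Sum.inl ⁻¹' B)
  have l2 := h' (Sum.inr ⁻¹' B)
  by_cases c1 : (Sum.inl ⁻¹' B : Set Γ.E) = Set.univ <;>
    by_cases c2 : (Sum.inr ⁻¹' B : Set Γ'.E) = Set.univ
  · refine absurd (Set.eq_univ_of_forall ?_) hB
    rintro (e | e)
    · exact (c1 ▸ Set.mem_univ e : e ∈ (Sum.inl ⁻¹' B : Set Γ.E))
    · exact (c2 ▸ Set.mem_univ e : e ∈ (Sum.inr ⁻¹' B : Set Γ'.E))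
  · have := l2 c2 hr
    rw [c1] at e1
    omega
  · have := l1 c1 hl
    rw [c2] at e1
    omega
  · have := l1 c1 hl
    have := l2 c2 hr
    omega

/-- The empty graph. -/
def empty (T : PowerCounting) : FeynmanGraph T where
  V := Unit
  E := Empty
  S := Empty
  finite_V := inferInstance
  finite_E := inferInstance
  nonempty_V := inferInstance
  ends := Empty.elim
  vtype _ := T.point
  etype := Empty.elim
  mass := Empty.elim
  ext := Empty.elim
  ext_conn s := s.elim
  ext_two s := s.elim
  scale_nonempty s := s.elim
  scale_unique s := s.elim

theorem isMotic_empty : (empty T).IsMotic := by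
  intro B hB
  exact absurd (Set.eq_univ_of_forall fun e : Empty => e.elim) hB

/-- An isomorphism of Feynman graphs: bijections between the edges, between the scales and between
the end points of edges (for the latter, `f` and `g` are mutually inverse on the end points of
edges, and their values elsewhere are irrelevant), compatible with all the structure. -/
structure Iso (Γ Γ' : FeynmanGraph T) where
  f : Γ.V → Γ'.V
  g : Γ'.V → Γ.V
  φ : Γ.E ≃ Γ'.E
  σ : Γ.S ≃ Γ'.S
  gf : ∀ e, ∀ u ∈ Γ.ends e, g (f u) = u
  fg : ∀ e, ∀ u ∈ Γ'.ends e, f (g u) = u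
  ends : ∀ e, Γ'.ends (φ e) = (Γ.ends e).map f
  vtype : ∀ e, ∀ u ∈ Γ.ends e, Γ'.vtype (f u) = Γ.vtype u
  etype : ∀ e, Γ'.etype (φ e) = Γ.etype e
  mass : ∀ s, Γ'.mass (σ s) = φ '' Γ.mass s
  ext : ∀ s, Γ'.ext (σ s) = f '' Γ.ext s

section Images

variable {α β γ δ β' : Type}

theorem im2 {f : α → β} {g : β → γ} {h : α → γ} (H : ∀ x, h x = g (f x)) (A : Set α) :
    h '' A = g '' (f '' A) := by
  rw [Set.image_image]; exact Set.image_congr fun x _ => H x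

theorem im3 {f : α → β} {g : β → γ} {k : γ → δ} {h : α → δ} (H : ∀ x, h x = k (g (f x)))
    (A : Set α) : h '' A = k '' (g '' (f '' A)) := by
  rw [Set.image_image, Set.image_image]; exact Set.image_congr fun x _ => H x

theorem im22 {f : α → β} {g : β → γ} {a : α → β'} {b : β' → γ} (H : ∀ x, b (a x) = g (f x))
    (A : Set α) : b '' (a '' A) = g '' (f '' A) := by
  rw [Set.image_image, Set.image_image]; exact Set.image_congr fun x _ => H x

theorem im23 {f : α → β} {g : β → γ} {k : γ → δ} {a : α → β'} {b : β' → δ}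
    (H : ∀ x, b (a x) = k (g (f x))) (A : Set α) : b '' (a '' A) = k '' (g '' (f '' A)) := by
  rw [Set.image_image, Set.image_image, Set.image_image]; exact Set.image_congr fun x _ => H x

theorem sm2 {f : α → β} {g : β → γ} {h : α → γ} (H : ∀ x, h x = g (f x)) (A : Sym2 α) :
    A.map h = (A.map f).map g := by
  rw [Sym2.map_map]; exact Sym2.map_congr fun x _ => H x

theorem sm3 {f : α → β} {g : β → γ} {k : γ → δ} {h : α → δ} (H : ∀ x, h x = k (g (f x)))
    (A : Sym2 α) : A.map h = ((A.map f).map g).map k := by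
  rw [Sym2.map_map, Sym2.map_map]; exact Sym2.map_congr fun x _ => H x

theorem sm22 {f : α → β} {g : β → γ} {a : α → β'} {b : β' → γ} (H : ∀ x, b (a x) = g (f x))
    (A : Sym2 α) : (A.map a).map b = (A.map f).map g := by
  rw [Sym2.map_map, Sym2.map_map]; exact Sym2.map_congr fun x _ => H x

theorem sm23 {f : α → β} {g : β → γ} {k : γ → δ} {a : α → β'} {b : β' → δ}
    (H : ∀ x, b (a x) = k (g (f x))) (A : Sym2 α) :
    (A.map a).map b = ((A.map f).map g).map k := by
  rw [Sym2.map_map, Sym2.map_map, Sym2.map_map]; exact Sym2.map_congr fun x _ => H x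

end Images

namespace Iso

variable {Γ Γ' Γ'' Γ₃ : FeynmanGraph T}

/-- The identity. -/
def refl (Γ : FeynmanGraph T) : Iso Γ Γ where
  f := id
  g := id
  φ := .refl _
  σ := .refl _
  gf _ _ _ := rfl
  fg _ _ _ := rfl
  ends e := by simp
  vtype _ _ _ := rfl
  etype _ := rfl
  mass s := by simp
  ext s := by simp

theorem gf_ext (i : Iso Γ Γ') {s : Γ.S} {u : Γ.V} (hu : u ∈ Γ.ext s) : i.g (i.f u) = u := by
  obtain ⟨e, _, h⟩ := Γ.ext_subset_verts s hu
  exact i.gf e u h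

theorem mem_ends (i : Iso Γ Γ') {e : Γ.E} {u : Γ.V} (hu : u ∈ Γ.ends e) :
    i.f u ∈ Γ'.ends (i.φ e) := by
  rw [i.ends]; exact Sym2.mem_map.2 ⟨u, hu, rfl⟩

/-- The inverse. -/
def symm (i : Iso Γ Γ') : Iso Γ' Γ where
  f := i.g
  g := i.f
  φ := i.φ.symm
  σ := i.σ.symm
  gf := i.fg
  fg := i.gf
  ends e := by
    obtain ⟨e, rfl⟩ := i.φ.surjective e
    rw [i.ends, Equiv.symm_apply_apply, Sym2.map_map, Sym2.map_congr (g := id), Sym2.map_id]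
    · rfl
    · exact fun u hu => i.gf e u hu
  vtype e u hu := by
    obtain ⟨e, rfl⟩ := i.φ.surjective e
    rw [i.ends] at hu
    obtain ⟨v, hv, rfl⟩ := Sym2.mem_map.1 hu
    rw [i.gf e v hv, i.vtype e v hv]
  etype e := by
    obtain ⟨e, rfl⟩ := i.φ.surjective e
    rw [i.etype, Equiv.symm_apply_apply]
  mass s := by
    obtain ⟨s, rfl⟩ := i.σ.surjective s
    rw [i.mass, Equiv.symm_apply_apply, ← Set.image_comp]
    simp
  ext s := by
    obtain ⟨s, rfl⟩ := i.σ.surjective s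
    rw [i.ext, Equiv.symm_apply_apply, ← Set.image_comp]
    refine Eq.symm ((Set.image_congr fun u hu => ?_).trans (Set.image_id _))
    exact i.gf_ext hu

/-- The composition. -/
def trans (i : Iso Γ Γ') (j : Iso Γ' Γ'') : Iso Γ Γ'' where
  f := j.f ∘ i.f
  g := i.g ∘ j.g
  φ := i.φ.trans j.φ
  σ := i.σ.trans j.σ
  gf e u hu := by
    change i.g (j.g (j.f (i.f u))) = u
    rw [j.gf _ _ (i.mem_ends hu), i.gf e u hu]
  fg e u hu := by
    change j.f (i.f (i.g (j.g u))) = u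
    have h : j.g u ∈ Γ'.ends (j.φ.symm e) := j.symm.mem_ends hu
    rw [i.fg _ _ h]
    exact j.fg e u hu
  ends e := by
    change Γ''.ends (j.φ (i.φ e)) = _
    rw [j.ends, i.ends, Sym2.map_map]
  vtype e u hu := (j.vtype _ _ (i.mem_ends hu)).trans (i.vtype e u hu)
  etype e := (j.etype _).trans (i.etype e)
  mass s := by
    change Γ''.mass (j.σ (i.σ s)) = _
    rw [j.mass, i.mass]
    exact (im2 (by intro _; rfl) _).symm
  ext s := by
    change Γ''.ext (j.σ (i.σ s)) = _
    rw [j.ext, i.ext, ← Set.image_comp]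

/-- The disjoint union of isomorphisms. -/
def sum (i : Iso Γ Γ') (j : Iso Γ'' Γ₃) : Iso (Γ.sum Γ'') (Γ'.sum Γ₃) where
  f := Sum.map i.f j.f
  g := Sum.map i.g j.g
  φ := i.φ.sumCongr j.φ
  σ := i.σ.sumCongr j.σ
  gf := by
    rintro e (u | u) hu
    · obtain ⟨a, _, h⟩ := inl_mem_sumEnds.1 hu
      exact congrArg Sum.inl (i.gf a u h)
    · obtain ⟨a, _, h⟩ := inr_mem_sumEnds.1 hu
      exact congrArg Sum.inr (j.gf a u h)
  fg := by
    rintro e (u | u) hu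
    · obtain ⟨a, _, h⟩ := inl_mem_sumEnds.1 hu
      exact congrArg Sum.inl (i.fg a u h)
    · obtain ⟨a, _, h⟩ := inr_mem_sumEnds.1 hu
      exact congrArg Sum.inr (j.fg a u h)
  ends := by
    rintro (e | e)
    · exact (congrArg (Sym2.map Sum.inl) (i.ends e)).trans (sm22 (by intro _; rfl) _)
    · exact (congrArg (Sym2.map Sum.inr) (j.ends e)).trans (sm22 (by intro _; rfl) _)
  vtype := by
    rintro e (u | u) hu
    · obtain ⟨a, _, h⟩ := inl_mem_sumEnds.1 hu
      exact i.vtype a u h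
    · obtain ⟨a, _, h⟩ := inr_mem_sumEnds.1 hu
      exact j.vtype a u h
  etype := by
    rintro (e | e)
    · exact i.etype e
    · exact j.etype e
  mass := by
    rintro (s | s)
    · exact (congrArg (Sum.inl '' ·) (i.mass s)).trans (im22 (by intro _; rfl) _)
    · exact (congrArg (Sum.inr '' ·) (j.mass s)).trans (im22 (by intro _; rfl) _)
  ext := by
    rintro (s | s)
    · exact (congrArg (Sum.inl '' ·) (i.ext s)).trans (im22 (by intro _; rfl) _)
    · exact (congrArg (Sum.inr '' ·) (j.ext s)).trans (im22 (by intro _; rfl) _)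

/-- The disjoint union is commutative. -/
def sumComm (Γ Γ' : FeynmanGraph T) : Iso (Γ.sum Γ') (Γ'.sum Γ) where
  f := Sum.swap
  g := Sum.swap
  φ := Equiv.sumComm _ _
  σ := Equiv.sumComm _ _
  gf _ u _ := Sum.swap_swap u
  fg _ u _ := Sum.swap_swap u
  ends := by
    rintro (e | e)
    · exact sm2 (by intro _; rfl) _
    · exact sm2 (by intro _; rfl) _
  vtype := by rintro e (u | u) _ <;> rfl
  etype := by rintro (e | e) <;> rfl
  mass := by
    rintro (s | s)
    · exact im2 (by intro _; rfl) _
    · exact im2 (by intro _; rfl) _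
  ext := by
    rintro (s | s)
    · exact im2 (by intro _; rfl) _
    · exact im2 (by intro _; rfl) _

/-- The disjoint union is associative. -/
def sumAssoc (Γ Γ' Γ'' : FeynmanGraph T) :
    Iso ((Γ.sum Γ').sum Γ'') (Γ.sum (Γ'.sum Γ'')) where
  f := Equiv.sumAssoc _ _ _
  g := (Equiv.sumAssoc _ _ _).symm
  φ := Equiv.sumAssoc _ _ _
  σ := Equiv.sumAssoc _ _ _
  gf _ u _ := Equiv.symm_apply_apply _ u
  fg _ u _ := Equiv.apply_symm_apply _ u
  ends := by
    rintro ((e | e) | e)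
    · exact sm3 (by intro _; rfl) _
    · exact sm23 (by intro _; rfl) _
    · exact sm22 (by intro _; rfl) _
  vtype := by rintro e ((u | u) | u) _ <;> rfl
  etype := by rintro ((e | e) | e) <;> rfl
  mass := by
    rintro ((s | s) | s)
    · exact im3 (by intro _; rfl) _
    · exact im23 (by intro _; rfl) _
    · exact im22 (by intro _; rfl) _
  ext := by
    rintro ((s | s) | s)
    · exact im3 (by intro _; rfl) _
    · exact im23 (by intro _; rfl) _
    · exact im22 (by intro _; rfl) _

/-- The empty graph is neutral for the disjoint union. -/
noncomputable def emptySum (Γ : FeynmanGraph T) : Iso ((empty T).sum Γ) Γ where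
  f := Sum.elim (fun _ => Classical.arbitrary _) id
  g := Sum.inr
  φ := Equiv.emptySum Empty Γ.E
  σ := Equiv.emptySum Empty Γ.S
  gf := by
    rintro e (u | u) hu
    · obtain ⟨a, _⟩ := inl_mem_sumEnds.1 hu
      exact a.elim
    · rfl
  fg _ _ _ := rfl
  ends := by
    rintro (e | e)
    · exact e.elim
    · exact (congrFun Sym2.map_id _).symm.trans (sm2 (by intro _; rfl) _)
  vtype := by
    rintro e (u | u) hu
    · obtain ⟨a, _⟩ := inl_mem_sumEnds.1 hu
      exact a.elim
    · rfl
  etype := by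
    rintro (e | e)
    · exact e.elim
    · rfl
  mass := by
    rintro (s | s)
    · exact s.elim
    · exact (Set.image_id _).symm.trans (im2 (by intro _; rfl) _)
  ext := by
    rintro (s | s)
    · exact s.elim
    · exact (Set.image_id _).symm.trans (im2 (by intro _; rfl) _)

theorem conn_f (i : Iso Γ Γ') {A : Set Γ.E} {u v : Γ.V} (h : conn Γ.ends A u v) :
    conn Γ'.ends (i.φ '' A) (i.f u) (i.f v) :=
  conn_map (B := i.φ '' A) i.f
    (fun e he => ⟨i.φ e, Set.mem_image_of_mem _ he, fun _ hu => i.mem_ends hu⟩) h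

theorem conn_g (i : Iso Γ Γ') {A : Set Γ.E} {u v : Γ'.V} (h : conn Γ'.ends (i.φ '' A) u v) :
    conn Γ.ends A (i.g u) (i.g v) := by
  refine conn_map i.g ?_ h
  rintro _ ⟨e, he, rfl⟩
  refine ⟨e, he, fun u hu => ?_⟩
  simpa [symm] using i.symm.mem_ends hu

theorem verts_image (i : Iso Γ Γ') (A : Set Γ.E) :
    verts Γ'.ends (i.φ '' A) = i.f '' verts Γ.ends A := by
  ext v
  constructor
  · rintro ⟨_, ⟨e, he, rfl⟩, h⟩
    rw [i.ends] at h
    obtain ⟨u, hu, rfl⟩ := Sym2.mem_map.1 h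
    exact ⟨u, ⟨e, he, hu⟩, rfl⟩
  · rintro ⟨u, ⟨e, he, hu⟩, rfl⟩
    exact ⟨_, ⟨e, he, rfl⟩, i.mem_ends hu⟩

theorem comps_image (i : Iso Γ Γ') (A : Set Γ.E) :
    comps Γ'.ends (i.φ '' A) =
      Quotient.map' i.f (fun _ _ h => i.conn_f (A := A) h) '' comps Γ.ends A := by
  unfold comps
  rw [i.verts_image, ← Set.image_comp, ← Set.image_comp]
  rfl

theorem gf_verts (i : Iso Γ Γ') {A : Set Γ.E} {u : Γ.V} (hu : u ∈ verts Γ.ends A) :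
    i.g (i.f u) = u := by
  obtain ⟨e, _, h⟩ := hu
  exact i.gf e u h

theorem loops_image (i : Iso Γ Γ') (A : Set Γ.E) :
    loops Γ'.ends (i.φ '' A) = loops Γ.ends A := by
  unfold loops
  rw [Set.ncard_image_of_injective _ i.φ.injective, i.verts_image, i.comps_image,
    Set.InjOn.ncard_image, Set.InjOn.ncard_image]
  · rintro _ ⟨u, hu, rfl⟩ _ ⟨v, hv, rfl⟩ h
    have := i.conn_g (Quotient.exact h)
    rw [i.gf_verts hu, i.gf_verts hv] at this
    exact Quotient.sound this
  · intro u hu v hv h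
    rw [← i.gf_verts hu, ← i.gf_verts hv, h]

theorem momentumSpanning_image (i : Iso Γ Γ') (A : Set Γ.E) (s : Γ.S) :
    Γ'.MomentumSpanning (i.φ '' A) (i.σ s) ↔ Γ.MomentumSpanning A s := by
  unfold MomentumSpanning
  rw [i.ext]
  constructor
  · intro h u hu v hv
    have := i.conn_g (h _ ⟨u, hu, rfl⟩ _ ⟨v, hv, rfl⟩)
    rwa [i.gf_ext hu, i.gf_ext hv] at this
  · rintro h _ ⟨u, hu, rfl⟩ _ ⟨v, hv, rfl⟩
    exact i.conn_f (h u hu v hv)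

theorem spanning_image (i : Iso Γ Γ') (A : Set Γ.E) (s : Γ.S) :
    Γ'.Spanning (i.φ '' A) (i.σ s) ↔ Γ.Spanning A s := by
  unfold Spanning
  rw [i.momentumSpanning_image]
  unfold MassSpanning
  rw [i.mass, Set.image_subset_image_iff i.φ.injective]

theorem isMotic (i : Iso Γ Γ') (h : Γ.IsMotic) : Γ'.IsMotic := by
  intro B hB hs
  obtain ⟨A, rfl⟩ := i.φ.surjective.image_surjective B
  have hu : i.φ '' Set.univ = Set.univ := Set.image_univ_of_surjective i.φ.surjective
  rw [← hu, i.loops_image, i.loops_image]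
  refine h A ?_ fun s => (i.spanning_image A s).1 (hs _)
  rintro rfl
  exact hB hu

/-- The induced isomorphism of subgraphs. -/
def sub (i : Iso Γ Γ') (A : Set Γ.E) : Iso (Γ.sub A) (Γ'.sub (i.φ '' A)) where
  f := i.f
  g := i.g
  φ := i.φ.image A
  σ := i.σ.subtypeEquiv fun s => (i.spanning_image A s).symm
  gf := fun (e : A) => i.gf e
  fg := fun (e : i.φ '' A) => i.fg e
  ends := fun (e : A) => i.ends e
  vtype := fun (e : A) => i.vtype e
  etype := fun (e : A) => i.etype e
  mass := by
    rintro ⟨s, hs⟩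
    ext ⟨_, e, he, rfl⟩
    change i.φ e ∈ Γ'.mass (i.σ s) ↔ _
    rw [i.mass]
    constructor
    · rintro ⟨e', he', h⟩
      obtain rfl := i.φ.injective h
      exact ⟨⟨_, he⟩, he', rfl⟩
    · rintro ⟨⟨e', h'⟩, he', h⟩
      exact ⟨e', he', congrArg Subtype.val h⟩
  ext := fun (s : {s // Γ.Spanning A s}) => i.ext s

open Classical in
/-- The induced isomorphism of contracted graphs. -/
noncomputable def contract (i : Iso Γ Γ') (A : Set Γ.E) :
    Iso (Γ.contract A) (Γ'.contract (i.φ '' A)) where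
  f := Quotient.map' i.f fun _ _ h => i.conn_f h
  g := Quotient.map' i.g fun _ _ h => i.conn_g h
  φ := i.φ.subtypeEquiv fun e => by simp
  σ := i.σ.subtypeEquiv fun s => (i.spanning_image A s).symm.not
  gf e x hx := by
    obtain ⟨u, hu, rfl⟩ := Sym2.mem_map.1 hx
    exact congrArg (Quotient.mk _) (i.gf _ u hu)
  fg e x hx := by
    obtain ⟨u, hu, rfl⟩ := Sym2.mem_map.1 hx
    exact congrArg (Quotient.mk _) (i.fg _ u hu)
  ends := fun (e : {e // e ∉ A}) =>
    (congrArg (Sym2.map (Quotient.mk _)) (i.ends e)).trans (sm22 (by intro _; rfl) _)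
  vtype e x hx := by
    obtain ⟨u, hu, rfl⟩ := Sym2.mem_map.1 hx
    change (if Quotient.mk _ (i.f u) ∈ comps Γ'.ends (i.φ '' A) then T.point
        else Γ'.vtype (Quotient.mk _ (i.f u)).out) =
      if Quotient.mk _ u ∈ comps Γ.ends A then T.point else Γ.vtype (Quotient.mk _ u).out
    have h1 : Quotient.mk _ (i.f u) ∈ comps Γ'.ends (i.φ '' A) ↔
        Quotient.mk _ u ∈ comps Γ.ends A := by
      constructor
      · rintro ⟨w, hw, h⟩
        rw [i.verts_image] at hw
        obtain ⟨w, hw, rfl⟩ := hw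
        have := i.conn_g (Quotient.exact h)
        rw [i.gf_verts hw, i.gf _ u hu] at this
        exact ⟨w, hw, Quotient.sound this⟩
      · rintro ⟨w, hw, h⟩
        refine ⟨i.f w, i.verts_image A ▸ ⟨w, hw, rfl⟩, Quotient.sound ?_⟩
        exact i.conn_f (Quotient.exact h)
    by_cases h : Quotient.mk _ u ∈ comps Γ.ends A
    · rw [if_pos h, if_pos (h1.2 h)]
    · rw [if_neg h, if_neg (h1.not.2 h)]
      have e1 : (Quotient.mk (conn Γ.ends A) u).out = u := by
        rcases eq_or_verts_of_conn (Quotient.mk_out (s := conn Γ.ends A) u) with h' | h'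
        · exact h'
        · exact absurd ⟨u, h'.2, rfl⟩ h
      have e2 : (Quotient.mk (conn Γ'.ends (i.φ '' A)) (i.f u)).out = i.f u := by
        rcases eq_or_verts_of_conn (Quotient.mk_out (s := conn Γ'.ends (i.φ '' A)) (i.f u))
          with h' | h'
        · exact h'
        · exact absurd ⟨i.f u, h'.2, rfl⟩ (h1.not.2 h)
      rw [e1, e2]
      exact i.vtype _ u hu
  etype := fun (e : {e // e ∉ A}) => i.etype e
  mass := by
    rintro ⟨s, hs⟩
    ext ⟨e, he⟩
    change e ∈ Γ'.mass (i.σ s) ↔ _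
    rw [i.mass]
    constructor
    · rintro ⟨e', he', rfl⟩
      exact ⟨⟨e', fun h => he ⟨e', h, rfl⟩⟩, he', rfl⟩
    · rintro ⟨⟨e', h'⟩, he', h⟩
      exact ⟨e', he', congrArg Subtype.val h⟩
  ext := by
    rintro ⟨s, hs⟩
    ext x
    change (¬ Γ'.MomentumSpanning (i.φ '' A) (i.σ s) ∧ ∃ u ∈ Γ'.ext (i.σ s), _) ↔ _
    rw [i.momentumSpanning_image, i.ext]
    constructor
    · rintro ⟨h, _, ⟨u, hu, rfl⟩, rfl⟩
      exact ⟨Quotient.mk _ u, ⟨h, u, hu, rfl⟩, rfl⟩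
    · rintro ⟨_, ⟨h, u, hu, rfl⟩, rfl⟩
      exact ⟨h, _, ⟨u, hu, rfl⟩, rfl⟩

end Iso

/-- Isomorphism of motic graphs. -/
instance isoSetoid (T : PowerCounting) : Setoid {Γ : FeynmanGraph T // Γ.IsMotic} where
  r Γ Γ' := Nonempty (Iso Γ.1 Γ'.1)
  iseqv := ⟨fun _ => ⟨.refl _⟩, fun ⟨i⟩ => ⟨i.symm⟩, fun ⟨i⟩ ⟨j⟩ => ⟨i.trans j⟩⟩

end FeynmanGraph

/-- Isomorphism classes of motic graphs. -/
abbrev MoticClass (T : PowerCounting) := Quotient (FeynmanGraph.isoSetoid T)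

namespace MoticClass

open FeynmanGraph

/-- The isomorphism class of a motic graph. -/
def mk {T : PowerCounting} (Γ : FeynmanGraph T) (h : Γ.IsMotic) : MoticClass T :=
  Quotient.mk _ ⟨Γ, h⟩

theorem mk_eq {T : PowerCounting} {Γ Γ' : FeynmanGraph T} {h : Γ.IsMotic} {h' : Γ'.IsMotic}
    (i : Iso Γ Γ') : mk Γ h = mk Γ' h' :=
  Quotient.sound ⟨i⟩

variable {T : PowerCounting}

/-- The disjoint union on isomorphism classes. -/
instance : Mul (MoticClass T) where
  mul := Quotient.map₂ (fun Γ Γ' => ⟨Γ.1.sum Γ'.1, Γ.2.sum Γ'.2⟩)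
    fun _ _ ⟨i⟩ _ _ ⟨j⟩ => ⟨i.sum j⟩

/-- The class of the empty graph. -/
instance : One (MoticClass T) where
  one := mk (FeynmanGraph.empty T) isMotic_empty

theorem one_mul' (x : MoticClass T) : 1 * x = x := by
  induction x using Quotient.inductionOn with | _ x => ?_
  exact mk_eq (h := isMotic_empty.sum x.2) (h' := x.2) (Iso.emptySum x.1)

theorem mul_comm' (x y : MoticClass T) : x * y = y * x := by
  induction x using Quotient.inductionOn with | _ x => ?_
  induction y using Quotient.inductionOn with | _ y => ?_
  exact mk_eq (h := x.2.sum y.2) (h' := y.2.sum x.2) (Iso.sumComm x.1 y.1)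

instance : CommMonoid (MoticClass T) where
  mul_assoc x y z := by
    induction x using Quotient.inductionOn with | _ x => ?_
    induction y using Quotient.inductionOn with | _ y => ?_
    induction z using Quotient.inductionOn with | _ z => ?_
    exact mk_eq (h := (x.2.sum y.2).sum z.2) (h' := x.2.sum (y.2.sum z.2))
      (Iso.sumAssoc x.1 y.1 z.1)
  one_mul := one_mul'
  mul_one x := (mul_comm' x 1).trans (one_mul' x)
  mul_comm := mul_comm'

end MoticClass

/-- The algebra of motic graphs: the rational vector space with the isomorphism classes of motic
graphs as its basis, with the disjoint union as product and the empty graph as unit. -/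
abbrev M (T : PowerCounting) := MonoidAlgebra ℚ (MoticClass T)

/-- A motic graph as an element of `M T`. -/
noncomputable def graph {T : PowerCounting} (Γ : FeynmanGraph T) (h : Γ.IsMotic) : M T :=
  MonoidAlgebra.single (MoticClass.mk Γ h) 1

/-- The term `γ ⊗ Γ/γ` of the coproduct, where `γ` has edge set `A`. -/
noncomputable def term {T : PowerCounting} (Γ : FeynmanGraph T) (h : Γ.IsMotic) (A : Set Γ.E)
    (hA : (Γ.sub A).IsMotic) : M T ⊗[ℚ] M T :=
  graph (Γ.sub A) hA ⊗ₜ[ℚ] graph (Γ.contract A) (h.contract A)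

theorem graph_eq {T : PowerCounting} {Γ Γ' : FeynmanGraph T} {h : Γ.IsMotic} {h' : Γ'.IsMotic}
    (i : FeynmanGraph.Iso Γ Γ') : graph Γ h = graph Γ' h' := by
  unfold graph
  rw [MoticClass.mk_eq i]

/-- The coproduct of an isomorphism class of motic graphs: the sum of `γ ⊗ Γ/γ` over the motic
subgraphs `γ` of `Γ` (of which there are finitely many). -/
noncomputable def coproductGraph (T : PowerCounting) : MoticClass T → M T ⊗[ℚ] M T :=
  Quotient.lift
    (fun Γ => ∑ᶠ A : {A : Set Γ.1.E // (Γ.1.sub A).IsMotic}, term Γ.1 Γ.2 A.1 A.2) <| by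
    rintro ⟨Γ, h⟩ ⟨Γ', h'⟩ ⟨i⟩
    change FeynmanGraph.Iso Γ Γ' at i
    have key : ∀ A : Set Γ.E, (Γ.sub A).IsMotic ↔ (Γ'.sub (i.φ '' A)).IsMotic := fun A =>
      ⟨(i.sub A).isMotic, (i.sub A).symm.isMotic⟩
    refine finsum_eq_of_bijective (fun A => ⟨i.φ '' A.1, (key A.1).1 A.2⟩) ⟨?_, ?_⟩ ?_
    · intro A B hAB
      exact Subtype.ext (i.φ.injective.image_injective (congrArg Subtype.val hAB))
    · rintro ⟨B, hB⟩
      obtain ⟨A, rfl⟩ := i.φ.surjective.image_surjective B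
      exact ⟨⟨A, (key A).2 hB⟩, rfl⟩
    · rintro ⟨A, hA⟩
      unfold term
      rw [graph_eq (i.sub A), graph_eq (i.contract A)]

/-- The coproduct of the motic Hopf algebra. -/
noncomputable def coproduct (T : PowerCounting) : M T →ₗ[ℚ] M T ⊗[ℚ] M T :=
  (MonoidAlgebra.basis (MoticClass T) ℚ).constr ℚ (coproductGraph T)

open Classical in
/-- The counit: the projection onto the empty graph. -/
noncomputable def counit (T : PowerCounting) : M T →ₗ[ℚ] ℚ :=
  (MonoidAlgebra.basis (MoticClass T) ℚ).constr ℚ fun x => if x = 1 then 1 else 0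

/-! ### Superficial divergence -/

namespace FeynmanGraph

variable {T : PowerCounting} (Γ : FeynmanGraph T)

/-- The superficial degree of divergence `D · #loops + ∑ vertex weights - ∑ edge weights` of the
subgraph with edge set `A`. -/
noncomputable def omega (A : Set Γ.E) : ℝ :=
  T.dim * loops Γ.ends A + (∑ᶠ v ∈ verts Γ.ends A, T.vweight (Γ.vtype v))
    - ∑ᶠ e ∈ A, T.eweight (Γ.etype e)

/-- The edge set of the connected component that contains the edge `e`. -/
def compOf (e : Γ.E) : Set Γ.E :=
  {e' | ∃ u ∈ Γ.ends e, ∃ v ∈ Γ.ends e', conn Γ.ends Set.univ u v}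

/-- The edge set of the biconnected component (block) that contains the edge `e`: the edges that
are not separated from `e` by the removal of any one vertex `v`. -/
def blockOf (e : Γ.E) : Set Γ.E :=
  {e' | ∀ v, Relation.EqvGen (fun a b => ∃ u, u ≠ v ∧ u ∈ Γ.ends a ∧ u ∈ Γ.ends b) e e'}

/-- The subgraph with edge set `A` is one-particle irreducible: it is connected, and remains so
after the removal of any one edge. -/
def OnePI (A : Set Γ.E) : Prop :=
  ∀ f ∈ A, ∀ u ∈ verts Γ.ends A, ∀ v ∈ verts Γ.ends A, conn Γ.ends (A \ {f}) u v

/-- There are no masses and no external momenta. -/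
def Scaleless : Prop := IsEmpty Γ.S

/-- Divergent UV graphs: all connected components are 1PI with `ω ≥ 0`. -/
def UVDivergent : Prop := ∀ e, Γ.OnePI (Γ.compOf e) ∧ 0 ≤ Γ.omega (Γ.compOf e)

/-- Contracted divergent IR graphs: scaleless graphs, all of whose connected components
have `ω ≤ 0`. -/
def IRDivergent : Prop := Γ.Scaleless ∧ ∀ e, Γ.omega (Γ.compOf e) ≤ 0

/-- Variant of `IRDivergent` that decomposes the graph also at its cut vertices. -/
def IRDivergentBlocks : Prop := Γ.Scaleless ∧ ∀ e, Γ.omega (Γ.blockOf e) ≤ 0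

end FeynmanGraph

section Projections

variable {T : PowerCounting} (P : FeynmanGraph T → Prop)

/-- The isomorphism classes of motic graphs with the property `P`. -/
def classes : Set (MoticClass T) := {x | ∃ (Γ : FeynmanGraph T) (h : Γ.IsMotic),
  MoticClass.mk Γ h = x ∧ P Γ}

/-- The motic graphs with the property `P`, as elements of `M T`. -/
def graphs : Set (M T) := {x | ∃ (Γ : FeynmanGraph T) (h : Γ.IsMotic), graph Γ h = x ∧ P Γ}

/-- The subalgebra of `M T` generated by the motic graphs with the property `P`. -/
noncomputable def H : Subalgebra ℚ (M T) := Algebra.adjoin ℚ (graphs P)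

theorem single_mem_H {x : MoticClass T} (hx : x ∈ classes P) :
    (MonoidAlgebra.single x 1 : M T) ∈ H P := by
  obtain ⟨Γ, h, rfl, hP⟩ := hx
  exact Algebra.subset_adjoin ⟨Γ, h, rfl, hP⟩

open Classical in
/-- The projection that keeps the motic graphs with the property `P` and maps the others
to zero. -/
noncomputable def rho : M T →ₗ[ℚ] H P :=
  (MonoidAlgebra.basis (MoticClass T) ℚ).constr ℚ fun x =>
    if hx : x ∈ classes P then ⟨MonoidAlgebra.single x 1, single_mem_H P hx⟩ else 0

end Projections

/-- The subalgebra generated by the divergent UV graphs. -/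
noncomputable abbrev HUV (T : PowerCounting) : Subalgebra ℚ (M T) := H FeynmanGraph.UVDivergent

/-- The subalgebra generated by the contracted divergent IR graphs. -/
noncomputable abbrev HIR (T : PowerCounting) : Subalgebra ℚ (M T) := H FeynmanGraph.IRDivergent

/-- The variant of `HIR` that decomposes the graphs also at their cut vertices. -/
noncomputable abbrev HIRB (T : PowerCounting) : Subalgebra ℚ (M T) :=
  H FeynmanGraph.IRDivergentBlocks

noncomputable abbrev rhoUV (T : PowerCounting) : M T →ₗ[ℚ] HUV T := rho _

noncomputable abbrev rhoIR (T : PowerCounting) : M T →ₗ[ℚ] HIR T := rho _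

noncomputable abbrev rhoIRB (T : PowerCounting) : M T →ₗ[ℚ] HIRB T := rho _

/-- The UV coaction `(ρ ⊗ id) ∘ Δ`. -/
noncomputable def coactionUV (T : PowerCounting) : M T →ₗ[ℚ] HUV T ⊗[ℚ] M T :=
  (rhoUV T).rTensor (M T) ∘ₗ coproduct T

/-- The IR coaction `(id ⊗ ρ) ∘ Δ`. -/
noncomputable def coactionIR (T : PowerCounting) : M T →ₗ[ℚ] M T ⊗[ℚ] HIR T :=
  (rhoIR T).lTensor (M T) ∘ₗ coproduct T

/-- The variant of `coactionIR` that decomposes the graphs also at their cut vertices. -/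
noncomputable def coactionIRB (T : PowerCounting) : M T →ₗ[ℚ] M T ⊗[ℚ] HIRB T :=
  (rhoIRB T).lTensor (M T) ∘ₗ coproduct T

/-! ### Hopf algebras and coactions -/

section Algebra

universe u v

/-- `Δ`, `ε`, `S` are the coproduct, counit and antipode of a Hopf algebra structure on the
commutative algebra `A`. -/
structure IsHopf {A : Type u} [CommRing A] [Algebra ℚ A] (Δ : A →ₗ[ℚ] A ⊗[ℚ] A) (ε : A →ₗ[ℚ] ℚ)
    (S : A →ₗ[ℚ] A) : Prop where
  coassoc : TensorProduct.assoc ℚ A A A ∘ₗ Δ.rTensor A ∘ₗ Δ = Δ.lTensor A ∘ₗ Δ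
  rTensor_counit : ε.rTensor A ∘ₗ Δ = TensorProduct.mk ℚ ℚ A 1
  lTensor_counit : ε.lTensor A ∘ₗ Δ = (TensorProduct.mk ℚ A ℚ).flip 1
  comul_one : Δ 1 = 1
  comul_mul : ∀ a b, Δ (a * b) = Δ a * Δ b
  counit_one : ε 1 = 1
  counit_mul : ∀ a b, ε (a * b) = ε a * ε b
  antipode_left : LinearMap.mul' ℚ A ∘ₗ S.rTensor A ∘ₗ Δ = Algebra.linearMap ℚ A ∘ₗ ε
  antipode_right : LinearMap.mul' ℚ A ∘ₗ S.lTensor A ∘ₗ Δ = Algebra.linearMap ℚ A ∘ₗ ε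

/-- The Hopf algebra with given coproduct, counit and antipode. -/
noncomputable abbrev IsHopf.toHopfAlgebra {A : Type u} [CommRing A] [Algebra ℚ A]
    {Δ : A →ₗ[ℚ] A ⊗[ℚ] A} {ε : A →ₗ[ℚ] ℚ} {S : A →ₗ[ℚ] A} (h : IsHopf Δ ε S) :
    HopfAlgebra ℚ A :=
  letI : Coalgebra ℚ A :=
    { comul := Δ
      counit := ε
      coassoc := h.coassoc
      rTensor_counit_comp_comul := h.rTensor_counit
      lTensor_counit_comp_comul := h.lTensor_counit }
  letI : Bialgebra ℚ A :=
    Bialgebra.mk' ℚ A h.counit_one (h.counit_mul _ _) h.comul_one (h.comul_mul _ _)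
  { antipode := S
    mul_antipode_rTensor_comul := h.antipode_left
    mul_antipode_lTensor_comul := h.antipode_right }

/-- The kernel of `ρ : A → B` is a Hopf ideal `I` of the Hopf algebra `A`, and `ρ` induces an
isomorphism from the quotient Hopf algebra `A ⧸ I` to the Hopf algebra `B`. -/
def KernelIsHopfIdeal {A : Type u} [CommRing A] [Algebra ℚ A] {B : Type v} [CommRing B]
    [Algebra ℚ B] {Δ : A →ₗ[ℚ] A ⊗[ℚ] A} {ε : A →ₗ[ℚ] ℚ} {S : A →ₗ[ℚ] A} (h : IsHopf Δ ε S)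
    {Δ' : B →ₗ[ℚ] B ⊗[ℚ] B} {ε' : B →ₗ[ℚ] ℚ} {S' : B →ₗ[ℚ] B} (h' : IsHopf Δ' ε' S')
    (ρ : A →ₗ[ℚ] B) : Prop :=
  letI := h.toHopfAlgebra
  letI := h'.toHopfAlgebra
  ∃ I : Ideal A, I.restrictScalars ℚ = LinearMap.ker ρ ∧
    ∃ _ : I.IsHopfIdeal ℚ, ∃ e : (A ⧸ I) ≃ₐc[ℚ] B, ∀ a, e (Ideal.Quotient.mk I a) = ρ a

/-- `δ` is a left coaction on `N` of the coalgebra `C` with coproduct `Δ` and counit `ε`. -/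
structure IsLeftCoaction {C : Type u} [AddCommGroup C] [Module ℚ C] {N : Type v} [AddCommGroup N]
    [Module ℚ N] (Δ : C →ₗ[ℚ] C ⊗[ℚ] C) (ε : C →ₗ[ℚ] ℚ) (δ : N →ₗ[ℚ] C ⊗[ℚ] N) : Prop where
  coassoc : TensorProduct.assoc ℚ C C N ∘ₗ Δ.rTensor N ∘ₗ δ = δ.lTensor C ∘ₗ δ
  counit : TensorProduct.lid ℚ N ∘ₗ ε.rTensor N ∘ₗ δ = LinearMap.id

/-- `δ` is a right coaction on `N` of the coalgebra `C` with coproduct `Δ` and counit `ε`. -/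
structure IsRightCoaction {C : Type u} [AddCommGroup C] [Module ℚ C] {N : Type v}
    [AddCommGroup N] [Module ℚ N] (Δ : C →ₗ[ℚ] C ⊗[ℚ] C) (ε : C →ₗ[ℚ] ℚ)
    (δ : N →ₗ[ℚ] N ⊗[ℚ] C) : Prop where
  coassoc : TensorProduct.assoc ℚ N C C ∘ₗ δ.rTensor C ∘ₗ δ = Δ.lTensor N ∘ₗ δ
  counit : TensorProduct.rid ℚ N ∘ₗ ε.lTensor N ∘ₗ δ = LinearMap.id

end Algebra

end Motic

open Motic FeynmanGraph

/-! The coproduct splits a graph into a subgraph and a quotient, so coassociativity should be the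
correspondence between subgraphs of subgraphs, subgraphs of quotients, and chains `B ⊆ A` of edge
sets. The point is that the motic condition is compatible with it. Being motic is a condition on
single edges (`isMotic_iff`). It passes to contracted graphs, and `Γ` is motic whenever `γ` and
`Γ/γ` are (`isMotic_of_sub_of_contract`). Hence all graphs can be admitted, with those that are not
motic set to zero in `M T`. The coproduct of any graph is then the sum over all edge sets
(`coproduct_graphOrZero`), and coassociativity and multiplicativity are reindexings of finite sums
along isomorphisms of graphs. The antipode exists because the number of edges filters `M T` and the
only motic graph without edges is the unit (`exists_antipode`).

The kernel of a projection `ρ` is spanned by the graphs without some property `P`. It is a Hopf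
ideal if `P` is invariant under isomorphism, holds for the empty graph, holds for a disjoint union
exactly if it holds for both factors, and passes to extensions: `P γ` and `P (Γ/γ)` imply `P Γ`
(`IsHopfProperty`). Indeed, if `P Γ` fails, then every term `γ ⊗ Γ/γ` has a factor in the kernel.
The inclusion of the span of the graphs with `P` is a section of `ρ`, so the quotient structure can
be transported to it, and the coactions come from coassociativity (`exists_isHopf_of_projection`).

It remains to see that divergence passes to extensions. For scales and bridges this is direct. For
`ω`, loops are additive under contraction and contracted vertices have weight 0, so `ω (Γ/γ) = ω Γ -
ω γ` (`omega_contract`), and a common sign of `ω γ` and `ω (Γ/γ)` is inherited by the sum `ω Γ`.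
This has to be applied part by part, where the parts are components or blocks: `ω` is additive over
the parts, and the parts of `γ` and `Γ/γ` lie in parts of `Γ` (`IsDecomposition`). For blocks,
additivity holds because connecting paths that close a cycle with an edge stay in the block of that
edge (`loops_eq_add`). -/

namespace Motic

/-! ### Connectivity, bridges and loop numbers -/

section Incidence

variable {V E : Type} {ends : E → Sym2 V}

theorem conn_of_mem_ends {A : Set E} {e : E} (he : e ∈ A) {u v : V} (hu : u ∈ ends e)
    (hv : v ∈ ends e) : conn ends A u v :=
  .rel _ _ ⟨e, he, hu, hv⟩

theorem conn_refl {A : Set E} (u : V) : conn ends A u u := .refl _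

theorem conn_symm {A : Set E} {u v : V} (h : conn ends A u v) : conn ends A v u :=
  (conn ends A).symm' h

theorem conn_trans {A : Set E} {u v w : V} (h : conn ends A u v) (h' : conn ends A v w) :
    conn ends A u w :=
  (conn ends A).trans' h h'

/-- The universal property of a generated equivalence relation. -/
theorem conn_le {A : Set E} {s : Setoid V} (h : ∀ e ∈ A, ∀ u ∈ ends e, ∀ v ∈ ends e, s u v)
    {u v : V} (huv : conn ends A u v) : s u v := by
  change Relation.EqvGen _ _ _ at huv
  induction huv with
  | rel x y hxy =>
    obtain ⟨e, he, hx, hy⟩ := hxy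
    exact h e he x hx y hy
  | refl x => exact s.refl' x
  | symm x y _ ih => exact s.symm' ih
  | trans x y z _ _ ih1 ih2 => exact s.trans' ih1 ih2

/-- Every passage of a path through `f` can be rerouted. -/
theorem conn_diff_singleton {A : Set E} {f : E}
    (hf : ∀ u ∈ ends f, ∀ v ∈ ends f, conn ends (A \ {f}) u v) {u v : V}
    (huv : conn ends A u v) : conn ends (A \ {f}) u v := by
  refine conn_le (fun e he u hu v hv => ?_) huv
  by_cases h : e = f
  · subst h
    exact hf u hu v hv
  · exact conn_of_mem_ends (A := A \ {f}) ⟨he, h⟩ hu hv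

/-- A path either avoids the edge `f` or can be cut at its first and last passage through `f`. -/
theorem conn_diff_or {A : Set E} (f : E) {u v : V} (huv : conn ends A u v) :
    conn ends (A \ {f}) u v ∨ ∃ p ∈ ends f, ∃ q ∈ ends f,
      conn ends (A \ {f}) u p ∧ conn ends (A \ {f}) q v := by
  change Relation.EqvGen _ _ _ at huv
  induction huv with
  | rel x y hxy =>
    obtain ⟨e, he, hx, hy⟩ := hxy
    by_cases h : e = f
    · subst h
      exact .inr ⟨x, hx, y, hy, conn_refl _, conn_refl _⟩
    · exact .inl (conn_of_mem_ends (A := A \ {f}) ⟨he, h⟩ hx hy)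
  | refl x => exact .inl (conn_refl _)
  | symm x y _ ih =>
    rcases ih with h | ⟨p, hp, q, hq, h1, h2⟩
    · exact .inl (conn_symm h)
    · exact .inr ⟨q, hq, p, hp, conn_symm h2, conn_symm h1⟩
  | trans x y z _ _ ih1 ih2 =>
    rcases ih1 with h | ⟨p, hp, q, hq, h1, h2⟩ <;>
      rcases ih2 with h' | ⟨p', hp', q', hq', h1', h2'⟩
    · exact .inl (conn_trans h h')
    · exact .inr ⟨p', hp', q', hq', conn_trans h h1', h2'⟩
    · exact .inr ⟨p, hp, q, hq, h1, conn_trans h2 h'⟩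
    · exact .inr ⟨p, hp, q', hq', h1, h2'⟩

theorem verts_mono {A B : Set E} (h : A ⊆ B) : verts ends A ⊆ verts ends B :=
  fun _ ⟨e, he, hv⟩ => ⟨e, h he, hv⟩

theorem verts_union (A B : Set E) : verts ends (A ∪ B) = verts ends A ∪ verts ends B := by
  ext v
  constructor
  · rintro ⟨e, he | he, hv⟩
    · exact .inl ⟨e, he, hv⟩
    · exact .inr ⟨e, he, hv⟩
  · rintro (⟨e, he, hv⟩ | ⟨e, he, hv⟩)
    · exact ⟨e, .inl he, hv⟩
    · exact ⟨e, .inr he, hv⟩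

/-- The class of a vertex outside the subgraph is a singleton, so it cannot be the class of an end
point. -/
theorem mk_mem_comps {A : Set E} {u : V} :
    Quotient.mk (conn ends A) u ∈ comps ends A ↔ u ∈ verts ends A := by
  constructor
  · rintro ⟨w, hw, h⟩
    rcases eq_or_verts_of_conn (Quotient.exact h) with rfl | h
    · exact hw
    · exact h.2
  · exact fun h => ⟨u, h, rfl⟩

theorem conn_empty {u v : V} : conn ends ∅ u v ↔ u = v := by
  constructor
  · intro h
    rcases eq_or_verts_of_conn h with h | ⟨⟨e, he, _⟩, _⟩
    · exact h
    · exact he.elim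
  · rintro rfl
    exact conn_refl _

theorem loops_empty : loops ends ∅ = 0 := by
  have : verts ends ∅ = ∅ := by
    ext v
    simp [verts]
  simp [loops, comps, this]

theorem ends_eq (ends : E → Sym2 V) (e : E) : ∃ a b, ends e = s(a, b) := by
  induction h : ends e using Sym2.inductionOn with | _ a b => exact ⟨a, b, rfl⟩

open Classical in
theorem loops_singleton (e : E) {a b : V} (h : ends e = s(a, b)) :
    loops ends {e} = if a = b then 1 else 0 := by
  have hv : verts ends {e} = {a, b} := by
    ext v
    simp [verts, h]
  have hc : comps ends {e} = {Quotient.mk _ a} := by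
    have : Quotient.mk (conn ends {e}) b = Quotient.mk _ a :=
      Quotient.sound (conn_of_mem_ends (A := {e}) rfl (h ▸ Sym2.mem_mk_right a b)
        (h ▸ Sym2.mem_mk_left a b))
    rw [comps, hv, Set.image_pair, this, Set.pair_eq_singleton]
  rw [loops, hv, hc, Set.ncard_singleton, Set.ncard_singleton]
  split_ifs with hab
  · subst hab
    simp
  · rw [Set.ncard_pair hab]
    norm_num

end Incidence

namespace FeynmanGraph

variable {T : PowerCounting} (Γ : FeynmanGraph T)

section Loops

variable {Γ}

open Classical in
-- After the contraction of `A`, the edge `e` is a self-loop exactly if its ends are connected in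
-- `A`, and loop numbers are additive under contraction. This count is behind `loops_mono`,
-- `loops_compl_singleton_lt` and `loops_eq_add`.
theorem loops_insert {A : Set Γ.E} {e : Γ.E} (he : e ∉ A) {a b : Γ.V} (h : Γ.ends e = s(a, b)) :
    loops Γ.ends (insert e A) = loops Γ.ends A + if conn Γ.ends A a b then 1 else 0 := by
  have h1 := Γ.loops_contract A {⟨e, he⟩}
  have h2 : Γ.contractEnds A ⟨e, he⟩ = s(Quotient.mk _ a, Quotient.mk _ b) := by
    simp [contractEnds, h]
  rw [loops_singleton _ h2, Set.image_singleton, Set.union_singleton] at h1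
  have h3 : (Quotient.mk (conn Γ.ends A) a = Quotient.mk _ b) ↔ conn Γ.ends A a b :=
    ⟨fun h => Quotient.exact h, fun h => Quotient.sound h⟩
  simp only [h3] at h1
  omega

theorem loops_mono {A B : Set Γ.E} (h : A ⊆ B) : loops Γ.ends A ≤ loops Γ.ends B := by
  classical
  have key : ∀ C : Set Γ.E, loops Γ.ends A ≤ loops Γ.ends (A ∪ C) := by
    intro C
    induction C, Set.toFinite C using Set.Finite.induction_on with
    | empty => simp
    | @insert e C _ _ ih =>
      rw [Set.union_insert]
      by_cases he : e ∈ A ∪ C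
      · rwa [Set.insert_eq_of_mem he]
      · obtain ⟨a, b, hab⟩ := ends_eq Γ.ends e
        rw [loops_insert he hab]
        split_ifs <;> omega
  simpa [Set.union_eq_self_of_subset_left h] using key B

/-- This is `loops_insert` for the complement of `e`: an edge contributes a loop exactly if it is
not a bridge. -/
theorem loops_compl_singleton_lt {e : Γ.E} :
    loops Γ.ends {e}ᶜ < loops Γ.ends Set.univ ↔
      ∀ u ∈ Γ.ends e, ∀ v ∈ Γ.ends e, conn Γ.ends {e}ᶜ u v := by
  obtain ⟨a, b, h⟩ := ends_eq Γ.ends e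
  have h1 := loops_insert (A := {e}ᶜ) (by simp) h
  have h2 : insert e ({e}ᶜ : Set Γ.E) = Set.univ := by
    ext x
    simp [Classical.em]
  rw [h2] at h1
  have h3 : (∀ u ∈ Γ.ends e, ∀ v ∈ Γ.ends e, conn Γ.ends {e}ᶜ u v) ↔ conn Γ.ends {e}ᶜ a b := by
    rw [h]
    constructor
    · exact fun h => h a (Sym2.mem_mk_left _ _) b (Sym2.mem_mk_right _ _)
    · intro h u hu v hv
      rcases Sym2.mem_iff.1 hu with rfl | rfl <;> rcases Sym2.mem_iff.1 hv with rfl | rfl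
      · exact conn_refl _
      · exact h
      · exact conn_symm h
      · exact conn_refl _
  rw [h3, h1]
  split_ifs with hc <;> simp [hc]

end Loops

/-- A graph is motic if and only if the removal of any bridge destroys the
mass-momentum-spanning property of some scale. -/
theorem isMotic_iff : Γ.IsMotic ↔ ∀ e, (∀ s, Γ.Spanning {e}ᶜ s) →
    ∀ u ∈ Γ.ends e, ∀ v ∈ Γ.ends e, conn Γ.ends {e}ᶜ u v := by
  constructor
  · intro h e hs
    refine loops_compl_singleton_lt.1 (h _ ?_ hs)
    intro h
    have : e ∈ ({e}ᶜ : Set Γ.E) := h ▸ Set.mem_univ e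
    exact this rfl
  · intro h B hB hs
    obtain ⟨e, he⟩ : ∃ e, e ∉ B := by
      by_contra! hc
      exact hB (Set.eq_univ_of_forall hc)
    -- A scale spanned by `B` is spanned by the larger set `{e}ᶜ`, which has at least as many loops.
    -- So it suffices to delete a single edge.
    have hBe : B ⊆ {e}ᶜ := fun x hx hxe => he (hxe ▸ hx)
    exact (loops_mono hBe).trans_lt
      (loops_compl_singleton_lt.2 (h e fun s => (hs s).mono hBe))

theorem conn_sub (A : Set Γ.E) (B : Set A) (u v : Γ.V) :
    conn (Γ.sub A).ends B u v ↔ conn Γ.ends (Subtype.val '' B) u v := by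
  constructor
  · exact fun h => conn_map (B := Subtype.val '' B) id
      (fun e he => ⟨(e : A).1, ⟨e, he, rfl⟩, fun _ h => h⟩) h
  · refine fun h => conn_map (ends' := (Γ.sub A).ends) (B := B) id ?_ h
    rintro _ ⟨e, he, rfl⟩
    exact ⟨e, he, fun _ h => h⟩

theorem sub_spanning (A : Set Γ.E) (B : Set A) (s : (Γ.sub A).S) :
    (Γ.sub A).Spanning B s ↔ Γ.Spanning (Subtype.val '' B) s.1 := by
  refine and_congr ⟨fun h e he => ⟨⟨e, s.2.1 he⟩, h he, rfl⟩, fun h e he => ?_⟩ ?_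
  · obtain ⟨e', he', h'⟩ := h he
    exact Subtype.ext h' ▸ he'
  · exact forall₂_congr fun u _ => forall₂_congr fun v _ => Γ.conn_sub A B u v

theorem contract_spanning (A : Set Γ.E) (B : Set {e // e ∉ A}) (s : (Γ.contract A).S) :
    (Γ.contract A).Spanning B s ↔ Γ.Spanning (A ∪ Subtype.val '' B) s.1 := by
  constructor
  · rintro ⟨h1, h2⟩
    refine ⟨fun e he => ?_, ?_⟩
    · by_cases heA : e ∈ A
      · exact .inl heA
      · exact .inr ⟨⟨e, heA⟩, h1 (show (⟨e, heA⟩ : {e // e ∉ A}) ∈ _ from he), rfl⟩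
    -- If `A` is momentum-spanning, the contracted graph has no external vertices for this scale and
    -- `h2` is void, but then the claim holds by monotonicity.
    · by_cases hm : Γ.MomentumSpanning A s.1
      · exact fun u hu v hv => conn_mono Set.subset_union_left (hm u hu v hv)
      · exact fun u hu v hv => (Γ.conn_contract A B u v).1
          (h2 _ ⟨hm, u, hu, rfl⟩ _ ⟨hm, v, hv, rfl⟩)
  · rintro ⟨h1, h2⟩
    refine ⟨fun e he => ?_, ?_⟩
    · rcases h1 he with h | ⟨e', he', h⟩
      · exact absurd h e.2
      · exact Subtype.ext h ▸ he'
    · rintro _ ⟨_, u, hu, rfl⟩ _ ⟨_, v, hv, rfl⟩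
      exact (Γ.conn_contract A B u v).2 (h2 u hu v hv)

theorem image_val_compl_singleton {α : Type} {A : Set α} (e : A) :
    (Subtype.val '' ({e}ᶜ : Set A) : Set α) = A \ {e.1} := by
  ext x
  constructor
  · rintro ⟨y, hy, rfl⟩
    exact ⟨y.2, fun h => hy (Subtype.ext h)⟩
  · rintro ⟨hx, hne⟩
    exact ⟨⟨x, hx⟩, fun h => hne (congrArg Subtype.val h), rfl⟩

theorem union_image_val_compl_singleton {α : Type} {A : Set α} (e : {e // e ∉ A}) :
    A ∪ Subtype.val '' ({e}ᶜ : Set {e // e ∉ A}) = {e.1}ᶜ := by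
  ext x
  constructor
  · rintro (hx | ⟨y, hy, rfl⟩) h
    · exact e.2 (h ▸ hx)
    · exact hy (Subtype.ext h)
  · intro hne
    by_cases hx : x ∈ A
    · exact .inl hx
    · exact .inr ⟨⟨x, hx⟩, fun h => hne (congrArg Subtype.val h), rfl⟩

/-- This criterion and the next one speak of paths and scales of `Γ` only, so that subgraph and
contracted graph can be compared. -/
theorem isMotic_sub_iff (A : Set Γ.E) : (Γ.sub A).IsMotic ↔
    ∀ e ∈ A, (∀ s, Γ.Spanning A s → Γ.Spanning (A \ {e}) s) →
      ∀ u ∈ Γ.ends e, ∀ v ∈ Γ.ends e, conn Γ.ends (A \ {e}) u v := by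
  refine (Γ.sub A).isMotic_iff.trans (Subtype.forall.trans (forall₂_congr fun e he =>
    imp_congr (Subtype.forall.trans (forall₂_congr fun s hs => ?_))
      (forall₂_congr fun u _ => forall₂_congr fun v _ => ?_)))
  · rw [← image_val_compl_singleton (⟨e, he⟩ : A)]
    exact Γ.sub_spanning A _ ⟨s, hs⟩
  · rw [← image_val_compl_singleton (⟨e, he⟩ : A)]
    exact Γ.conn_sub A _ u v

theorem isMotic_contract_iff (A : Set Γ.E) : (Γ.contract A).IsMotic ↔
    ∀ e ∉ A, (∀ s, ¬ Γ.Spanning A s → Γ.Spanning {e}ᶜ s) →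
      ∀ u ∈ Γ.ends e, ∀ v ∈ Γ.ends e, conn Γ.ends {e}ᶜ u v := by
  refine (Γ.contract A).isMotic_iff.trans (Subtype.forall.trans (forall₂_congr fun e he =>
    imp_congr (Subtype.forall.trans (forall₂_congr fun s hs => ?_)) ?_))
  · rw [← union_image_val_compl_singleton ⟨e, he⟩]
    exact Γ.contract_spanning A _ ⟨s, hs⟩
  · rw [← union_image_val_compl_singleton ⟨e, he⟩]
    constructor
    · exact fun h u hu v hv => (Γ.conn_contract A _ u v).1
        (h _ (Sym2.mem_map.2 ⟨u, hu, rfl⟩) _ (Sym2.mem_map.2 ⟨v, hv, rfl⟩))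
    · intro h x hx y hy
      obtain ⟨u, hu, rfl⟩ := Sym2.mem_map.1 hx
      obtain ⟨v, hv, rfl⟩ := Sym2.mem_map.1 hy
      exact (Γ.conn_contract A _ u v).2 (h u hu v hv)

variable {Γ} in
-- Let `e` be an edge whose removal preserves all scales. If `e` is outside `A`, the contracted
-- graph shows that it is not a bridge. If `e` is in `A` and were a bridge of `Γ`, then its removal
-- would also preserve the scales spanned by `A`, so that the subgraph being motic gives a
-- contradiction.
theorem isMotic_of_sub_of_contract {A : Set Γ.E} (h1 : (Γ.sub A).IsMotic)
    (h2 : (Γ.contract A).IsMotic) : Γ.IsMotic := by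
  rw [isMotic_sub_iff] at h1
  rw [isMotic_contract_iff] at h2
  rw [isMotic_iff]
  intro e hs u hu v hv
  by_cases he : e ∈ A
  · by_contra hc
    have hAe : A \ {e} ⊆ {e}ᶜ := fun x hx => hx.2
    refine hc (conn_mono hAe (h1 e he (fun s hsA => ?_) u hu v hv))
    refine ⟨fun x hx => ⟨hsA.1 hx, (hs s).1 hx⟩, fun x hx y hy => ?_⟩
    -- If the path in `A` from `x` to `y` needs `e`, it enters at `p` and leaves at `q`. The
    -- external vertices `x` and `y` are also connected outside `e` by `hs`, so `p` and `q` are too,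
    -- and `e` is not a bridge, against `hc`.
    rcases conn_diff_or e (hsA.2 x hx y hy) with h | ⟨p, hp, q, hq, hxp, hqy⟩
    · exact h
    by_cases hpq : p = q
    · subst hpq
      exact conn_trans hxp hqy
    · have hpq' : conn Γ.ends {e}ᶜ p q := conn_trans (conn_symm (conn_mono hAe hxp))
        (conn_trans ((hs s).2 x hx y hy) (conn_symm (conn_mono hAe hqy)))
      have hpq_ends := (Sym2.mem_and_mem_iff hpq).1 ⟨hp, hq⟩
      rw [hpq_ends] at hu hv
      refine absurd ?_ hc
      rcases Sym2.mem_iff.1 hu with rfl | rfl <;> rcases Sym2.mem_iff.1 hv with rfl | rfl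
      · exact conn_refl _
      · exact hpq'
      · exact conn_symm hpq'
      · exact conn_refl _
  · exact h2 e he (fun s _ => hs s) u hu v hv

end FeynmanGraph

end Motic

/-! ### Isomorphisms for iterated subgraphs, iterated contractions and disjoint unions -/

namespace Motic

namespace FeynmanGraph

variable {T : PowerCounting} (Γ : FeynmanGraph T)

open Classical in
-- Outside the vertices of `A` the class of `u` is `{u}`, so the chosen representative is `u`
-- itself.
theorem contract_vtype_mk (A : Set Γ.E) (u : Γ.V) :
    (Γ.contract A).vtype (Quotient.mk (conn Γ.ends A) u) =
      if u ∈ verts Γ.ends A then T.point else Γ.vtype u := by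
  change (if Quotient.mk (conn Γ.ends A) u ∈ comps Γ.ends A then T.point
    else Γ.vtype (Quotient.mk (conn Γ.ends A) u).out) = _
  rw [mk_mem_comps]
  split_ifs with h
  · rfl
  · rcases eq_or_verts_of_conn (Quotient.mk_out (s := conn Γ.ends A) u) with h' | h'
    · rw [h']
    · exact absurd h'.2 h

/-- The edges in `B` as edges of the subgraph with edge set `A`. -/
def inSub (A B : Set Γ.E) : Set (Γ.sub A).E := {e : A | e.1 ∈ B}

/-- The edges in `B` as edges of the graph in which `A` is contracted. -/
def inContract (A B : Set Γ.E) : Set (Γ.contract A).E := {e : {e // e ∉ A} | e.1 ∈ B}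

variable {Γ}

theorem image_inSub {A B : Set Γ.E} (h : B ⊆ A) :
    Subtype.val '' (show Set A from Γ.inSub A B) = B := by
  ext x
  constructor
  · rintro ⟨y, hy, rfl⟩
    exact hy
  · exact fun hx => ⟨⟨x, h hx⟩, hx, rfl⟩

/-- The edges of `B` in `A` are lost in `inContract A B` but come back in the union with `A`, so `A`
and `B` need not be disjoint. -/
theorem union_image_inContract {A B : Set Γ.E} :
    A ∪ Subtype.val '' (show Set {e // e ∉ A} from Γ.inContract A B) = A ∪ B := by
  ext x
  constructor
  · rintro (hx | ⟨y, hy, rfl⟩)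
    · exact .inl hx
    · exact .inr hy
  · rintro (hx | hx)
    · exact .inl hx
    · by_cases hxA : x ∈ A
      · exact .inl hxA
      · exact .inr ⟨⟨x, hxA⟩, hx, rfl⟩

theorem conn_inSub {A B : Set Γ.E} (h : B ⊆ A) {u v : Γ.V} :
    conn (Γ.sub A).ends (Γ.inSub A B) u v ↔ conn Γ.ends B u v := by
  have := Γ.conn_sub A (Γ.inSub A B) u v
  rwa [image_inSub h] at this

theorem conn_inContract {A B : Set Γ.E} {u v : Γ.V} :
    conn (Γ.contract A).ends (Γ.inContract A B) (Quotient.mk _ u) (Quotient.mk _ v) ↔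
      conn Γ.ends (A ∪ B) u v := by
  have := Γ.conn_contract A (Γ.inContract A B) u v
  rwa [union_image_inContract] at this

theorem spanning_inSub {A B : Set Γ.E} (h : B ⊆ A) (s : (Γ.sub A).S) :
    (Γ.sub A).Spanning (Γ.inSub A B) s ↔ Γ.Spanning B s.1 := by
  have := Γ.sub_spanning A (Γ.inSub A B) s
  rwa [image_inSub h] at this

theorem spanning_inContract {A B : Set Γ.E} (s : (Γ.contract A).S) :
    (Γ.contract A).Spanning (Γ.inContract A B) s ↔ Γ.Spanning (A ∪ B) s.1 := by
  have := Γ.contract_spanning A (Γ.inContract A B) s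
  rwa [union_image_inContract] at this

theorem spanning_inContract_of_subset {A B : Set Γ.E} (h : A ⊆ B) (s : (Γ.contract A).S) :
    (Γ.contract A).Spanning (Γ.inContract A B) s ↔ Γ.Spanning B s.1 := by
  rw [spanning_inContract, Set.union_eq_self_of_subset_left h]

theorem momentumSpanning_inSub {A B : Set Γ.E} (h : B ⊆ A) (s : (Γ.sub A).S) :
    (Γ.sub A).MomentumSpanning (Γ.inSub A B) s ↔ Γ.MomentumSpanning B s.1 :=
  forall₂_congr fun _ _ => forall₂_congr fun _ _ => conn_inSub h

theorem momentumSpanning_inContract {A B : Set Γ.E} (s : (Γ.contract A).S) :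
    (Γ.contract A).MomentumSpanning (Γ.inContract A B) s ↔
      Γ.MomentumSpanning (A ∪ B) s.1 := by
  constructor
  · intro h
    by_cases hm : Γ.MomentumSpanning A s.1
    · exact fun u hu v hv => conn_mono Set.subset_union_left (hm u hu v hv)
    · exact fun u hu v hv => conn_inContract.1 (h _ ⟨hm, u, hu, rfl⟩ _ ⟨hm, v, hv, rfl⟩)
  · rintro h _ ⟨_, u, hu, rfl⟩ _ ⟨_, v, hv, rfl⟩
    exact conn_inContract.2 (h u hu v hv)

theorem verts_inSub {A B : Set Γ.E} (h : B ⊆ A) :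
    verts (Γ.sub A).ends (Γ.inSub A B) = verts Γ.ends B := by
  ext v
  constructor
  · rintro ⟨e, he, hv⟩
    exact ⟨(e : A).1, he, hv⟩
  · rintro ⟨e, he, hv⟩
    exact ⟨(⟨e, h he⟩ : A), he, hv⟩

namespace Iso

/-- A subgraph of a subgraph. -/
def subSub {A B : Set Γ.E} (h : B ⊆ A) : Iso ((Γ.sub A).sub (Γ.inSub A B)) (Γ.sub B) where
  f := id
  g := id
  φ := show {e : A // e.1 ∈ B} ≃ B from
    ⟨fun e => ⟨e.1.1, e.2⟩, fun e => ⟨⟨e.1, h e.2⟩, e.2⟩, fun _ => rfl, fun _ => rfl⟩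
  -- A scale spanned by `B` is spanned by `A`, so none is lost in the intermediate step.
  σ := ⟨fun s => ⟨s.1.1, (spanning_inSub h s.1).1 s.2⟩,
    fun s => ⟨⟨s.1, s.2.mono h⟩, (spanning_inSub h ⟨s.1, s.2.mono h⟩).2 s.2⟩,
    fun _ => rfl, fun _ => rfl⟩
  gf _ _ _ := rfl
  fg _ _ _ := rfl
  ends e := (congrFun Sym2.map_id _).symm
  vtype _ _ _ := rfl
  etype _ := rfl
  mass := by
    intro s
    ext e
    constructor
    · exact fun he => ⟨(⟨⟨e.1, h e.2⟩, e.2⟩ : {e : A // e.1 ∈ B}), he, rfl⟩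
    · rintro ⟨e, he, rfl⟩
      exact he
  ext s := (Set.image_id _).symm

/-- The contraction of a subgraph in a subgraph is a subgraph of the contracted graph. -/
noncomputable def subContract {A B : Set Γ.E} (h : B ⊆ A) :
    Iso ((Γ.sub A).contract (Γ.inSub A B)) ((Γ.contract B).sub (Γ.inContract B A)) where
  f := Quotient.map' id fun _ _ => (conn_inSub h).1
  g := Quotient.map' id fun _ _ => (conn_inSub h).2
  φ := show {e : A // e.1 ∉ B} ≃ {e : {e // e ∉ B} // e.1 ∈ A} from
    ⟨fun e => ⟨⟨e.1.1, e.2⟩, e.1.2⟩, fun e => ⟨⟨e.1.1, e.2⟩, e.1.2⟩, fun _ => rfl, fun _ => rfl⟩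
  -- Both sides carry the scales that are spanned by `A` but not by `B`.
  σ := ⟨fun s => ⟨⟨s.1.1, fun hs => s.2 ((spanning_inSub h s.1).2 hs)⟩,
      (spanning_inContract_of_subset h _).2 s.1.2⟩,
    fun s => ⟨⟨s.1.1, (spanning_inContract_of_subset h s.1).1 s.2⟩,
      fun hs => s.1.2 ((spanning_inSub h _).1 hs)⟩, fun _ => rfl, fun _ => rfl⟩
  gf _ u _ := by
    induction u using Quotient.inductionOn
    rfl
  fg _ u _ := by
    induction u using Quotient.inductionOn
    rfl
  ends e := sm2 (by intro _; rfl) _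
  vtype _ u _ := by
    classical
    induction u using Quotient.inductionOn with | _ u => ?_
    refine (Γ.contract_vtype_mk B u).trans (Eq.trans ?_
      ((Γ.sub A).contract_vtype_mk (Γ.inSub A B) u).symm)
    rw [verts_inSub h]
    rfl
  etype _ := rfl
  mass := by
    intro s
    ext e
    constructor
    · exact fun he => ⟨(⟨⟨e.1.1, e.2⟩, e.1.2⟩ : {e : A // e.1 ∉ B}), he, rfl⟩
    · rintro ⟨e, he, rfl⟩
      exact he
  ext := by
    intro s
    ext x
    constructor
    · rintro ⟨hm, u, hu, rfl⟩
      exact ⟨Quotient.mk _ u, ⟨fun hm' => hm ((momentumSpanning_inSub h _).1 hm'), u, hu, rfl⟩,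
        rfl⟩
    · rintro ⟨_, ⟨hm, u, hu, rfl⟩, rfl⟩
      exact ⟨fun hm' => hm ((momentumSpanning_inSub h _).2 hm'), u, hu, rfl⟩

/-- Contraction in two steps. -/
noncomputable def contractContract {A B : Set Γ.E} (h : B ⊆ A) :
    Iso ((Γ.contract B).contract (Γ.inContract B A)) (Γ.contract A) :=
  have hBA : B ∪ A = A := Set.union_eq_self_of_subset_left h
  have hc : ∀ u v : Γ.V, conn (Γ.contract B).ends (Γ.inContract B A) (Quotient.mk _ u)
      (Quotient.mk _ v) ↔ conn Γ.ends A u v := fun u v => by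
    rw [conn_inContract, hBA]
  have hm : ∀ s, (Γ.contract B).MomentumSpanning (Γ.inContract B A) s ↔
      Γ.MomentumSpanning A s.1 := fun s => by
    rw [momentumSpanning_inContract, hBA]
  { f := Quotient.lift (Quotient.map' id fun _ _ => conn_mono h) fun x y hxy => by
      induction x using Quotient.inductionOn
      induction y using Quotient.inductionOn
      exact Quotient.sound ((hc _ _).1 hxy)
    g := Quotient.map' (Quotient.mk _) fun _ _ => (hc _ _).2
    φ := show {e : {e // e ∉ B} // e.1 ∉ A} ≃ {e // e ∉ A} from
      ⟨fun e => ⟨e.1.1, e.2⟩, fun e => ⟨⟨e.1, fun he => e.2 (h he)⟩, e.2⟩,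
        fun _ => rfl, fun _ => rfl⟩
    -- A scale not spanned by `A` is not spanned by the smaller `B` and survives both contractions.
    σ := ⟨fun s => ⟨s.1.1, fun hs => s.2 ((spanning_inContract_of_subset h s.1).2 hs)⟩,
      fun s => ⟨⟨s.1, fun hs => s.2 (hs.mono h)⟩, fun hs =>
        s.2 ((spanning_inContract_of_subset h _).1 hs)⟩, fun _ => rfl, fun _ => rfl⟩
    gf _ u _ := by
      induction u using Quotient.inductionOn with | _ u => ?_
      induction u using Quotient.inductionOn
      rfl
    fg _ u _ := by
      induction u using Quotient.inductionOn
      rfl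
    ends e := sm3 (by intro _; rfl) _
    vtype e x hx := by
      classical
      induction x using Quotient.inductionOn with | _ x => ?_
      induction x using Quotient.inductionOn with | _ u => ?_
      refine (Γ.contract_vtype_mk A u).trans (Eq.symm
        (((Γ.contract B).contract_vtype_mk (Γ.inContract B A) (Quotient.mk _ u)).trans ?_))
      split_ifs with h1 h2 h2
      · rfl
      · refine absurd ?_ h2
        obtain ⟨e, he, hu⟩ := h1
        obtain ⟨w, hw, hwu⟩ := Sym2.mem_map.1 hu
        rcases eq_or_verts_of_conn (Quotient.exact hwu) with rfl | h'
        · exact ⟨e.1, he, hw⟩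
        · exact verts_mono h h'.2
      -- Here `u` is a vertex of `A` that the second contraction does not touch. Then it is an end
      -- point of an edge in `B` and became a point in the first contraction.
      · refine (Γ.contract_vtype_mk B u).trans (if_pos ?_)
        obtain ⟨e, he, hu⟩ := h2
        by_contra hB
        exact h1 ⟨(⟨e, fun heB => hB ⟨e, heB, hu⟩⟩ : {e // e ∉ B}), he,
          Sym2.mem_map.2 ⟨u, hu, rfl⟩⟩
      · exact (Γ.contract_vtype_mk B u).trans (if_neg fun hB => h2 (verts_mono h hB))
    etype _ := rfl
    mass := by
      intro s
      ext e
      constructor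
      · exact fun he => ⟨(⟨⟨e.1, fun he => e.2 (h he)⟩, e.2⟩ : {e : {e // e ∉ B} // e.1 ∉ A}),
          he, rfl⟩
      · rintro ⟨e, he, rfl⟩
        exact he
    ext := by
      intro s
      ext x
      constructor
      · rintro ⟨hs, u, hu, rfl⟩
        exact ⟨Quotient.mk _ (Quotient.mk _ u), ⟨fun hs' => hs ((hm _).1 hs'), Quotient.mk _ u,
          ⟨fun hs' => hs fun a ha b hb => conn_mono h (hs' a ha b hb), u, hu, rfl⟩, rfl⟩, rfl⟩
      · rintro ⟨_, ⟨hs, _, ⟨_, u, hu, rfl⟩, rfl⟩, rfl⟩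
        exact ⟨fun hs' => hs ((hm _).2 hs'), u, hu, rfl⟩ }

/-- The subgraph that contains all edges. -/
def subUniv (Γ : FeynmanGraph T) : Iso (Γ.sub Set.univ) Γ where
  f := id
  g := id
  φ := Equiv.Set.univ Γ.E
  σ := Equiv.subtypeUnivEquiv fun s => ⟨fun _ _ => trivial, Γ.ext_conn s⟩
  gf _ _ _ := rfl
  fg _ _ _ := rfl
  ends e := (congrFun Sym2.map_id _).symm
  vtype _ _ _ := rfl
  etype _ := rfl
  mass := by
    intro s
    ext e
    constructor
    · exact fun he => ⟨(⟨e, trivial⟩ : (Set.univ : Set Γ.E)), he, rfl⟩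
    · rintro ⟨e, he, rfl⟩
      exact he
  ext s := (Set.image_id _).symm

end Iso

/-- A scale has a massive edge or two distinct external vertices. So the contraction of no edges
keeps every scale. -/
theorem not_spanning_empty (s : Γ.S) : ¬ Γ.Spanning ∅ s := by
  rintro ⟨h1, h2⟩
  rcases Γ.scale_nonempty s with ⟨e, he⟩ | ⟨u, hu⟩
  · exact h1 he
  · obtain ⟨v, hv, hne⟩ := Γ.ext_two s u hu
    exact hne (conn_empty.1 (h2 v hv u hu))

theorem isEmpty_scale [IsEmpty Γ.E] : IsEmpty Γ.S := by
  refine ⟨fun s => ?_⟩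
  rcases Γ.scale_nonempty s with ⟨e, _⟩ | ⟨u, hu⟩
  · exact isEmptyElim e
  · obtain ⟨e, _⟩ := Γ.ext_subset_verts s hu
    exact isEmptyElim e

namespace Iso

/-- The contraction of no edges. -/
noncomputable def contractEmpty (Γ : FeynmanGraph T) : Iso (Γ.contract ∅) Γ where
  f := Quotient.lift id fun _ _ h => conn_empty.1 h
  g := Quotient.mk _
  φ := Equiv.subtypeUnivEquiv fun _ h => h
  σ := Equiv.subtypeUnivEquiv not_spanning_empty
  gf _ u _ := by
    induction u using Quotient.inductionOn
    rfl
  fg _ _ _ := rfl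
  ends e := (congrFun Sym2.map_id _).symm.trans (sm2 (by intro _; rfl) _)
  vtype _ u _ := by
    induction u using Quotient.inductionOn with | _ u => ?_
    refine Eq.symm ((Γ.contract_vtype_mk ∅ u).trans (if_neg ?_))
    rintro ⟨e, he, _⟩
    exact he
  etype _ := rfl
  mass := by
    intro s
    ext e
    constructor
    · exact fun he => ⟨(⟨e, fun h => h⟩ : {e // e ∉ (∅ : Set Γ.E)}), he, rfl⟩
    · rintro ⟨e, he, rfl⟩
      exact he
  ext := by
    intro s
    ext u
    constructor
    · intro hu
      refine ⟨Quotient.mk _ u, ⟨fun hm => ?_, u, hu, rfl⟩, rfl⟩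
      obtain ⟨v, hv, hne⟩ := Γ.ext_two _ u hu
      exact hne (conn_empty.1 (hm v hv u hu))
    · rintro ⟨_, ⟨_, u, hu, rfl⟩, rfl⟩
      exact hu

/-- A graph without edges is the empty graph. -/
noncomputable def ofIsEmpty (Γ : FeynmanGraph T) [h : IsEmpty Γ.E] : Iso Γ (empty T) :=
  haveI := isEmpty_scale (Γ := Γ)
  { f := fun _ => ()
    g := fun _ => Classical.arbitrary _
    φ := Equiv.equivOfIsEmpty Γ.E Empty
    σ := Equiv.equivOfIsEmpty Γ.S Empty
    gf := isEmptyElim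
    fg := fun e => Empty.elim e
    ends := isEmptyElim
    vtype := isEmptyElim
    etype := isEmptyElim
    mass := isEmptyElim
    ext := isEmptyElim }

end Iso

section Sum

variable {Γ' : FeynmanGraph T}

theorem sum_conn_inl {A : Set (Γ.sum Γ').E} {u v : Γ.V} :
    conn (Γ.sum Γ').ends A (.inl u) (.inl v) ↔ conn Γ.ends (Sum.inl ⁻¹' A) u v :=
  conn_sum.trans Sum.liftRel_inl_inl

theorem sum_conn_inr {A : Set (Γ.sum Γ').E} {u v : Γ'.V} :
    conn (Γ.sum Γ').ends A (.inr u) (.inr v) ↔ conn Γ'.ends (Sum.inr ⁻¹' A) u v :=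
  conn_sum.trans Sum.liftRel_inr_inr

theorem inl_mem_sum_ends {e : Γ.E} {u : Γ.V} :
    Sum.inl u ∈ (Γ.sum Γ').ends (.inl e) ↔ u ∈ Γ.ends e := by
  refine (inl_mem_sumEnds (p := Γ.ends) (q := Γ'.ends) (e := .inl e)).trans
    ⟨?_, fun h => ⟨e, rfl, h⟩⟩
  rintro ⟨a, h, ha⟩
  cases h
  exact ha

theorem inr_mem_sum_ends {e : Γ'.E} {u : Γ'.V} :
    Sum.inr u ∈ (Γ.sum Γ').ends (.inr e) ↔ u ∈ Γ'.ends e := by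
  refine (inr_mem_sumEnds (p := Γ.ends) (q := Γ'.ends) (e := .inr e)).trans
    ⟨?_, fun h => ⟨e, rfl, h⟩⟩
  rintro ⟨a, h, ha⟩
  cases h
  exact ha

theorem sum_momentumSpanning_inl {A : Set (Γ.sum Γ').E} {s : Γ.S} :
    (Γ.sum Γ').MomentumSpanning A (.inl s) ↔ Γ.MomentumSpanning (Sum.inl ⁻¹' A) s := by
  constructor
  · intro h u hu v hv
    exact sum_conn_inl.1 (h _ ⟨u, hu, rfl⟩ _ ⟨v, hv, rfl⟩)
  · rintro h _ ⟨u, hu, rfl⟩ _ ⟨v, hv, rfl⟩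
    exact sum_conn_inl.2 (h u hu v hv)

theorem sum_momentumSpanning_inr {A : Set (Γ.sum Γ').E} {s : Γ'.S} :
    (Γ.sum Γ').MomentumSpanning A (.inr s) ↔ Γ'.MomentumSpanning (Sum.inr ⁻¹' A) s := by
  constructor
  · intro h u hu v hv
    exact sum_conn_inr.1 (h _ ⟨u, hu, rfl⟩ _ ⟨v, hv, rfl⟩)
  · rintro h _ ⟨u, hu, rfl⟩ _ ⟨v, hv, rfl⟩
    exact sum_conn_inr.2 (h u hu v hv)

theorem sum_spanning_inl {A : Set (Γ.sum Γ').E} {s : Γ.S} :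
    (Γ.sum Γ').Spanning A (.inl s) ↔ Γ.Spanning (Sum.inl ⁻¹' A) s :=
  and_congr Set.image_subset_iff sum_momentumSpanning_inl

theorem sum_spanning_inr {A : Set (Γ.sum Γ').E} {s : Γ'.S} :
    (Γ.sum Γ').Spanning A (.inr s) ↔ Γ'.Spanning (Sum.inr ⁻¹' A) s :=
  and_congr Set.image_subset_iff sum_momentumSpanning_inr

theorem inl_mem_verts_sum {A : Set (Γ.sum Γ').E} {u : Γ.V} :
    Sum.inl u ∈ verts (Γ.sum Γ').ends A ↔ u ∈ verts Γ.ends (Sum.inl ⁻¹' A) := by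
  constructor
  · rintro ⟨e, he, hu⟩
    obtain ⟨a, rfl, ha⟩ := inl_mem_sumEnds.1 hu
    exact ⟨a, he, ha⟩
  · rintro ⟨a, he, hu⟩
    exact ⟨.inl a, he, inl_mem_sum_ends.2 hu⟩

theorem inr_mem_verts_sum {A : Set (Γ.sum Γ').E} {u : Γ'.V} :
    Sum.inr u ∈ verts (Γ.sum Γ').ends A ↔ u ∈ verts Γ'.ends (Sum.inr ⁻¹' A) := by
  constructor
  · rintro ⟨e, he, hu⟩
    obtain ⟨a, rfl, ha⟩ := inr_mem_sumEnds.1 hu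
    exact ⟨a, he, ha⟩
  · rintro ⟨a, he, hu⟩
    exact ⟨.inr a, he, inr_mem_sum_ends.2 hu⟩

namespace Iso

/-- The subgraphs of a disjoint union. -/
def sumSub (A : Set (Γ.sum Γ').E) : Iso ((Γ.sum Γ').sub A)
    ((Γ.sub (Sum.inl ⁻¹' A)).sum (Γ'.sub (Sum.inr ⁻¹' A))) where
  f := id
  g := id
  φ := Equiv.subtypeSum
  σ := Equiv.subtypeSum.trans ((Equiv.subtypeEquivRight fun _ => sum_spanning_inl).sumCongr
    (Equiv.subtypeEquivRight fun _ => sum_spanning_inr))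
  gf _ _ _ := rfl
  fg _ _ _ := rfl
  ends := by
    rintro ⟨e | e, he⟩
    · exact (congrFun Sym2.map_id _).symm
    · exact (congrFun Sym2.map_id _).symm
  vtype := by
    rintro e (u | u) _
    · rfl
    · rfl
  etype := by
    rintro ⟨e | e, he⟩
    · rfl
    · rfl
  mass := by
    rintro ⟨s | s, hs⟩
    · ext (⟨e, he⟩ | ⟨e, he⟩)
      · constructor
        · rintro ⟨w, h, hw⟩
          obtain rfl := Sum.inl.inj hw
          exact ⟨⟨.inl e, he⟩, ⟨e, h, rfl⟩, rfl⟩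
        · rintro ⟨⟨_, _⟩, ⟨e', h, rfl⟩, h'⟩
          cases h'
          exact ⟨⟨e, he⟩, h, rfl⟩
      · constructor
        · rintro ⟨_, _, h⟩
          cases h
        · rintro ⟨⟨_, _⟩, ⟨e', h, rfl⟩, h'⟩
          cases h'
    · ext (⟨e, he⟩ | ⟨e, he⟩)
      · constructor
        · rintro ⟨_, _, h⟩
          cases h
        · rintro ⟨⟨_, _⟩, ⟨e', h, rfl⟩, h'⟩
          cases h'
      · constructor
        · rintro ⟨w, h, hw⟩
          obtain rfl := Sum.inr.inj hw
          exact ⟨⟨.inr e, he⟩, ⟨e, h, rfl⟩, rfl⟩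
        · rintro ⟨⟨_, _⟩, ⟨e', h, rfl⟩, h'⟩
          cases h'
          exact ⟨⟨e, he⟩, h, rfl⟩
  ext := by
    rintro ⟨s | s, hs⟩
    · exact (Set.image_id _).symm
    · exact (Set.image_id _).symm

/-- Contraction in a disjoint union. -/
noncomputable def sumContract (A : Set (Γ.sum Γ').E) : Iso ((Γ.sum Γ').contract A)
    ((Γ.contract (Sum.inl ⁻¹' A)).sum (Γ'.contract (Sum.inr ⁻¹' A))) where
  f := Quotient.lift (Sum.map (Quotient.mk _) (Quotient.mk _)) fun x y h => by
    rcases x with x | x <;> rcases y with y | y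
    · exact congrArg Sum.inl (Quotient.sound (sum_conn_inl.1 h))
    · cases conn_sum.1 h
    · cases conn_sum.1 h
    · exact congrArg Sum.inr (Quotient.sound (sum_conn_inr.1 h))
  g := Sum.elim (Quotient.map' Sum.inl fun _ _ h => conn_sum.2 (.inl h))
    (Quotient.map' Sum.inr fun _ _ h => conn_sum.2 (.inr h))
  φ := Equiv.subtypeSum
  σ := Equiv.subtypeSum.trans ((Equiv.subtypeEquivRight fun _ => sum_spanning_inl.not).sumCongr
    (Equiv.subtypeEquivRight fun _ => sum_spanning_inr.not))
  gf _ u _ := by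
    induction u using Quotient.inductionOn with | _ u => ?_
    rcases u with u | u
    · rfl
    · rfl
  fg := by
    rintro _ (u | u) _
    · induction u using Quotient.inductionOn
      rfl
    · induction u using Quotient.inductionOn
      rfl
  ends := by
    rintro ⟨e | e, he⟩
    · exact sm23 (by intro _; rfl) _
    · exact sm23 (by intro _; rfl) _
  vtype _ u _ := by
    classical
    induction u using Quotient.inductionOn with | _ u => ?_
    refine Eq.trans ?_ ((Γ.sum Γ').contract_vtype_mk A u).symm
    rcases u with u | u
    · refine (Γ.contract_vtype_mk _ u).trans ?_
      exact if_congr inl_mem_verts_sum.symm rfl rfl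
    · refine (Γ'.contract_vtype_mk _ u).trans ?_
      exact if_congr inr_mem_verts_sum.symm rfl rfl
  etype := by
    rintro ⟨e | e, he⟩
    · rfl
    · rfl
  mass := by
    rintro ⟨s | s, hs⟩
    · ext (⟨e, he⟩ | ⟨e, he⟩)
      · constructor
        · rintro ⟨w, h, hw⟩
          obtain rfl := Sum.inl.inj hw
          exact ⟨⟨.inl e, he⟩, ⟨e, h, rfl⟩, rfl⟩
        · rintro ⟨⟨_, _⟩, ⟨e', h, rfl⟩, h'⟩
          cases h'
          exact ⟨⟨e, he⟩, h, rfl⟩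
      · constructor
        · rintro ⟨_, _, h⟩
          cases h
        · rintro ⟨⟨_, _⟩, ⟨e', h, rfl⟩, h'⟩
          cases h'
    · ext (⟨e, he⟩ | ⟨e, he⟩)
      · constructor
        · rintro ⟨_, _, h⟩
          cases h
        · rintro ⟨⟨_, _⟩, ⟨e', h, rfl⟩, h'⟩
          cases h'
      · constructor
        · rintro ⟨w, h, hw⟩
          obtain rfl := Sum.inr.inj hw
          exact ⟨⟨.inr e, he⟩, ⟨e, h, rfl⟩, rfl⟩
        · rintro ⟨⟨_, _⟩, ⟨e', h, rfl⟩, h'⟩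
          cases h'
          exact ⟨⟨e, he⟩, h, rfl⟩
  ext := by
    rintro ⟨s | s, hs⟩
    · ext x
      constructor
      · rintro ⟨_, ⟨hm, u, hu, rfl⟩, rfl⟩
        exact ⟨Quotient.mk _ (.inl u), ⟨sum_momentumSpanning_inl.not.2 hm, _, ⟨u, hu, rfl⟩, rfl⟩,
          rfl⟩
      · rintro ⟨_, ⟨hm, _, ⟨u, hu, rfl⟩, rfl⟩, rfl⟩
        exact ⟨_, ⟨sum_momentumSpanning_inl.not.1 hm, u, hu, rfl⟩, rfl⟩
    · ext x
      constructor
      · rintro ⟨_, ⟨hm, u, hu, rfl⟩, rfl⟩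
        exact ⟨Quotient.mk _ (.inr u), ⟨sum_momentumSpanning_inr.not.2 hm, _, ⟨u, hu, rfl⟩, rfl⟩,
          rfl⟩
      · rintro ⟨_, ⟨hm, _, ⟨u, hu, rfl⟩, rfl⟩, rfl⟩
        exact ⟨_, ⟨sum_momentumSpanning_inr.not.1 hm, u, hu, rfl⟩, rfl⟩

end Iso

/-- The removal of an edge of one factor leaves the other factor whole, so that the scales of the
latter stay spanned. This converse to `IsMotic.sum` makes `graphOrZero` multiplicative. -/
theorem IsMotic.of_sum (h : (Γ.sum Γ').IsMotic) : Γ.IsMotic ∧ Γ'.IsMotic := by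
  rw [isMotic_iff] at h
  have hl : ∀ e : Γ.E, Sum.inr ⁻¹' ({.inl e}ᶜ : Set (Γ.E ⊕ Γ'.E)) = Set.univ := by
    intro e
    ext x
    simp
  have hl' : ∀ e : Γ.E, Sum.inl ⁻¹' ({.inl e}ᶜ : Set (Γ.E ⊕ Γ'.E)) = {e}ᶜ := by
    intro e
    ext x
    simp
  have hr : ∀ e : Γ'.E, Sum.inl ⁻¹' ({.inr e}ᶜ : Set (Γ.E ⊕ Γ'.E)) = Set.univ := by
    intro e
    ext x
    simp
  have hr' : ∀ e : Γ'.E, Sum.inr ⁻¹' ({.inr e}ᶜ : Set (Γ.E ⊕ Γ'.E)) = {e}ᶜ := by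
    intro e
    ext x
    simp
  constructor
  · rw [isMotic_iff]
    intro e hs u hu v hv
    have := h (.inl e) ?_ (.inl u) (inl_mem_sum_ends.2 hu) (.inl v)
      (inl_mem_sum_ends.2 hv)
    · have h : conn Γ.ends (Sum.inl ⁻¹' ({.inl e}ᶜ : Set (Γ.E ⊕ Γ'.E))) u v := sum_conn_inl.1 this
      rwa [hl'] at h
    · rintro (s | s)
      · refine sum_spanning_inl.2 ?_
        change Γ.Spanning (Sum.inl ⁻¹' ({.inl e}ᶜ : Set (Γ.E ⊕ Γ'.E))) s
        rw [hl' e]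
        exact hs s
      · refine sum_spanning_inr.2 ?_
        change Γ'.Spanning (Sum.inr ⁻¹' ({.inl e}ᶜ : Set (Γ.E ⊕ Γ'.E))) s
        rw [hl e]
        exact ⟨fun _ _ => trivial, Γ'.ext_conn s⟩
  · rw [isMotic_iff]
    intro e hs u hu v hv
    have := h (.inr e) ?_ (.inr u) (inr_mem_sum_ends.2 hu) (.inr v)
      (inr_mem_sum_ends.2 hv)
    · have h : conn Γ'.ends (Sum.inr ⁻¹' ({.inr e}ᶜ : Set (Γ.E ⊕ Γ'.E))) u v := sum_conn_inr.1 this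
      rwa [hr'] at h
    · rintro (s | s)
      · refine sum_spanning_inl.2 ?_
        change Γ.Spanning (Sum.inl ⁻¹' ({.inr e}ᶜ : Set (Γ.E ⊕ Γ'.E))) s
        rw [hr e]
        exact ⟨fun _ _ => trivial, Γ.ext_conn s⟩
      · refine sum_spanning_inr.2 ?_
        change Γ'.Spanning (Sum.inr ⁻¹' ({.inr e}ᶜ : Set (Γ.E ⊕ Γ'.E))) s
        rw [hr' e]
        exact hs s

end Sum

end FeynmanGraph

end Motic

/-! ### The antipode as a geometric series -/

namespace Motic

section Antipode

open WithConv LinearMap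

variable {A : Type*} [CommRing A] [Algebra ℚ A] {ι : Type*}

/-- The span of the basis vectors of degree less than `n`. -/
def degreeLT (b : Module.Basis ι ℚ A) (d : ι → ℕ) (n : ℕ) : Submodule ℚ A :=
  Submodule.span ℚ (b '' {i | d i < n})

theorem degreeLT_mono (b : Module.Basis ι ℚ A) (d : ι → ℕ) {m n : ℕ} (h : m ≤ n) :
    degreeLT b d m ≤ degreeLT b d n :=
  Submodule.span_mono (Set.image_mono fun _ hi => lt_of_lt_of_le hi h)

theorem eq_of_mem_degreeLT {b : Module.Basis ι ℚ A} {d : ι → ℕ} {n : ℕ} {N : Type*}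
    [AddCommGroup N] [Module ℚ N] {f g : A →ₗ[ℚ] N} (h : ∀ i, d i < n → f (b i) = g (b i)) {x : A}
    (hx : x ∈ degreeLT b d n) : f x = g x := by
  refine LinearMap.eqOn_span (R := ℚ) ?_ hx
  rintro _ ⟨i, hi, rfl⟩
  exact h i hi

/-- A coalgebra structure on an algebra which is connected with respect to the degree of the
vectors of a basis has an antipode. -/
theorem exists_antipode {Δ : A →ₗ[ℚ] A ⊗[ℚ] A} {ε : A →ₗ[ℚ] ℚ}
    (coassoc : TensorProduct.assoc ℚ A A A ∘ₗ Δ.rTensor A ∘ₗ Δ = Δ.lTensor A ∘ₗ Δ)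
    (rTensor_counit : ε.rTensor A ∘ₗ Δ = TensorProduct.mk ℚ ℚ A 1)
    (lTensor_counit : ε.lTensor A ∘ₗ Δ = (TensorProduct.mk ℚ A ℚ).flip 1) (counit_one : ε 1 = 1)
    (b : Module.Basis ι ℚ A) (d : ι → ℕ)
    (hΔ : ∀ i, Δ (b i) ∈ Submodule.span ℚ {z | ∃ x ∈ degreeLT b d (d i + 1),
      ∃ y ∈ degreeLT b d (d i + 1), (x = 1 ∨ y ∈ degreeLT b d (d i)) ∧ x ⊗ₜ y = z}) :
    ∃ S : A →ₗ[ℚ] A, LinearMap.mul' ℚ A ∘ₗ S.rTensor A ∘ₗ Δ = Algebra.linearMap ℚ A ∘ₗ ε ∧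
      LinearMap.mul' ℚ A ∘ₗ S.lTensor A ∘ₗ Δ = Algebra.linearMap ℚ A ∘ₗ ε := by
  let _ : Coalgebra ℚ A :=
    { comul := Δ
      counit := ε
      coassoc := coassoc
      rTensor_counit_comp_comul := rTensor_counit
      lTensor_counit_comp_comul := lTensor_counit }
  -- In the convolution algebra the identity is `1 - g`. Its inverse, the antipode, is the geometric
  -- series in `g`, which is finite in each degree because `g` kills `1`.
  let g : WithConv (A →ₗ[ℚ] A) := 1 - toConv LinearMap.id
  have hg : g.ofConv 1 = 0 := by
    change algebraMap ℚ A (ε 1) - 1 = 0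
    rw [counit_one, map_one, sub_self]
  have happ : ∀ f h : WithConv (A →ₗ[ℚ] A), ∀ x,
      (f * h).ofConv x = LinearMap.mul' ℚ A (TensorProduct.map f.ofConv h.ofConv (Δ x)) :=
    fun _ _ _ => rfl
  -- A convolution product at `b i` depends on its factors only through the tensors allowed by `hΔ`.
  have hcongr : ∀ f h f' h' : WithConv (A →ₗ[ℚ] A), ∀ i,
      (∀ x ∈ degreeLT b d (d i + 1), ∀ y ∈ degreeLT b d (d i + 1), x = 1 ∨ y ∈ degreeLT b d (d i) →
        f.ofConv x * h.ofConv y = f'.ofConv x * h'.ofConv y) →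
      (f * h).ofConv (b i) = (f' * h').ofConv (b i) := by
    intro f h f' h' i hfh
    rw [happ, happ]
    refine LinearMap.eqOn_span (R := ℚ) (f := LinearMap.mul' ℚ A ∘ₗ TensorProduct.map f.ofConv h.ofConv)
      (g := LinearMap.mul' ℚ A ∘ₗ TensorProduct.map f'.ofConv h'.ofConv) ?_ (hΔ i)
    rintro _ ⟨x, hx, y, hy, hxy, rfl⟩
    exact hfh x hx y hy hxy
  -- Every factor `g` lowers the degree by one: in a tensor `x ⊗ y` either `x = 1` is killed by `g`,
  -- or `y` has smaller degree and is killed by `g ^ n`.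
  have hpow : ∀ n, ∀ x ∈ degreeLT b d n, (g ^ n).ofConv x = 0 := by
    intro n
    induction n with
    | zero =>
      intro x hx
      have : x = 0 := by simpa [degreeLT] using hx
      rw [this, map_zero]
    | succ n ih =>
      intro x hx
      refine eq_of_mem_degreeLT (g := 0) (fun i hi => ?_) hx
      rw [pow_succ', hcongr g (g ^ n) 0 0 i]
      · rw [zero_mul]
        rfl
      · rintro x _ y _ (rfl | hy)
        · rw [hg, zero_mul]
          exact (zero_mul _).symm
        · rw [ih y (degreeLT_mono b d (Nat.lt_succ_iff.1 hi) hy), mul_zero]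
          exact (zero_mul _).symm
  let G : ℕ → WithConv (A →ₗ[ℚ] A) := fun n => ∑ k ∈ Finset.range n, g ^ k
  have hG : ∀ m n, m ≤ n → ∀ x ∈ degreeLT b d m, (G n).ofConv x = (G m).ofConv x := by
    intro m n hmn x hx
    induction n, hmn using Nat.le_induction with
    | base => rfl
    | succ n hmn ih =>
      have : G (n + 1) = G n + g ^ n := Finset.sum_range_succ _ _
      rw [this]
      change (G n).ofConv x + (g ^ n).ofConv x = _
      rw [hpow n x (degreeLT_mono b d hmn hx), add_zero, ih]
  -- The powers of `g` from the exponent `d i + 1` on vanish at `b i`, so nothing is lost by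
  -- truncation.
  let S : A →ₗ[ℚ] A := b.constr ℚ fun i => (G (d i + 1)).ofConv (b i)
  have hS : ∀ n, ∀ x ∈ degreeLT b d n, S x = (G n).ofConv x := by
    intro n x hx
    refine eq_of_mem_degreeLT (fun i hi => ?_) hx
    rw [Module.Basis.constr_basis]
    exact (hG _ _ hi _ (Submodule.subset_span ⟨i, Nat.lt_succ_self _, rfl⟩)).symm
  have hmem : ∀ i, b i ∈ degreeLT b d (d i + 1) := fun i =>
    Submodule.subset_span ⟨i, Nat.lt_succ_self _, rfl⟩
  have hid : toConv LinearMap.id = 1 - g := (sub_sub_cancel _ _).symm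
  refine ⟨S, b.ext fun i => ?_, b.ext fun i => ?_⟩
  -- On the tensors that occur, `S` agrees with the truncated series. Its product with `1 - g`
  -- telescopes to `1 - g ^ (d i + 1)`, and the last power vanishes at `b i`.
  · change (toConv S * toConv LinearMap.id).ofConv (b i) = (1 : WithConv (A →ₗ[ℚ] A)).ofConv (b i)
    rw [hcongr _ _ (G (d i + 1)) (toConv LinearMap.id) i, hid, geom_sum_mul_neg]
    · change _ - (g ^ (d i + 1)).ofConv (b i) = _
      rw [hpow _ _ (hmem i), sub_zero]
      rfl
    · intro x hx y _ _
      exact congrArg (· * _) (hS _ x hx)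
  · change (toConv LinearMap.id * toConv S).ofConv (b i) = (1 : WithConv (A →ₗ[ℚ] A)).ofConv (b i)
    rw [hcongr _ _ (toConv LinearMap.id) (G (d i + 1)) i, hid, mul_neg_geom_sum]
    · change _ - (g ^ (d i + 1)).ofConv (b i) = _
      rw [hpow _ _ (hmem i), sub_zero]
      rfl
    · intro x _ y hy _
      exact congrArg (_ * ·) (hS _ y hy)

end Antipode

end Motic

/-! ### Transport of a Hopf algebra structure along a projection -/

namespace Motic

section Quotient

universe u v

variable {A : Type u} [CommRing A] [Algebra ℚ A] {B : Type v} [CommRing B] [Algebra ℚ B]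
  {Δ : A →ₗ[ℚ] A ⊗[ℚ] A} {ε : A →ₗ[ℚ] ℚ} {S : A →ₗ[ℚ] A}

/-- A multiplicative projection whose kernel is stable under the structure maps of a Hopf algebra
transports the Hopf algebra structure to its range, and gives rise to coactions. -/
theorem exists_isHopf_of_projection (h : IsHopf Δ ε S) (ρ : A →ₗ[ℚ] B) (i : B →ₗ[ℚ] A)
    (hρi : ∀ b, ρ (i b) = b) (hρ1 : ρ 1 = 1) (hρm : ∀ a b, ρ (a * b) = ρ a * ρ b)
    (hΔ : ∀ a, ρ a = 0 → TensorProduct.map ρ ρ (Δ a) = 0) (hε : ∀ a, ρ a = 0 → ε a = 0)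
    (hS : ∀ a, ρ a = 0 → ρ (S a) = 0) :
    ∃ (Δ' : B →ₗ[ℚ] B ⊗[ℚ] B) (ε' : B →ₗ[ℚ] ℚ) (S' : B →ₗ[ℚ] B) (h' : IsHopf Δ' ε' S'),
      KernelIsHopfIdeal h h' ρ ∧ IsLeftCoaction Δ' ε' (ρ.rTensor A ∘ₗ Δ) ∧
        IsRightCoaction Δ' ε' (ρ.lTensor A ∘ₗ Δ) := by
  have hsurj : Function.Surjective ρ := fun b => ⟨i b, hρi b⟩
  -- The elements `i (ρ a)` and `a` differ by an element of the kernel. As the structure maps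
  -- respect the kernel, the maps defined below through the section `i` commute with `ρ`.
  have hker : ∀ a, ρ (i (ρ a) - a) = 0 := fun a => by rw [map_sub, hρi, sub_self]
  let Δ' : B →ₗ[ℚ] B ⊗[ℚ] B := TensorProduct.map ρ ρ ∘ₗ Δ ∘ₗ i
  let ε' : B →ₗ[ℚ] ℚ := ε ∘ₗ i
  let S' : B →ₗ[ℚ] B := ρ ∘ₗ S ∘ₗ i
  have hΔ' : ∀ a, Δ' (ρ a) = TensorProduct.map ρ ρ (Δ a) := fun a => by
    have := hΔ _ (hker a)
    rwa [map_sub, map_sub, sub_eq_zero] at this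
  have hε' : ∀ a, ε' (ρ a) = ε a := fun a => by
    have := hε _ (hker a)
    rwa [map_sub, sub_eq_zero] at this
  have hS' : ∀ a, S' (ρ a) = ρ (S a) := fun a => by
    have := hS _ (hker a)
    rwa [map_sub, map_sub, sub_eq_zero] at this
  let ρa : A →ₐ[ℚ] B := AlgHom.ofLinearMap ρ hρ1 hρm
  have hρa : ∀ z, TensorProduct.map ρ ρ z = Algebra.TensorProduct.map ρa ρa z := fun _ => rfl
  have hmul : ∀ z, LinearMap.mul' ℚ B (TensorProduct.map ρ ρ z) = ρ (LinearMap.mul' ℚ A z) := by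
    intro z
    induction z using TensorProduct.induction_on with
    | zero => simp
    | tmul x y => simp [hρm]
    | add x y hx hy => simp only [map_add, hx, hy]
  -- Since `ρ` is surjective, each axiom needs to be checked on elements `ρ a` only, where it is the
  -- image of the axiom for `A`.
  have h' : IsHopf Δ' ε' S' := by
    constructor
    · refine LinearMap.ext fun b => ?_
      obtain ⟨a, rfl⟩ := hsurj b
      have e1 : TensorProduct.assoc ℚ B B B ∘ₗ Δ'.rTensor B ∘ₗ TensorProduct.map ρ ρ =
          TensorProduct.map ρ (TensorProduct.map ρ ρ) ∘ₗ TensorProduct.assoc ℚ A A A ∘ₗ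
            Δ.rTensor A := by
        ext x y
        simp only [TensorProduct.AlgebraTensorModule.curry_apply, TensorProduct.curry_apply,
          LinearMap.coe_restrictScalars, LinearMap.comp_apply, TensorProduct.map_tmul,
          LinearMap.rTensor_tmul, hΔ', LinearEquiv.coe_coe]
        induction Δ x using TensorProduct.induction_on with
        | zero => simp
        | tmul x y => simp
        | add x y hx hy => simp only [map_add, TensorProduct.add_tmul, hx, hy]
      have e2 : Δ'.lTensor B ∘ₗ TensorProduct.map ρ ρ =
          TensorProduct.map ρ (TensorProduct.map ρ ρ) ∘ₗ Δ.lTensor A := by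
        ext x y
        simp [hΔ']
      have := congrArg (TensorProduct.map ρ (TensorProduct.map ρ ρ))
        (LinearMap.congr_fun h.coassoc a)
      simp only [LinearMap.comp_apply, hΔ'] at this ⊢
      have e1' := LinearMap.congr_fun e1 (Δ a)
      have e2' := LinearMap.congr_fun e2 (Δ a)
      simp only [LinearMap.comp_apply] at e1' e2'
      rw [e1', e2', this]
    · refine LinearMap.ext fun b => ?_
      obtain ⟨a, rfl⟩ := hsurj b
      have e : ε'.rTensor B ∘ₗ TensorProduct.map ρ ρ = ρ.lTensor ℚ ∘ₗ ε.rTensor A := by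
        ext x y
        simp [hε']
      have e' := LinearMap.congr_fun e (Δ a)
      have := LinearMap.congr_fun h.rTensor_counit a
      simp only [LinearMap.comp_apply, hΔ'] at this e' ⊢
      rw [e', this]
      simp
    · refine LinearMap.ext fun b => ?_
      obtain ⟨a, rfl⟩ := hsurj b
      have e : ε'.lTensor B ∘ₗ TensorProduct.map ρ ρ = ρ.rTensor ℚ ∘ₗ ε.lTensor A := by
        ext x y
        simp [hε']
      have e' := LinearMap.congr_fun e (Δ a)
      have := LinearMap.congr_fun h.lTensor_counit a
      simp only [LinearMap.comp_apply, hΔ'] at this e' ⊢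
      rw [e', this]
      simp
    · rw [← hρ1, hΔ', h.comul_one, hρa, map_one]
    · intro a b
      obtain ⟨a, rfl⟩ := hsurj a
      obtain ⟨b, rfl⟩ := hsurj b
      rw [← hρm, hΔ', hΔ', hΔ', h.comul_mul, hρa, hρa, hρa, map_mul]
    · rw [← hρ1, hε', h.counit_one]
    · intro a b
      obtain ⟨a, rfl⟩ := hsurj a
      obtain ⟨b, rfl⟩ := hsurj b
      rw [← hρm, hε', hε', hε', h.counit_mul]
    · refine LinearMap.ext fun b => ?_
      obtain ⟨a, rfl⟩ := hsurj b
      have e : S'.rTensor B ∘ₗ TensorProduct.map ρ ρ = TensorProduct.map ρ ρ ∘ₗ S.rTensor A := by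
        ext x y
        simp [hS']
      have e' := LinearMap.congr_fun e (Δ a)
      have := LinearMap.congr_fun h.antipode_left a
      simp only [LinearMap.comp_apply, hΔ', hε'] at this e' ⊢
      rw [e', hmul, this]
      exact ρa.commutes _
    · refine LinearMap.ext fun b => ?_
      obtain ⟨a, rfl⟩ := hsurj b
      have e : S'.lTensor B ∘ₗ TensorProduct.map ρ ρ = TensorProduct.map ρ ρ ∘ₗ S.lTensor A := by
        ext x y
        simp [hS']
      have e' := LinearMap.congr_fun e (Δ a)
      have := LinearMap.congr_fun h.antipode_right a
      simp only [LinearMap.comp_apply, hΔ', hε'] at this e' ⊢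
      rw [e', hmul, this]
      exact ρa.commutes _
  refine ⟨Δ', ε', S', h', ?_, ?_, ?_⟩
  · let _ := h.toHopfAlgebra
    let _ := h'.toHopfAlgebra
    let I : Ideal A := RingHom.ker ρa
    have hI : ∀ a, a ∈ I ↔ ρ a = 0 := fun a => RingHom.mem_ker
    have hH : I.IsHopfIdeal ℚ :=
      { counit_eq_zero := fun x hx => hε x ((hI x).1 hx)
        map_mkQ_comul_eq_zero := fun x hx => by
          -- The quotient map factors through `ρ` by means of `i`. Hence its tensor square factors
          -- through that of `ρ`, which annihilates the coproduct of the kernel.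
          have e : TensorProduct.map (I.restrictScalars ℚ).mkQ (I.restrictScalars ℚ).mkQ =
              TensorProduct.map ((I.restrictScalars ℚ).mkQ ∘ₗ i) ((I.restrictScalars ℚ).mkQ ∘ₗ i) ∘ₗ
                TensorProduct.map ρ ρ := by
            have e0 : ((I.restrictScalars ℚ).mkQ ∘ₗ i) ∘ₗ ρ = (I.restrictScalars ℚ).mkQ :=
              LinearMap.ext fun a => (Submodule.Quotient.eq _).2 ((hI _).2 (hker a))
            rw [← TensorProduct.map_comp, e0]
          rw [e, LinearMap.comp_apply]
          refine (congrArg _ (hΔ x ((hI x).1 hx))).trans (map_zero _)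
        antipode_mem := fun x hx => (hI _).2 (hS x ((hI x).1 hx)) }
    let q : (A ⧸ I) ≃ₐ[ℚ] B := Ideal.quotientKerAlgEquivOfSurjective (f := ρa) hsurj
    have hq : ∀ z, Algebra.TensorProduct.map (q : (A ⧸ I) →ₐ[ℚ] B) (q : (A ⧸ I) →ₐ[ℚ] B)
        (TensorProduct.map (Ideal.Quotient.mkₐ ℚ I).toLinearMap
          (Ideal.Quotient.mkₐ ℚ I).toLinearMap z) = TensorProduct.map ρ ρ z := by
      intro z
      induction z using TensorProduct.induction_on with
      | zero => simp only [map_zero]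
      | tmul x y => rfl
      | add x y hx hy => simp only [map_add, hx, hy]
    refine ⟨I, ?_, hH, BialgEquiv.ofAlgEquiv q ?_ ?_, fun a => ?_⟩
    · ext a
      exact hI a
    · refine Ideal.Quotient.algHom_ext ℚ (AlgHom.ext fun a => ?_)
      exact hε' a
    · refine Ideal.Quotient.algHom_ext ℚ (AlgHom.ext fun a => ?_)
      refine Eq.trans ?_ (hΔ' a).symm
      exact hq (Δ a)
    · rfl
  · constructor
    · refine LinearMap.ext fun a => ?_
      -- The left coaction law is the coassociativity of `Δ` with `ρ` applied to the first two
      -- tensor factors; for the right coaction it is applied to the last two.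
      have e1 : TensorProduct.assoc ℚ B B A ∘ₗ Δ'.rTensor A ∘ₗ ρ.rTensor A =
          TensorProduct.map ρ (ρ.rTensor A) ∘ₗ TensorProduct.assoc ℚ A A A ∘ₗ Δ.rTensor A := by
        ext x y
        simp only [TensorProduct.AlgebraTensorModule.curry_apply, TensorProduct.curry_apply,
          LinearMap.coe_restrictScalars, LinearMap.comp_apply, LinearMap.rTensor_tmul, hΔ',
          LinearEquiv.coe_coe]
        induction Δ x using TensorProduct.induction_on with
        | zero => simp
        | tmul x y => simp
        | add x y hx hy => simp only [map_add, TensorProduct.add_tmul, hx, hy]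
      have e2 : (ρ.rTensor A ∘ₗ Δ).lTensor B ∘ₗ ρ.rTensor A =
          TensorProduct.map ρ (ρ.rTensor A) ∘ₗ Δ.lTensor A := by
        ext x y
        simp
      have := congrArg (TensorProduct.map ρ (ρ.rTensor A)) (LinearMap.congr_fun h.coassoc a)
      have e1' := LinearMap.congr_fun e1 (Δ a)
      have e2' := LinearMap.congr_fun e2 (Δ a)
      simp only [LinearMap.comp_apply] at this e1' e2' ⊢
      rw [e1', e2', this]
    · refine LinearMap.ext fun a => ?_
      have e : ε'.rTensor A ∘ₗ ρ.rTensor A = ε.rTensor A := by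
        ext x y
        simp [hε']
      have e' := LinearMap.congr_fun e (Δ a)
      have := LinearMap.congr_fun h.rTensor_counit a
      simp only [LinearMap.comp_apply] at this e' ⊢
      rw [e', this]
      simp
  · constructor
    · refine LinearMap.ext fun a => ?_
      have e1 : TensorProduct.assoc ℚ A B B ∘ₗ (ρ.lTensor A ∘ₗ Δ).rTensor B ∘ₗ ρ.lTensor A =
          (TensorProduct.map ρ ρ).lTensor A ∘ₗ TensorProduct.assoc ℚ A A A ∘ₗ Δ.rTensor A := by
        ext x y
        simp only [TensorProduct.AlgebraTensorModule.curry_apply, TensorProduct.curry_apply,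
          LinearMap.coe_restrictScalars, LinearMap.comp_apply, LinearMap.rTensor_tmul,
          LinearMap.lTensor_tmul, LinearEquiv.coe_coe]
        induction Δ x using TensorProduct.induction_on with
        | zero => simp
        | tmul x y => simp
        | add x y hx hy => simp only [map_add, TensorProduct.add_tmul, hx, hy]
      have e2 : Δ'.lTensor A ∘ₗ ρ.lTensor A =
          (TensorProduct.map ρ ρ).lTensor A ∘ₗ Δ.lTensor A := by
        ext x y
        simp [hΔ']
      have := congrArg ((TensorProduct.map ρ ρ).lTensor A) (LinearMap.congr_fun h.coassoc a)
      have e1' := LinearMap.congr_fun e1 (Δ a)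
      have e2' := LinearMap.congr_fun e2 (Δ a)
      simp only [LinearMap.comp_apply] at this e1' e2' ⊢
      rw [e1', e2', this]
    · refine LinearMap.ext fun a => ?_
      have e : ε'.lTensor A ∘ₗ ρ.lTensor A = ε.lTensor A := by
        ext x y
        simp [hε']
      have e' := LinearMap.congr_fun e (Δ a)
      have := LinearMap.congr_fun h.lTensor_counit a
      simp only [LinearMap.comp_apply] at this e' ⊢
      rw [e', this]
      simp

end Quotient

end Motic

/-! ### The Hopf algebra of motic graphs -/

namespace Motic

open FeynmanGraph

section Sums

/-- Used to extend sums over motic subgraphs to all edge sets by terms that vanish. -/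
theorem finsum_subtype_eq_sum {α N : Type*} [Fintype α] [AddCommMonoid N] {p : α → Prop}
    {f : {a // p a} → N} {F : α → N} (h : ∀ a, f a = F a.1) (h0 : ∀ a, ¬ p a → F a = 0) :
    ∑ᶠ a, f a = ∑ a, F a := by
  classical
  rw [finsum_congr h, finsum_subtype_eq_finsum_cond (f := F) p, ← finsum_eq_sum_of_fintype]
  refine finsum_congr fun a => ?_
  rw [finsum_eq_if]
  split_ifs with ha
  · rfl
  · exact (h0 a ha).symm

variable {T : PowerCounting} (Γ : FeynmanGraph T)

noncomputable instance FeynmanGraph.fintypeSetE : Fintype (Set Γ.E) := Fintype.ofFinite _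

open Classical in
-- The edge sets of `γ` are the edge sets of `Γ` inside `A`; those of `Γ/γ` correspond to the edge
-- sets of `Γ` that contain `A`. With both reindexings an iterated coproduct becomes a sum over
-- chains.
theorem sum_set_sub {N : Type*} [AddCommMonoid N] (A : Set Γ.E) (F : Set (Γ.sub A).E → N) :
    ∑ B, F B = ∑ B : Set Γ.E with B ⊆ A, F (Γ.inSub A B) := by
  refine Finset.sum_nbij' (fun B : Set A => Subtype.val '' B) (fun B => Γ.inSub A B)
    (fun B _ => ?_) (fun _ _ => Finset.mem_univ _) (fun (B : Set A) _ => ?_) (fun B hB => ?_)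
    (fun (B : Set A) _ => ?_)
  · rw [Finset.mem_filter]
    exact ⟨Finset.mem_univ _, Subtype.coe_image_subset A B⟩
  · exact Set.preimage_image_eq B Subtype.val_injective
  · exact image_inSub (Finset.mem_filter.1 hB).2
  · exact congrArg F (Set.preimage_image_eq B Subtype.val_injective).symm

open Classical in
theorem sum_set_contract {N : Type*} [AddCommMonoid N] (A : Set Γ.E)
    (F : Set (Γ.contract A).E → N) :
    ∑ B, F B = ∑ B : Set Γ.E with A ⊆ B, F (Γ.inContract A B) := by
  have key : ∀ B : Set {e // e ∉ A}, Γ.inContract A (A ∪ Subtype.val '' B) = B := by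
    intro B
    ext e
    constructor
    · rintro (he | ⟨e', he', h⟩)
      · exact absurd he (e : {e // e ∉ A}).2
      · exact Subtype.ext h ▸ he'
    · exact fun he => .inr ⟨e, he, rfl⟩
  refine Finset.sum_nbij' (fun B : Set {e // e ∉ A} => A ∪ Subtype.val '' B)
    (fun B => Γ.inContract A B)
    (fun B _ => ?_) (fun _ _ => Finset.mem_univ _) (fun B _ => key B) (fun B hB => ?_)
    (fun B _ => congrArg F (key B).symm)
  · rw [Finset.mem_filter]
    exact ⟨Finset.mem_univ _, Set.subset_union_left⟩
  · exact union_image_inContract.trans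
      (Set.union_eq_self_of_subset_left (Finset.mem_filter.1 hB).2)

theorem sum_set_sum {N : Type*} [AddCommMonoid N] (Γ' : FeynmanGraph T)
    (F : Set Γ.E → Set Γ'.E → N) :
    ∑ A : Set (Γ.sum Γ').E, F (Sum.inl ⁻¹' A) (Sum.inr ⁻¹' A) = ∑ A, ∑ B, F A B := by
  rw [← Fintype.sum_prod_type' F]
  exact Fintype.sum_equiv (show Set (Γ.sum Γ').E ≃ Set Γ.E × Set Γ'.E from
    Equiv.sumArrowEquivProdArrow Γ.E Γ'.E Prop) _ _ fun _ => rfl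

end Sums

variable {T : PowerCounting}

open Classical in
/-- A graph as an element of `M T`, where the graphs which are not motic are set to zero. -/
noncomputable def graphOrZero (Γ : FeynmanGraph T) : M T :=
  if h : Γ.IsMotic then graph Γ h else 0

theorem graphOrZero_of_isMotic {Γ : FeynmanGraph T} (h : Γ.IsMotic) :
    graphOrZero Γ = graph Γ h := dif_pos h

theorem graphOrZero_of_not_isMotic {Γ : FeynmanGraph T} (h : ¬ Γ.IsMotic) :
    graphOrZero Γ = 0 := dif_neg h

theorem graphOrZero_eq {Γ Γ' : FeynmanGraph T} (i : Iso Γ Γ') :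
    graphOrZero Γ = graphOrZero Γ' := by
  by_cases h : Γ.IsMotic
  · rw [graphOrZero_of_isMotic h, graphOrZero_of_isMotic (i.isMotic h), graph_eq i]
  · rw [graphOrZero_of_not_isMotic h,
      graphOrZero_of_not_isMotic fun h' => h (i.symm.isMotic h')]

/-- A disjoint union is motic exactly if both factors are, so both sides vanish together. -/
theorem graphOrZero_sum (Γ Γ' : FeynmanGraph T) :
    graphOrZero (Γ.sum Γ') = graphOrZero Γ * graphOrZero Γ' := by
  by_cases h : Γ.IsMotic
  · by_cases h' : Γ'.IsMotic
    · rw [graphOrZero_of_isMotic h, graphOrZero_of_isMotic h', graphOrZero_of_isMotic (h.sum h')]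
      unfold graph
      rw [MonoidAlgebra.single_mul_single, one_mul]
      rfl
    · rw [graphOrZero_of_not_isMotic h', mul_zero,
        graphOrZero_of_not_isMotic fun hs => h' hs.of_sum.2]
  · rw [graphOrZero_of_not_isMotic h, zero_mul,
      graphOrZero_of_not_isMotic fun hs => h hs.of_sum.1]

theorem graphOrZero_of_isEmpty (Γ : FeynmanGraph T) [IsEmpty Γ.E] : graphOrZero Γ = 1 := by
  rw [graphOrZero_eq (Iso.ofIsEmpty Γ), graphOrZero_of_isMotic isMotic_empty]
  rfl

theorem basis_mk (Γ : FeynmanGraph T) (h : Γ.IsMotic) :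
    MonoidAlgebra.basis (MoticClass T) ℚ (MoticClass.mk Γ h) = graphOrZero Γ := by
  rw [MonoidAlgebra.basis_apply, graphOrZero_of_isMotic h]
  rfl

theorem linearMap_ext {N : Type*} [AddCommMonoid N] [Module ℚ N] {f g : M T →ₗ[ℚ] N}
    (h : ∀ Γ : FeynmanGraph T, f (graphOrZero Γ) = g (graphOrZero Γ)) : f = g := by
  refine (MonoidAlgebra.basis (MoticClass T) ℚ).ext fun x => ?_
  induction x using Quotient.inductionOn with | _ x => ?_
  have := h x.1
  rwa [← basis_mk x.1 x.2] at this

theorem map_mul_of_graphOrZero {B : Type*} [CommRing B] [Algebra ℚ B] (f : M T →ₗ[ℚ] B)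
    (h : ∀ Γ Γ' : FeynmanGraph T,
      f (graphOrZero (Γ.sum Γ')) = f (graphOrZero Γ) * f (graphOrZero Γ')) (a b : M T) :
    f (a * b) = f a * f b := by
  have : (LinearMap.mul ℚ (M T)).compr₂ f = (LinearMap.mul ℚ B).compl₁₂ f f := by
    refine linearMap_ext fun Γ => linearMap_ext fun Γ' => ?_
    simp only [LinearMap.compr₂_apply, LinearMap.mul_apply', LinearMap.compl₁₂_apply]
    rw [← graphOrZero_sum, h]
  exact LinearMap.congr_fun (LinearMap.congr_fun this a) b

/-- If `Γ` is not motic, the right hand side vanishes too, since `γ` and `Γ/γ` cannot both be motic.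
After this lemma the motic condition plays no part in coassociativity and multiplicativity. -/
theorem coproduct_graphOrZero (Γ : FeynmanGraph T) :
    coproduct T (graphOrZero Γ) =
      ∑ A : Set Γ.E, graphOrZero (Γ.sub A) ⊗ₜ[ℚ] graphOrZero (Γ.contract A) := by
  by_cases h : Γ.IsMotic
  · rw [← basis_mk Γ h, coproduct, Module.Basis.constr_basis]
    refine finsum_subtype_eq_sum (fun A => ?_) fun A hA => ?_
    · rw [graphOrZero_of_isMotic A.2, graphOrZero_of_isMotic (h.contract A.1)]
      rfl
    · rw [graphOrZero_of_not_isMotic hA, TensorProduct.zero_tmul]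
  · rw [graphOrZero_of_not_isMotic h, map_zero]
    refine (Finset.sum_eq_zero fun A _ => ?_).symm
    by_cases h1 : (Γ.sub A).IsMotic
    · rw [graphOrZero_of_not_isMotic fun h2 => h (isMotic_of_sub_of_contract h1 h2),
        TensorProduct.tmul_zero]
    · rw [graphOrZero_of_not_isMotic h1, TensorProduct.zero_tmul]

/-- Both sides are sums over chains `B ⊆ A`, with the terms given by the subgraph `B`, the quotient
of `A` by `B` and the contraction of `A`. -/
theorem coproduct_coassoc : TensorProduct.assoc ℚ (M T) (M T) (M T) ∘ₗ
    (coproduct T).rTensor (M T) ∘ₗ coproduct T =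
      (coproduct T).lTensor (M T) ∘ₗ coproduct T := by
  classical
  refine linearMap_ext fun Γ => ?_
  have e1 : ∀ A : Set Γ.E, TensorProduct.assoc ℚ (M T) (M T) (M T) ((coproduct T).rTensor (M T)
      (graphOrZero (Γ.sub A) ⊗ₜ[ℚ] graphOrZero (Γ.contract A))) =
        ∑ B : Set Γ.E with B ⊆ A, graphOrZero (Γ.sub B) ⊗ₜ[ℚ]
          (graphOrZero ((Γ.contract B).sub (Γ.inContract B A)) ⊗ₜ[ℚ]
            graphOrZero (Γ.contract A)) := by
    intro A
    rw [LinearMap.rTensor_tmul, coproduct_graphOrZero, TensorProduct.sum_tmul, map_sum,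
      sum_set_sub]
    refine Finset.sum_congr rfl fun B hB => ?_
    have hBA := (Finset.mem_filter.1 hB).2
    rw [TensorProduct.assoc_tmul, graphOrZero_eq (Iso.subSub hBA),
      graphOrZero_eq (Iso.subContract hBA)]
  have e2 : ∀ B : Set Γ.E, (coproduct T).lTensor (M T)
      (graphOrZero (Γ.sub B) ⊗ₜ[ℚ] graphOrZero (Γ.contract B)) =
        ∑ A : Set Γ.E with B ⊆ A, graphOrZero (Γ.sub B) ⊗ₜ[ℚ]
          (graphOrZero ((Γ.contract B).sub (Γ.inContract B A)) ⊗ₜ[ℚ]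
            graphOrZero (Γ.contract A)) := by
    intro B
    rw [LinearMap.lTensor_tmul, coproduct_graphOrZero, TensorProduct.tmul_sum, sum_set_contract]
    refine Finset.sum_congr rfl fun A hA => ?_
    rw [graphOrZero_eq (Iso.contractContract (Finset.mem_filter.1 hA).2)]
  simp only [LinearMap.comp_apply, LinearEquiv.coe_coe]
  rw [coproduct_graphOrZero, map_sum, map_sum, map_sum, Finset.sum_congr rfl fun A _ => e1 A,
    Finset.sum_congr rfl fun B _ => e2 B]
  refine Finset.sum_comm' ?_
  simp

instance : IsEmpty (empty T).E := inferInstanceAs (IsEmpty Empty)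

theorem mk_eq_one_iff {Γ : FeynmanGraph T} (h : Γ.IsMotic) :
    MoticClass.mk Γ h = 1 ↔ IsEmpty Γ.E := by
  constructor
  · intro h1
    obtain ⟨i⟩ : Nonempty (Iso Γ (empty T)) := Quotient.exact h1
    exact i.φ.isEmpty
  · intro _
    exact MoticClass.mk_eq (Iso.ofIsEmpty Γ)

theorem counit_of_nonempty (Γ : FeynmanGraph T) [Nonempty Γ.E] :
    counit T (graphOrZero Γ) = 0 := by
  by_cases h : Γ.IsMotic
  · rw [← basis_mk Γ h, counit, Module.Basis.constr_basis, if_neg]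
    rw [mk_eq_one_iff, not_isEmpty_iff]
    infer_instance
  · rw [graphOrZero_of_not_isMotic h, map_zero]

theorem counit_one : counit T 1 = 1 := by
  have h1 : MonoidAlgebra.basis (MoticClass T) ℚ 1 = (1 : M T) :=
    MonoidAlgebra.basis_apply _ _
  rw [← h1, counit, Module.Basis.constr_basis, if_pos rfl]

instance (Γ : FeynmanGraph T) : IsEmpty (Γ.sub ∅).E := Set.isEmpty_coe_sort.2 rfl

instance (Γ : FeynmanGraph T) : IsEmpty (Γ.contract Set.univ).E := ⟨fun e => e.2 trivial⟩

theorem counit_of_isEmpty (Γ : FeynmanGraph T) [IsEmpty Γ.E] :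
    counit T (graphOrZero Γ) = 1 := by
  rw [graphOrZero_of_isEmpty, counit_one]

/-- Only the empty subgraph has a nonzero counit, and its contraction changes nothing. -/
theorem counit_rTensor : (counit T).rTensor (M T) ∘ₗ coproduct T =
    TensorProduct.mk ℚ ℚ (M T) 1 := by
  refine linearMap_ext fun Γ => ?_
  rw [LinearMap.comp_apply, coproduct_graphOrZero, map_sum, Finset.sum_eq_single ∅]
  · rw [LinearMap.rTensor_tmul, counit_of_isEmpty, graphOrZero_eq (Iso.contractEmpty Γ)]
    rfl
  · intro A _ hA
    have : Nonempty (Γ.sub A).E := (Set.nonempty_iff_ne_empty.2 hA).to_subtype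
    rw [LinearMap.rTensor_tmul, counit_of_nonempty, TensorProduct.zero_tmul]
  · exact fun h => absurd (Finset.mem_univ _) h

theorem counit_lTensor : (counit T).lTensor (M T) ∘ₗ coproduct T =
    (TensorProduct.mk ℚ (M T) ℚ).flip 1 := by
  refine linearMap_ext fun Γ => ?_
  rw [LinearMap.comp_apply, coproduct_graphOrZero, map_sum, Finset.sum_eq_single Set.univ]
  · rw [LinearMap.lTensor_tmul, counit_of_isEmpty, graphOrZero_eq (Iso.subUniv Γ)]
    rfl
  · intro A _ hA
    obtain ⟨e, he⟩ := (Set.ne_univ_iff_exists_notMem A).1 hA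
    have : Nonempty (Γ.contract A).E := ⟨⟨e, he⟩⟩
    rw [LinearMap.lTensor_tmul, counit_of_nonempty, TensorProduct.tmul_zero]
  · exact fun h => absurd (Finset.mem_univ _) h

theorem coproduct_one : coproduct T 1 = 1 := by
  rw [← graphOrZero_of_isEmpty (empty T), coproduct_graphOrZero, Fintype.sum_eq_single ∅]
  · have : IsEmpty ((empty T).contract ∅).E := ⟨fun e => isEmptyElim (α := Empty) e.1⟩
    rw [graphOrZero_of_isEmpty, graphOrZero_of_isEmpty]
    rfl
  · intro A hA
    exact absurd (Set.eq_empty_of_isEmpty A) hA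

/-- An edge set of a disjoint union is a pair of edge sets, and restriction and contraction act on
each factor separately. -/
theorem coproduct_mul (a b : M T) : coproduct T (a * b) = coproduct T a * coproduct T b := by
  refine map_mul_of_graphOrZero _ (fun Γ Γ' => ?_) a b
  rw [coproduct_graphOrZero, coproduct_graphOrZero, coproduct_graphOrZero, Finset.sum_mul_sum,
    ← sum_set_sum]
  refine Finset.sum_congr rfl fun A _ => ?_
  rw [graphOrZero_eq (Iso.sumSub A), graphOrZero_eq (Iso.sumContract A), graphOrZero_sum,
    graphOrZero_sum, Algebra.TensorProduct.tmul_mul_tmul]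

theorem counit_mul (a b : M T) : counit T (a * b) = counit T a * counit T b := by
  refine map_mul_of_graphOrZero _ (fun Γ Γ' => ?_) a b
  rcases isEmpty_or_nonempty Γ.E with h | ⟨⟨e⟩⟩
  · rw [graphOrZero_sum, graphOrZero_of_isEmpty Γ, one_mul, counit_one, one_mul]
  · have : Nonempty Γ.E := ⟨e⟩
    have : Nonempty (Γ.sum Γ').E := ⟨.inl e⟩
    rw [counit_of_nonempty, counit_of_nonempty Γ, zero_mul]

/-- The number of edges of an isomorphism class of motic graphs. -/
noncomputable def MoticClass.edgeCount : MoticClass T → ℕ :=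
  Quotient.lift (fun Γ => Nat.card Γ.1.E) fun _ _ ⟨i⟩ => Nat.card_congr i.φ

theorem graphOrZero_mem_degreeLT {Γ : FeynmanGraph T} {n : ℕ} (h : Nat.card Γ.E < n) :
    graphOrZero Γ ∈ degreeLT (MonoidAlgebra.basis (MoticClass T) ℚ) MoticClass.edgeCount n := by
  by_cases hΓ : Γ.IsMotic
  · exact Submodule.subset_span ⟨MoticClass.mk Γ hΓ, h, basis_mk Γ hΓ⟩
  · rw [graphOrZero_of_not_isMotic hΓ]
    exact zero_mem _

theorem exists_isHopf (T : PowerCounting) :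
    ∃ S : M T →ₗ[ℚ] M T, IsHopf (coproduct T) (counit T) S := by
  obtain ⟨S, h1, h2⟩ := exists_antipode coproduct_coassoc counit_rTensor counit_lTensor counit_one
    (MonoidAlgebra.basis (MoticClass T) ℚ) MoticClass.edgeCount fun x => by
      induction x using Quotient.inductionOn with | _ x => ?_
      obtain ⟨Γ, h⟩ := x
      have hb := basis_mk Γ h
      change coproduct T (MonoidAlgebra.basis (MoticClass T) ℚ (MoticClass.mk Γ h)) ∈ _
      rw [hb, coproduct_graphOrZero]
      refine Submodule.sum_mem _ fun A _ => Submodule.subset_span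
        ⟨_, graphOrZero_mem_degreeLT ?_, _, graphOrZero_mem_degreeLT ?_, ?_, rfl⟩
      · exact Nat.lt_succ_of_le (Finite.card_subtype_le (· ∈ A))
      · exact Nat.lt_succ_of_le (Finite.card_subtype_le (· ∉ A))
      -- Either `A` is empty and the left factor is `1`, or the contracted graph has lost an edge.
      · rcases Set.eq_empty_or_nonempty A with rfl | ⟨e, he⟩
        · exact .inl (graphOrZero_of_isEmpty _)
        · exact .inr (graphOrZero_mem_degreeLT (Finite.card_subtype_lt (x := e) (not_not.2 he)))
  exact ⟨S, coproduct_coassoc, counit_rTensor, counit_lTensor, coproduct_one, coproduct_mul,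
    counit_one, counit_mul, h1, h2⟩

end Motic

/-! ### Hopf ideals from properties of graphs -/

namespace Motic

open FeynmanGraph

variable {T : PowerCounting}

/-- A property of graphs whose complement spans a Hopf ideal. -/
structure IsHopfProperty (P : FeynmanGraph T → Prop) : Prop where
  of_iso : ∀ {Γ Γ' : FeynmanGraph T}, Iso Γ Γ' → P Γ → P Γ'
  empty : P (FeynmanGraph.empty T)
  sum_iff : ∀ Γ Γ' : FeynmanGraph T, P (Γ.sum Γ') ↔ P Γ ∧ P Γ'
  of_sub_of_contract : ∀ (Γ : FeynmanGraph T) (A : Set Γ.E), P (Γ.sub A) → P (Γ.contract A) → P Γ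

variable {P : FeynmanGraph T → Prop}

namespace IsHopfProperty

theorem mk_mem_classes (hP : IsHopfProperty P) {Γ : FeynmanGraph T} (h : Γ.IsMotic) :
    MoticClass.mk Γ h ∈ classes P ↔ P Γ := by
  constructor
  · rintro ⟨Γ', h', hΓ', hPΓ'⟩
    obtain ⟨i⟩ : Nonempty (Iso Γ' Γ) := Quotient.exact hΓ'
    exact hP.of_iso i hPΓ'
  · exact fun hPΓ => ⟨Γ, h, rfl, hPΓ⟩

theorem rho_of (hP : IsHopfProperty P) {Γ : FeynmanGraph T} (hΓ : P Γ) :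
    (rho P (graphOrZero Γ) : M T) = graphOrZero Γ := by
  by_cases h : Γ.IsMotic
  · rw [← basis_mk Γ h, rho, Module.Basis.constr_basis, dif_pos ((hP.mk_mem_classes h).2 hΓ),
      MonoidAlgebra.basis_apply]
  · rw [graphOrZero_of_not_isMotic h, map_zero]
    rfl

theorem rho_of_not (hP : IsHopfProperty P) {Γ : FeynmanGraph T} (hΓ : ¬ P Γ) :
    rho P (graphOrZero Γ) = 0 := by
  by_cases h : Γ.IsMotic
  · rw [← basis_mk Γ h, rho, Module.Basis.constr_basis,
      dif_neg fun h' => hΓ ((hP.mk_mem_classes h).1 h')]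
  · rw [graphOrZero_of_not_isMotic h, map_zero]

/-- The graphs with `P` are closed under products and contain `1`, so their span is already an
algebra. -/
theorem toSubmodule_H (hP : IsHopfProperty P) :
    Subalgebra.toSubmodule (H P) = Submodule.span ℚ (graphs P) := by
  let N : Submonoid (M T) :=
    { carrier := graphs P
      one_mem' := ⟨_, isMotic_empty, rfl, hP.empty⟩
      mul_mem' := by
        rintro _ _ ⟨Γ, h, rfl, hΓ⟩ ⟨Γ', h', rfl, hΓ'⟩
        refine ⟨Γ.sum Γ', h.sum h', ?_, (hP.sum_iff Γ Γ').2 ⟨hΓ, hΓ'⟩⟩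
        rw [← graphOrZero_of_isMotic, graphOrZero_sum, graphOrZero_of_isMotic h,
          graphOrZero_of_isMotic h'] }
  have hN : (Submonoid.closure (graphs P) : Set (M T)) = graphs P :=
    congrArg SetLike.coe (Submonoid.closure_eq N)
  rw [H, Algebra.adjoin_eq_span, hN]

/-- `rho P` fixes the graphs that span `H P`. So the inclusion of `H P` is the section needed for
the transport of structure. -/
theorem rho_val (hP : IsHopfProperty P) (b : H P) : rho P (b : M T) = b := by
  have key : ∀ a ∈ Submodule.span ℚ (graphs P), (rho P a : M T) = a := by
    intro a ha
    refine LinearMap.eqOn_span (R := ℚ) (f := (H P).val.toLinearMap ∘ₗ rho P)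
      (g := LinearMap.id) ?_ ha
    rintro _ ⟨Γ, h, rfl, hΓ⟩
    have := hP.rho_of hΓ
    rwa [graphOrZero_of_isMotic h] at this
  exact Subtype.ext (key b (hP.toSubmodule_H ▸ b.2))

/-- Such an `f` factors through `rho P`, since it agrees with its composition with the projection on
every graph. This reduces statements on the kernel to single graphs without `P`. -/
theorem eq_zero_of_rho_eq_zero (hP : IsHopfProperty P) {N : Type*} [AddCommMonoid N] [Module ℚ N]
    (f : M T →ₗ[ℚ] N) (hf : ∀ Γ : FeynmanGraph T, ¬ P Γ → f (graphOrZero Γ) = 0) {a : M T}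
    (ha : rho P a = 0) : f a = 0 := by
  have : f = f ∘ₗ (H P).val.toLinearMap ∘ₗ rho P := by
    refine linearMap_ext fun Γ => ?_
    by_cases hΓ : P Γ
    · exact congrArg f (hP.rho_of hΓ).symm
    · rw [hf Γ hΓ, LinearMap.comp_apply, LinearMap.comp_apply, hP.rho_of_not hΓ, map_zero, map_zero]
  rw [this, LinearMap.comp_apply, LinearMap.comp_apply, ha, map_zero, map_zero]

theorem rho_one (hP : IsHopfProperty P) : rho P 1 = 1 := by
  refine Subtype.ext ?_
  rw [← graphOrZero_of_isEmpty (FeynmanGraph.empty T), hP.rho_of hP.empty, graphOrZero_of_isEmpty]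
  rfl

theorem rho_mul (hP : IsHopfProperty P) (a b : M T) : rho P (a * b) = rho P a * rho P b := by
  refine map_mul_of_graphOrZero _ (fun Γ Γ' => ?_) a b
  by_cases h : P Γ
  · by_cases h' : P Γ'
    · refine Subtype.ext ?_
      rw [hP.rho_of ((hP.sum_iff Γ Γ').2 ⟨h, h'⟩), graphOrZero_sum]
      exact congrArg₂ (· * ·) (hP.rho_of h).symm (hP.rho_of h').symm
    · rw [hP.rho_of_not h', hP.rho_of_not fun hs => h' ((hP.sum_iff Γ Γ').1 hs).2, mul_zero]
  · rw [hP.rho_of_not h, hP.rho_of_not fun hs => h ((hP.sum_iff Γ Γ').1 hs).1, zero_mul]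

/-- If both factors of a term had `P`, then so would `Γ`. Hence the projection kills a factor of
every term. -/
theorem map_rho_coproduct (hP : IsHopfProperty P) {Γ : FeynmanGraph T} (hΓ : ¬ P Γ) :
    TensorProduct.map (rho P) (rho P) (coproduct T (graphOrZero Γ)) = 0 := by
  rw [coproduct_graphOrZero, map_sum]
  refine Finset.sum_eq_zero fun A _ => ?_
  rw [TensorProduct.map_tmul]
  by_cases h1 : P (Γ.sub A)
  · rw [hP.rho_of_not fun h2 => hΓ (hP.of_sub_of_contract Γ A h1 h2), TensorProduct.tmul_zero]
  · rw [hP.rho_of_not h1, TensorProduct.zero_tmul]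

theorem nonempty_of_not (hP : IsHopfProperty P) {Γ : FeynmanGraph T} (hΓ : ¬ P Γ) :
    Nonempty Γ.E := by
  by_contra h
  rw [not_nonempty_iff] at h
  exact hΓ (hP.of_iso (Iso.ofIsEmpty Γ).symm hP.empty)

/-- Induction on the number of edges in the antipode identity. The term of the full subgraph is the
antipode of `Γ`. In any other term either `Γ/γ` lacks `P`, or `γ` lacks `P` and has fewer edges than
`Γ`. -/
theorem rho_antipode (hP : IsHopfProperty P) {S : M T →ₗ[ℚ] M T}
    (h : IsHopf (coproduct T) (counit T) S) {Γ : FeynmanGraph T} (hΓ : ¬ P Γ) :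
    rho P (S (graphOrZero Γ)) = 0 := by
  induction hn : Nat.card Γ.E using Nat.strong_induction_on generalizing Γ with | _ n ih => ?_
  have := hP.nonempty_of_not hΓ
  have h1 := congrArg (rho P) (LinearMap.congr_fun h.antipode_left (graphOrZero Γ))
  simp only [LinearMap.comp_apply] at h1
  rw [counit_of_nonempty Γ, map_zero, map_zero, coproduct_graphOrZero, map_sum, map_sum, map_sum,
    Finset.sum_eq_single Set.univ] at h1
  · rwa [LinearMap.rTensor_tmul, LinearMap.mul'_apply, hP.rho_mul,
      graphOrZero_of_isEmpty (Γ.contract Set.univ), hP.rho_one, mul_one,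
      graphOrZero_eq (Iso.subUniv Γ)] at h1
  · intro A _ hA
    rw [LinearMap.rTensor_tmul, LinearMap.mul'_apply, hP.rho_mul]
    by_cases hc : P (Γ.contract A)
    · have hs : ¬ P (Γ.sub A) := fun hs => hΓ (hP.of_sub_of_contract Γ A hs hc)
      obtain ⟨e, he⟩ := (Set.ne_univ_iff_exists_notMem A).1 hA
      have hlt : Nat.card (Γ.sub A).E < Nat.card Γ.E := Finite.card_subtype_lt (x := e) he
      rw [ih _ (hn ▸ hlt) hs rfl, zero_mul]
    · rw [hP.rho_of_not hc, mul_zero]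
  · exact fun h => absurd (Finset.mem_univ _) h

theorem exists_isHopf (hP : IsHopfProperty P) {S : M T →ₗ[ℚ] M T}
    (h : IsHopf (coproduct T) (counit T) S) :
    ∃ (Δ' : H P →ₗ[ℚ] H P ⊗[ℚ] H P) (ε' : H P →ₗ[ℚ] ℚ) (S' : H P →ₗ[ℚ] H P)
      (h' : IsHopf Δ' ε' S'), KernelIsHopfIdeal h h' (rho P) ∧
        IsLeftCoaction Δ' ε' ((rho P).rTensor (M T) ∘ₗ coproduct T) ∧
        IsRightCoaction Δ' ε' ((rho P).lTensor (M T) ∘ₗ coproduct T) :=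
  exists_isHopf_of_projection h (rho P) (H P).val.toLinearMap hP.rho_val hP.rho_one hP.rho_mul
    (fun _ => hP.eq_zero_of_rho_eq_zero (TensorProduct.map (rho P) (rho P) ∘ₗ coproduct T)
      fun _ => hP.map_rho_coproduct)
    (fun _ => hP.eq_zero_of_rho_eq_zero (counit T) fun Γ hΓ =>
      have := hP.nonempty_of_not hΓ
      counit_of_nonempty Γ)
    (fun _ => hP.eq_zero_of_rho_eq_zero (rho P ∘ₗ S) fun _ => hP.rho_antipode h)

theorem rTensor_coproduct (hP : IsHopfProperty P) {Γ : FeynmanGraph T} (hΓ : Γ.IsMotic) :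
    (H P).val.toLinearMap.rTensor (M T)
        (((rho P).rTensor (M T) ∘ₗ coproduct T) (graph Γ hΓ)) =
      ∑ᶠ A : {A : Set Γ.E // (Γ.sub A).IsMotic ∧ P (Γ.sub A)}, term Γ hΓ A.1 A.2.1 := by
  rw [← graphOrZero_of_isMotic hΓ, LinearMap.comp_apply, coproduct_graphOrZero, map_sum, map_sum]
  refine (finsum_subtype_eq_sum (fun A => ?_) fun A hA => ?_).symm
  · rw [LinearMap.rTensor_tmul, LinearMap.rTensor_tmul]
    refine Eq.trans ?_ (congrArg (· ⊗ₜ[ℚ] graphOrZero (Γ.contract A.1)) (hP.rho_of A.2.2).symm)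
    rw [graphOrZero_of_isMotic A.2.1, graphOrZero_of_isMotic (hΓ.contract A.1)]
    rfl
  · rw [LinearMap.rTensor_tmul]
    by_cases h : P (Γ.sub A)
    · rw [graphOrZero_of_not_isMotic fun h' => hA ⟨h', h⟩, map_zero, TensorProduct.zero_tmul,
        map_zero]
    · rw [hP.rho_of_not h, TensorProduct.zero_tmul, map_zero]

theorem lTensor_coproduct (hP : IsHopfProperty P) {Γ : FeynmanGraph T} (hΓ : Γ.IsMotic)
    {p : Set Γ.E → Prop} (hp : ∀ A, p A ↔ P (Γ.contract A)) :
    (H P).val.toLinearMap.lTensor (M T)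
        (((rho P).lTensor (M T) ∘ₗ coproduct T) (graph Γ hΓ)) =
      ∑ᶠ A : {A : Set Γ.E // (Γ.sub A).IsMotic ∧ p A}, term Γ hΓ A.1 A.2.1 := by
  rw [← graphOrZero_of_isMotic hΓ, LinearMap.comp_apply, coproduct_graphOrZero, map_sum, map_sum]
  refine (finsum_subtype_eq_sum (fun A => ?_) fun A hA => ?_).symm
  · rw [LinearMap.lTensor_tmul, LinearMap.lTensor_tmul]
    refine Eq.trans ?_ (congrArg (graphOrZero (Γ.sub A.1) ⊗ₜ[ℚ] ·)
      (hP.rho_of ((hp A.1).1 A.2.2)).symm)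
    rw [graphOrZero_of_isMotic A.2.1, graphOrZero_of_isMotic (hΓ.contract A.1)]
    rfl
  · rw [LinearMap.lTensor_tmul]
    by_cases h : P (Γ.contract A)
    · rw [graphOrZero_of_not_isMotic fun h' => hA ⟨h', (hp A).2 h⟩, TensorProduct.zero_tmul,
        map_zero]
    · rw [hP.rho_of_not h, TensorProduct.tmul_zero, map_zero]

end IsHopfProperty

end Motic

/-! ### Blocks, and the degree of divergence under contraction -/

namespace Motic

section Incidence

variable {V E V' E' : Type} {ends : E → Sym2 V} {ends' : E' → Sym2 V'}

theorem verts_image {A : Set E} {f : V → V'} {φ : E → E'}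
    (h : ∀ e ∈ A, ends' (φ e) = (ends e).map f) :
    verts ends' (φ '' A) = f '' verts ends A := by
  ext v
  constructor
  · rintro ⟨_, ⟨e, he, rfl⟩, hv⟩
    rw [h e he] at hv
    obtain ⟨u, hu, rfl⟩ := Sym2.mem_map.1 hv
    exact ⟨u, ⟨e, he, hu⟩, rfl⟩
  · rintro ⟨u, ⟨e, he, hu⟩, rfl⟩
    exact ⟨_, ⟨e, he, rfl⟩, (h e he).symm ▸ Sym2.mem_map.2 ⟨u, hu, rfl⟩⟩

theorem conn_image {A : Set E} {f : V → V'} {φ : E → E'}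
    (h : ∀ e ∈ A, ends' (φ e) = (ends e).map f) {u v : V} (huv : conn ends A u v) :
    conn ends' (φ '' A) (f u) (f v) :=
  conn_map (ends' := ends') (B := φ '' A) f (fun e he => ⟨φ e, ⟨e, he, rfl⟩, fun u hu =>
    (h e he).symm ▸ Sym2.mem_map.2 ⟨u, hu, rfl⟩⟩) huv

/-- A left inverse of `f` on the vertices of `A` carries paths back; injectivity elsewhere is not
needed. -/
theorem conn_of_conn_image [Nonempty V] {A : Set E} {f : V → V'} {φ : E → E'}
    (hf : Set.InjOn f (verts ends A)) (h : ∀ e ∈ A, ends' (φ e) = (ends e).map f) {u v : V}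
    (hu : u ∈ verts ends A) (hv : v ∈ verts ends A) (huv : conn ends' (φ '' A) (f u) (f v)) :
    conn ends A u v := by
  have hg := hf.leftInvOn_invFunOn
  have : conn ends A (Function.invFunOn f (verts ends A) (f u))
      (Function.invFunOn f (verts ends A) (f v)) := by
    refine conn_map _ ?_ huv
    rintro _ ⟨e, he, rfl⟩
    refine ⟨e, he, fun x hx => ?_⟩
    rw [h e he] at hx
    obtain ⟨w, hw, rfl⟩ := Sym2.mem_map.1 hx
    rwa [hg ⟨e, he, hw⟩]
  rwa [hg hu, hg hv] at this

theorem loops_image [Nonempty V] {A : Set E} {f : V → V'} {φ : E → E'} (hφ : φ.Injective)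
    (hf : Set.InjOn f (verts ends A)) (h : ∀ e ∈ A, ends' (φ e) = (ends e).map f) :
    loops ends' (φ '' A) = loops ends A := by
  have hc : comps ends' (φ '' A) =
      Quotient.map' f (fun _ _ huv => conn_image h huv) '' comps ends A := by
    unfold comps
    rw [verts_image h, ← Set.image_comp, ← Set.image_comp]
    rfl
  unfold loops
  rw [Set.ncard_image_of_injective _ hφ, hc, verts_image h, hf.ncard_image,
    Set.InjOn.ncard_image]
  rintro _ ⟨u, hu, rfl⟩ _ ⟨v, hv, rfl⟩ huv
  exact Quotient.sound (conn_of_conn_image hf h hu hv (Quotient.exact huv))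

theorem eqvGen_lift {α β : Type} {r : α → α → Prop} {s : β → β → Prop} (f : α → β)
    (h : ∀ a b, r a b → Relation.EqvGen s (f a) (f b)) {a b : α} (hab : Relation.EqvGen r a b) :
    Relation.EqvGen s (f a) (f b) := by
  induction hab with
  | rel x y hxy => exact h x y hxy
  | refl x => exact .refl _
  | symm x y _ ih => exact .symm _ _ ih
  | trans x y z _ _ ih1 ih2 => exact .trans _ _ _ ih1 ih2

/-- Two edges are joined by a sequence of edges that are adjacent at vertices other than `v`. -/
def chain (ends : E → Sym2 V) (v : V) : E → E → Prop :=
  Relation.EqvGen fun a b => ∃ u, u ≠ v ∧ u ∈ ends a ∧ u ∈ ends b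

theorem chain_of_mem {v u : V} {e f : E} (h : u ≠ v) (he : u ∈ ends e) (hf : u ∈ ends f) :
    chain ends v e f := .rel _ _ ⟨u, h, he, hf⟩

/-- A path in `A` from `x` to `y` stays in the class of `x`, which does not contain `v`, so its
consecutive edges meet away from `v`. -/
theorem chain_of_conn {A : Set E} {x y v : V} (hxy : conn ends A x y) (hv : ¬ conn ends A x v)
    {e f : E} (he : x ∈ ends e) (hf : y ∈ ends f) : chain ends v e f := by
  change Relation.EqvGen _ _ _ at hxy
  induction hxy generalizing e f with
  | rel x y hxy =>
    obtain ⟨a, ha, hx, hy⟩ := hxy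
    refine .trans _ a _ (chain_of_mem (fun h => hv (h ▸ conn_refl _)) he hx)
      (chain_of_mem (fun h => hv (h ▸ conn_of_mem_ends ha hx hy)) hy hf)
  | refl x => exact chain_of_mem (fun h => hv (h ▸ conn_refl _)) he hf
  | symm x y hxy ih => exact .symm _ _ (ih (fun h => hv (conn_trans (conn_symm hxy) h)) hf he)
  | trans x y z hxy hyz ih1 ih2 =>
    have hv' : ¬ conn ends A y v := fun h => hv (conn_trans hxy h)
    -- Unless `x = y`, the middle vertex `y` has an edge `a` of `A`, through which the two chains
    -- are joined.
    rcases eq_or_verts_of_conn hxy with rfl | ⟨_, a, _, hy⟩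
    · exact ih2 hv' he hf
    · exact .trans _ a _ (ih1 hv he hy) (ih2 hv' hy hf)

end Incidence

namespace FeynmanGraph

variable {T : PowerCounting} (Γ : FeynmanGraph T)

section Blocks

variable {Γ}

theorem mem_blockOf_self (e : Γ.E) : e ∈ Γ.blockOf e := fun _ => .refl _

theorem mem_blockOf_symm {e f : Γ.E} (h : f ∈ Γ.blockOf e) : e ∈ Γ.blockOf f :=
  fun v => .symm _ _ (h v)

theorem mem_blockOf_trans {e f g : Γ.E} (h : f ∈ Γ.blockOf e) (h' : g ∈ Γ.blockOf f) :
    g ∈ Γ.blockOf e := fun v => .trans _ _ _ (h v) (h' v)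

theorem mem_compOf_self (e : Γ.E) : e ∈ Γ.compOf e := by
  obtain ⟨a, b, h⟩ := ends_eq Γ.ends e
  have ha : a ∈ Γ.ends e := h ▸ Sym2.mem_mk_left a b
  exact ⟨a, ha, a, ha, conn_refl _⟩

theorem mem_compOf_symm {e f : Γ.E} (h : f ∈ Γ.compOf e) : e ∈ Γ.compOf f := by
  obtain ⟨u, hu, v, hv, huv⟩ := h
  exact ⟨v, hv, u, hu, conn_symm huv⟩

theorem mem_compOf_trans {e f g : Γ.E} (h : f ∈ Γ.compOf e) (h' : g ∈ Γ.compOf f) :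
    g ∈ Γ.compOf e := by
  obtain ⟨u, hu, v, hv, huv⟩ := h
  obtain ⟨x, hx, y, hy, hxy⟩ := h'
  exact ⟨u, hu, y, hy, conn_trans huv (conn_trans (conn_of_mem_ends (Set.mem_univ f) hv hx) hxy)⟩

theorem blockOf_subset_compOf (e : Γ.E) : Γ.blockOf e ⊆ Γ.compOf e := by
  -- Avoidance of a single vertex is enough here, and any one will do.
  have key : ∀ x y, chain Γ.ends (Classical.arbitrary Γ.V) x y → y ∈ Γ.compOf x := by
    intro x y h
    change Relation.EqvGen _ _ _ at h
    induction h with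
    | rel x y h =>
      obtain ⟨u, _, hx, hy⟩ := h
      exact ⟨u, hx, u, hy, conn_refl _⟩
    | refl x => exact mem_compOf_self x
    | symm x y _ ih => exact mem_compOf_symm ih
    | trans x y z _ _ ih1 ih2 => exact mem_compOf_trans ih1 ih2
  exact fun f hf => key e f (hf _)

/-- The end points of an edge that are connected in `C` are connected within the block of the
edge. -/
theorem conn_inter_blockOf {C : Set Γ.E} {e : Γ.E} {a b : Γ.V} (ha : a ∈ Γ.ends e)
    (hb : b ∈ Γ.ends e) (h : conn Γ.ends C a b) : conn Γ.ends (C ∩ Γ.blockOf e) a b := by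
  -- A minimal connecting set `X` is a path that closes up with `e`. Without `f` it leaves a piece
  -- at `a` and a piece at `b`, not connected to each other. The vertex `v` is on at most one of
  -- them, and along the other piece `f` is chained to `e` while avoiding `v`.
  obtain ⟨X, hXC, hX⟩ := exists_minimal_le_of_wellFoundedLT (fun X => conn Γ.ends X a b) C h
  refine conn_mono (A := X) (B := C ∩ Γ.blockOf e) (fun f hf => ⟨hXC hf, fun v => ?_⟩) hX.prop
  have hf' : ¬ conn Γ.ends (X \ {f}) a b := fun hc =>
    (hX.le_of_le hc Set.sdiff_subset hf).2 rfl
  obtain ⟨p, hp, q, hq, hap, hqb⟩ := (conn_diff_or f hX.prop).resolve_left hf'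
  by_cases hav : conn Γ.ends (X \ {f}) a v
  · exact chain_of_conn (conn_symm hqb) (fun hbv => hf' (conn_trans hav (conn_symm hbv))) hb hq
  · exact chain_of_conn hap hav ha hp

/-- Add the edges of `X` one by one. A new edge closes a loop exactly if its ends are already
connected, and by `conn_inter_blockOf` this is decided within its block, which lies either inside or
outside `A`. -/
theorem loops_eq_add {A : Set Γ.E} (hA : ∀ e ∈ A, Γ.blockOf e ⊆ A) (X : Set Γ.E) :
    loops Γ.ends X = loops Γ.ends (X ∩ A) + loops Γ.ends (X \ A) := by
  classical
  induction X, Set.toFinite X using Set.Finite.induction_on with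
  | empty => simp [loops_empty]
  | @insert e C heC _ ih =>
    obtain ⟨a, b, hab⟩ := ends_eq Γ.ends e
    have ha : a ∈ Γ.ends e := hab ▸ Sym2.mem_mk_left a b
    have hb : b ∈ Γ.ends e := hab ▸ Sym2.mem_mk_right a b
    by_cases he : e ∈ A
    · have hc : conn Γ.ends (C ∩ A) a b ↔ conn Γ.ends C a b :=
        ⟨conn_mono Set.inter_subset_left, fun h =>
          conn_mono (Set.inter_subset_inter_right C (hA e he)) (conn_inter_blockOf ha hb h)⟩
      rw [Set.insert_inter_of_mem he, Set.insert_sdiff_of_mem C he, loops_insert heC hab,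
        loops_insert (fun h => heC h.1) hab, ih]
      simp only [hc]
      ring
    · have hc : conn Γ.ends (C \ A) a b ↔ conn Γ.ends C a b :=
        ⟨conn_mono Set.sdiff_subset, fun h =>
          conn_mono (A := C ∩ Γ.blockOf e) (B := C \ A) (fun f hf => ⟨hf.1, fun hfA => he (hA f hfA (mem_blockOf_symm hf.2))⟩)
            (conn_inter_blockOf ha hb h)⟩
      rw [Set.insert_inter_of_notMem he, Set.insert_sdiff_of_notMem C he, loops_insert heC hab,
        loops_insert (fun h => heC h.1) hab, ih]
      simp only [hc]
      ring

end Blocks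

section Omega

variable {Γ}

theorem omega_image {Γ' : FeynmanGraph T} {A : Set Γ.E} (f : Γ.V → Γ'.V) (φ : Γ.E → Γ'.E)
    (hφ : φ.Injective) (hf : Set.InjOn f (verts Γ.ends A))
    (h : ∀ e ∈ A, Γ'.ends (φ e) = (Γ.ends e).map f)
    (hv : ∀ u ∈ verts Γ.ends A, Γ'.vtype (f u) = Γ.vtype u)
    (he : ∀ e ∈ A, Γ'.etype (φ e) = Γ.etype e) :
    Γ'.omega (φ '' A) = Γ.omega A := by
  unfold omega
  rw [Motic.loops_image hφ hf h, Motic.verts_image h, finsum_mem_image hf,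
    finsum_mem_image hφ.injOn,
    finsum_mem_congr rfl fun u hu => congrArg T.vweight (hv u hu),
    finsum_mem_congr rfl fun e hA => congrArg T.eweight (he e hA)]

theorem Iso.omega_image {Γ' : FeynmanGraph T} (i : Iso Γ Γ') (A : Set Γ.E) :
    Γ'.omega (i.φ '' A) = Γ.omega A := by
  refine FeynmanGraph.omega_image i.f i.φ i.φ.injective (fun u hu v hv h => ?_)
    (fun e _ => i.ends e) (fun u ⟨e, _, hu⟩ => i.vtype e u hu) (fun e _ => i.etype e)
  rw [← i.gf_verts hu, h, i.gf_verts hv]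

theorem omega_sum_inl (Γ' : FeynmanGraph T) (A : Set Γ.E) :
    (Γ.sum Γ').omega (show Set (Γ.E ⊕ Γ'.E) from Sum.inl '' A) = Γ.omega A :=
  omega_image (Γ' := Γ.sum Γ') Sum.inl Sum.inl Sum.inl_injective Sum.inl_injective.injOn
    (fun _ _ => rfl) (fun _ _ => rfl) (fun _ _ => rfl)

theorem omega_inSub {A B : Set Γ.E} (h : B ⊆ A) : (Γ.sub A).omega (Γ.inSub A B) = Γ.omega B := by
  have := omega_image (Γ := Γ.sub A) (Γ' := Γ) (A := Γ.inSub A B) id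
    (show A → Γ.E from Subtype.val) Subtype.val_injective Function.injective_id.injOn
    (fun _ _ => (congrFun Sym2.map_id _).symm) (fun _ _ => rfl) (fun _ _ => rfl)
  exact this.symm.trans (congrArg Γ.omega (image_inSub h))

theorem verts_inContract {A B : Set Γ.E} (h : Disjoint A B) :
    verts (Γ.contract A).ends (Γ.inContract A B) =
      Quotient.mk (conn Γ.ends A) '' verts Γ.ends B := by
  ext x
  constructor
  · rintro ⟨e, he, hx⟩
    obtain ⟨u, hu, rfl⟩ := Sym2.mem_map.1 hx
    exact ⟨u, ⟨_, he, hu⟩, rfl⟩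
  · rintro ⟨u, ⟨e, he, hu⟩, rfl⟩
    exact ⟨(⟨e, Set.disjoint_right.1 h he⟩ : {e // e ∉ A}), he, Sym2.mem_map.2 ⟨u, hu, rfl⟩⟩

/-- Vertices of `B` that lie on `A` become points of weight 0, and on the other vertices the
contraction is injective and keeps the type. -/
theorem sum_vweight_contract {A B : Set Γ.E} (h : Disjoint A B) :
    ∑ᶠ x ∈ verts (Γ.contract A).ends (Γ.inContract A B), T.vweight ((Γ.contract A).vtype x) =
      ∑ᶠ u ∈ verts Γ.ends B \ verts Γ.ends A, T.vweight (Γ.vtype u) := by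
  classical
  have hinj : ∀ u ∉ verts Γ.ends A, ∀ v, Quotient.mk (conn Γ.ends A) u = Quotient.mk _ v → u = v :=
    fun u hu v huv => (eq_or_verts_of_conn (Quotient.exact huv)).resolve_right fun h => hu h.1
  let q : Γ.V → (Γ.contract A).V := Quotient.mk (conn Γ.ends A)
  have hK : verts (Γ.contract A).ends (Γ.inContract A B) =
      q '' (verts Γ.ends B ∩ verts Γ.ends A) ∪ q '' (verts Γ.ends B \ verts Γ.ends A) :=
    (verts_inContract h).trans
      (show q '' _ = _ by rw [← Set.image_union, Set.inter_union_sdiff])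
  have hd : Disjoint (q '' (verts Γ.ends B ∩ verts Γ.ends A))
      (q '' (verts Γ.ends B \ verts Γ.ends A)) := by
    rw [Set.disjoint_left]
    rintro _ ⟨u, ⟨_, hu⟩, rfl⟩ ⟨v, ⟨_, hv⟩, huv⟩
    exact hv (hinj v hv u huv ▸ hu)
  rw [hK, finsum_mem_union hd (Set.toFinite _) (Set.toFinite _)]
  have h0 : ∑ᶠ x ∈ q '' (verts Γ.ends B ∩ verts Γ.ends A),
      T.vweight ((Γ.contract A).vtype x) = 0 := by
    refine finsum_mem_eq_zero_of_forall_eq_zero ?_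
    rintro _ ⟨u, ⟨_, hu⟩, rfl⟩
    exact (congrArg T.vweight ((Γ.contract_vtype_mk A u).trans (if_pos hu))).trans T.vweight_point
  rw [h0, zero_add]
  refine (finsum_mem_eq_of_bijOn q
    ⟨Set.mapsTo_image _ _, fun u hu v _ => hinj u hu.2 v, Set.surjOn_image _ _⟩ ?_).symm
  rintro u ⟨_, hu⟩
  exact congrArg T.vweight ((Γ.contract_vtype_mk A u).trans (if_neg hu)).symm

/-- Loops are additive under contraction, the edge sets are disjoint, and the vertices of `A ∪ B`
outside `A` are those that keep their weights. -/
theorem omega_contract {A B : Set Γ.E} (h : Disjoint A B) :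
    (Γ.contract A).omega (Γ.inContract A B) = Γ.omega (A ∪ B) - Γ.omega A := by
  have h1 : loops (Γ.contract A).ends (Γ.inContract A B) =
      loops Γ.ends (A ∪ B) - loops Γ.ends A := by
    have := Γ.loops_contract A (Γ.inContract A B)
    rwa [union_image_inContract] at this
  have h2 : ∑ᶠ e ∈ Γ.inContract A B, T.eweight ((Γ.contract A).etype e) =
      ∑ᶠ e ∈ B, T.eweight (Γ.etype e) :=
    finsum_mem_eq_of_bijOn (fun e : {e // e ∉ A} => e.1)
      ⟨fun _ he => he, Subtype.val_injective.injOn,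
        fun e he => ⟨⟨e, Set.disjoint_right.1 h he⟩, he, rfl⟩⟩ fun _ _ => rfl
  have h3 : ∑ᶠ v ∈ verts Γ.ends (A ∪ B), T.vweight (Γ.vtype v) =
      ∑ᶠ v ∈ verts Γ.ends A, T.vweight (Γ.vtype v) +
        ∑ᶠ v ∈ verts Γ.ends B \ verts Γ.ends A, T.vweight (Γ.vtype v) := by
    rw [verts_union, ← Set.union_sdiff_self, finsum_mem_union Set.disjoint_sdiff_right
      (Set.toFinite _) (Set.toFinite _)]
  unfold omega
  rw [h1, h2, h3, sum_vweight_contract h, finsum_mem_union h (Set.toFinite _) (Set.toFinite _)]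
  push_cast
  ring

end Omega

end FeynmanGraph

end Motic

/-! ### Divergence as a Hopf property -/

namespace Motic

theorem IsHopfProperty.and {T : PowerCounting} {P Q : FeynmanGraph T → Prop} (hP : IsHopfProperty P)
    (hQ : IsHopfProperty Q) : IsHopfProperty fun Γ => P Γ ∧ Q Γ where
  of_iso i h := ⟨hP.of_iso i h.1, hQ.of_iso i h.2⟩
  empty := ⟨hP.empty, hQ.empty⟩
  sum_iff Γ Γ' := (and_congr (hP.sum_iff Γ Γ') (hQ.sum_iff Γ Γ')).trans and_and_and_comm
  of_sub_of_contract Γ A h h' :=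
    ⟨hP.of_sub_of_contract Γ A h.1 h'.1, hQ.of_sub_of_contract Γ A h.2 h'.2⟩

namespace FeynmanGraph

variable {T : PowerCounting}

/-- Every scale of `Γ` is passed on to `γ` or to `Γ/γ`, according to whether `γ` spans it. -/
theorem isHopfProperty_scaleless : IsHopfProperty (Scaleless (T := T)) where
  of_iso i h := ⟨fun s => h.false (i.σ.symm s)⟩
  empty := isEmpty_scale
  sum_iff _ _ := isEmpty_sum
  of_sub_of_contract Γ A h h' := ⟨fun s => by
    by_cases hs : Γ.Spanning A s
    · exact h.false ⟨s, hs⟩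
    · exact h'.false ⟨s, hs⟩⟩

section Bridges

/-- No edge is a bridge. -/
def NoBridge (Γ : FeynmanGraph T) : Prop :=
  ∀ e, ∀ u ∈ Γ.ends e, ∀ v ∈ Γ.ends e, conn Γ.ends {e}ᶜ u v

theorem NoBridge.of_iso {Γ Γ' : FeynmanGraph T} (i : Iso Γ Γ') (h : Γ.NoBridge) :
    Γ'.NoBridge := by
  intro e' u' hu' v' hv'
  obtain ⟨e, rfl⟩ := i.φ.surjective e'
  rw [i.ends] at hu' hv'
  obtain ⟨u, hu, rfl⟩ := Sym2.mem_map.1 hu'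
  obtain ⟨v, hv, rfl⟩ := Sym2.mem_map.1 hv'
  refine conn_mono ?_ (i.conn_f (h e u hu v hv))
  rintro _ ⟨f, hf, rfl⟩ hfe
  exact hf (i.φ.injective hfe)

theorem NoBridge.of_sum {Γ Γ' : FeynmanGraph T} (h : (Γ.sum Γ').NoBridge) : Γ.NoBridge := by
  intro e u hu v hv
  refine conn_mono ?_ (sum_conn_inl.1
    (h (.inl e) _ (inl_mem_sum_ends.2 hu) _ (inl_mem_sum_ends.2 hv)))
  exact fun f hf hfe => hf (congrArg Sum.inl hfe)

theorem NoBridge.sum {Γ Γ' : FeynmanGraph T} (h : Γ.NoBridge) (h' : Γ'.NoBridge) :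
    (Γ.sum Γ').NoBridge := by
  rintro (e | e) u hu v hv
  · obtain ⟨a, ha, rfl⟩ := Sym2.mem_map.1 hu
    obtain ⟨b, hb, rfl⟩ := Sym2.mem_map.1 hv
    refine sum_conn_inl.2 (conn_mono ?_ (h e a ha b hb))
    exact fun f hf hfe => hf (Sum.inl_injective hfe)
  · obtain ⟨a, ha, rfl⟩ := Sym2.mem_map.1 hu
    obtain ⟨b, hb, rfl⟩ := Sym2.mem_map.1 hv
    refine sum_conn_inr.2 (conn_mono ?_ (h' e a ha b hb))
    exact fun f hf hfe => hf (Sum.inr_injective hfe)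

/-- An edge of `γ` can be bypassed within `γ`. For any other edge, a bypass in `Γ/γ` lifts to `Γ` by
means of paths in `γ`. -/
theorem isHopfProperty_noBridge : IsHopfProperty (NoBridge (T := T)) where
  of_iso := NoBridge.of_iso
  empty e := isEmptyElim e
  sum_iff Γ Γ' :=
    ⟨fun h => ⟨h.of_sum, (h.of_iso (Iso.sumComm Γ Γ')).of_sum⟩, fun h => h.1.sum h.2⟩
  of_sub_of_contract Γ A h h' e u hu v hv := by
    by_cases he : e ∈ A
    · refine conn_mono ?_ ((Γ.conn_sub A _ u v).1 (h (show A from ⟨e, he⟩) u hu v hv))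
      rintro _ ⟨f, hf, rfl⟩ hfe
      exact hf (Subtype.ext hfe)
    · have := (Γ.conn_contract A _ u v).1 (h' (show {e // e ∉ A} from ⟨e, he⟩) _
        (Sym2.mem_map.2 ⟨u, hu, rfl⟩) _ (Sym2.mem_map.2 ⟨v, hv, rfl⟩))
      refine conn_mono ?_ this
      rintro f (hf | ⟨f, hf, rfl⟩) hfe
      · exact he (hfe ▸ hf)
      · exact hf (Subtype.ext hfe)

variable {Γ : FeynmanGraph T}

theorem mem_compOf_of_mem_verts {e a : Γ.E} {x : Γ.V} (hx : x ∈ verts Γ.ends (Γ.compOf e))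
    (ha : x ∈ Γ.ends a) : a ∈ Γ.compOf e := by
  obtain ⟨f, hf, hxf⟩ := hx
  exact mem_compOf_trans hf ⟨x, hxf, x, ha, conn_refl _⟩

theorem conn_inter_compOf {X : Set Γ.E} {e : Γ.E} {x y : Γ.V}
    (hx : x ∈ verts Γ.ends (Γ.compOf e)) (h : conn Γ.ends X x y) :
    conn Γ.ends (X ∩ Γ.compOf e) x y := by
  have key : ∀ {x y}, x ∈ verts Γ.ends (Γ.compOf e) → conn Γ.ends (X ∩ Γ.compOf e) x y →
      y ∈ verts Γ.ends (Γ.compOf e) := by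
    intro x y hx h
    rcases eq_or_verts_of_conn h with rfl | h
    · exact hx
    · exact verts_mono Set.inter_subset_right h.2
  -- The assumption is made symmetric in `x` and `y` so that the induction survives reversal and
  -- composition of paths.
  suffices x ∈ verts Γ.ends (Γ.compOf e) ∨ y ∈ verts Γ.ends (Γ.compOf e) →
      conn Γ.ends (X ∩ Γ.compOf e) x y from this (.inl hx)
  clear hx
  change Relation.EqvGen _ _ _ at h
  induction h with
  | rel x y h =>
    obtain ⟨a, ha, hx, hy⟩ := h
    rintro (h | h)
    · exact conn_of_mem_ends (A := X ∩ Γ.compOf e) ⟨ha, mem_compOf_of_mem_verts h hx⟩ hx hy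
    · exact conn_of_mem_ends (A := X ∩ Γ.compOf e) ⟨ha, mem_compOf_of_mem_verts h hy⟩ hx hy
  | refl x => exact fun _ => conn_refl _
  | symm x y _ ih => exact fun h => conn_symm (ih h.symm)
  | trans x y z _ _ ih1 ih2 =>
    rintro (h | h)
    · have h1 := ih1 (.inl h)
      exact conn_trans h1 (ih2 (.inl (key h h1)))
    · have h2 := ih2 (.inr h)
      exact conn_trans (ih1 (.inr (key h (conn_symm h2)))) h2

/-- A component is connected, so it stays connected without `f` as soon as the ends of `f` do. -/
theorem forall_onePI_compOf_iff : (∀ e, Γ.OnePI (Γ.compOf e)) ↔ Γ.NoBridge := by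
  constructor
  · intro h e u hu v hv
    have he := mem_compOf_self e
    exact conn_mono (fun f hf => hf.2) (h e e he u ⟨e, he, hu⟩ v ⟨e, he, hv⟩)
  · intro h e f hf u hu v hv
    have huv : conn Γ.ends Set.univ u v := by
      obtain ⟨a, ha, hua⟩ := hu
      obtain ⟨b, hb, hvb⟩ := hv
      obtain ⟨p, hp, q, hq, hpq⟩ := mem_compOf_trans (mem_compOf_symm ha) hb
      exact conn_trans (conn_of_mem_ends (Set.mem_univ a) hua hp)
        (conn_trans hpq (conn_of_mem_ends (Set.mem_univ b) hq hvb))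
    refine conn_diff_singleton (fun x hx y hy => ?_)
      (conn_mono Set.inter_subset_right (conn_inter_compOf hu huv))
    exact conn_mono (B := Γ.compOf e \ {f}) (fun a ha => ⟨ha.2, ha.1⟩) (conn_inter_compOf ⟨f, hf, hx⟩ (h f x hx y hy))

end Bridges

section Decomposition

theorem omega_empty (Γ : FeynmanGraph T) : Γ.omega ∅ = 0 := by
  have : verts Γ.ends ∅ = ∅ := by
    ext v
    simp [verts]
  simp [omega, loops_empty, this]

/-- A natural partition of the edges of all graphs that is compatible with subgraphs, contraction
and disjoint unions, and for which `ω` is the sum of its values on the parts. -/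
structure IsDecomposition (c : ∀ Γ : FeynmanGraph T, Γ.E → Set Γ.E) : Prop where
  self_mem : ∀ Γ e, e ∈ c Γ e
  symm : ∀ Γ e f, f ∈ c Γ e → e ∈ c Γ f
  trans : ∀ Γ e f g, f ∈ c Γ e → g ∈ c Γ f → g ∈ c Γ e
  omega_eq_add : ∀ Γ A, (∀ e ∈ A, c Γ e ⊆ A) → ∀ X,
    Γ.omega X = Γ.omega (X ∩ A) + Γ.omega (X \ A)
  iso : ∀ {Γ Γ'} (i : Iso Γ Γ') e f, f ∈ c Γ e → i.φ f ∈ c Γ' (i.φ e)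
  sub : ∀ (Γ : FeynmanGraph T) (A : Set Γ.E) (e f : A), f ∈ c (Γ.sub A) e → f.1 ∈ c Γ e.1
  contract : ∀ (Γ : FeynmanGraph T) (A : Set Γ.E) (e f : {e // e ∉ A}),
    f ∈ c (Γ.contract A) e → f.1 ∈ c Γ e.1
  sum_inl : ∀ Γ Γ' (e : Γ.E), c (Γ.sum Γ') (show Γ.E ⊕ Γ'.E from .inl e) =
    (Sum.inl : Γ.E → Γ.E ⊕ Γ'.E) '' c Γ e

namespace IsDecomposition

variable {c : ∀ Γ : FeynmanGraph T, Γ.E → Set Γ.E} {W : AddSubmonoid ℝ}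

/-- Split off one part at a time; `ω` adds up and `W` is closed under addition. -/
theorem omega_mem (hc : IsDecomposition c) {Γ : FeynmanGraph T} (hΓ : ∀ e, Γ.omega (c Γ e) ∈ W) {A : Set Γ.E}
    (hA : ∀ e ∈ A, c Γ e ⊆ A) : Γ.omega A ∈ W := by
  induction hn : A.ncard using Nat.strong_induction_on generalizing A with | _ n ih => ?_
  rcases A.eq_empty_or_nonempty with rfl | ⟨e, he⟩
  · exact Γ.omega_empty ▸ W.zero_mem
  rw [hc.omega_eq_add Γ (c Γ e) (fun f hf g hg => hc.trans Γ _ _ _ hf hg) A,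
    Set.inter_eq_right.2 (hA e he)]
  refine W.add_mem (hΓ e) (ih _ ?_ (fun f hf g hg => ⟨hA f hf.1 hg, fun hge =>
    hf.2 (hc.trans Γ _ _ _ hge (hc.symm Γ _ _ hg))⟩) rfl)
  rw [← hn]
  exact Set.ncard_lt_ncard ⟨Set.sdiff_subset, fun h => (h he).2 (hc.self_mem Γ e)⟩ (Set.toFinite A)

theorem iso_image (hc : IsDecomposition c) {Γ Γ' : FeynmanGraph T} (i : Iso Γ Γ') (e : Γ.E) :
    c Γ' (i.φ e) = i.φ '' c Γ e := by
  refine Set.Subset.antisymm (fun f' hf' => ?_) (Set.image_subset_iff.2 fun f hf =>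
    hc.iso i e f hf)
  have h := hc.iso i.symm _ _ hf'
  change i.φ.symm f' ∈ c Γ (i.φ.symm (i.φ e)) at h
  rw [Equiv.symm_apply_apply] at h
  exact ⟨_, h, i.φ.apply_symm_apply f'⟩

theorem forall_omega_mem_of_iso (hc : IsDecomposition c) {Γ Γ' : FeynmanGraph T} (i : Iso Γ Γ')
    (h : ∀ e, Γ.omega (c Γ e) ∈ W) (e : Γ'.E) : Γ'.omega (c Γ' e) ∈ W := by
  obtain ⟨e, rfl⟩ := i.φ.surjective e
  rw [hc.iso_image i, i.omega_image]
  exact h e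

theorem omega_sum_inl (hc : IsDecomposition c) (Γ Γ' : FeynmanGraph T) (e : Γ.E) :
    (Γ.sum Γ').omega (c (Γ.sum Γ') (.inl e)) = Γ.omega (c Γ e) :=
  (congrArg _ (hc.sum_inl Γ Γ' e)).trans (FeynmanGraph.omega_sum_inl Γ' _)

theorem omega_sum_inr (hc : IsDecomposition c) (Γ Γ' : FeynmanGraph T) (e : Γ'.E) :
    (Γ.sum Γ').omega (c (Γ.sum Γ') (.inr e)) = Γ'.omega (c Γ' e) := by
  refine Eq.trans (congrArg _ ?_)
    (((Iso.sumComm Γ' Γ).omega_image (c (Γ'.sum Γ) (.inl e))).trans (hc.omega_sum_inl Γ' Γ e))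
  exact hc.iso_image (Iso.sumComm Γ' Γ) (.inl e)

theorem isHopfProperty (hc : IsDecomposition c) (W : AddSubmonoid ℝ) :
    IsHopfProperty fun Γ => ∀ e, Γ.omega (c Γ e) ∈ W where
  of_iso := hc.forall_omega_mem_of_iso
  empty e := isEmptyElim e
  sum_iff Γ Γ' := by
    refine Sum.forall.trans (and_congr (forall_congr' fun e => ?_) (forall_congr' fun e => ?_))
    · exact iff_of_eq (congrArg (· ∈ W) (hc.omega_sum_inl Γ Γ' e))
    · exact iff_of_eq (congrArg (· ∈ W) (hc.omega_sum_inr Γ Γ' e))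
  of_sub_of_contract Γ A h h' e := by
    -- Write `C` for the part of `e`. `C ∩ A` is a union of parts of the subgraph and `C \ A` one of
    -- the contracted graph. The latter has the degree `ω (A ∪ C) - ω A`, which is `ω C - ω (A ∩ C)`
    -- because `ω (A \ C)` cancels. The two degrees add up to `ω C`.
    have hC : ∀ f ∈ c Γ e, c Γ f ⊆ c Γ e := fun f hf g hg => hc.trans Γ _ _ _ hf hg
    have h1 := hc.omega_mem h (A := Γ.inSub A (c Γ e ∩ A)) fun a ha f hf =>
      ⟨hC _ ha.1 (hc.sub Γ A a f hf), f.2⟩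
    have h2 := hc.omega_mem h' (A := Γ.inContract A (c Γ e \ A)) fun a ha f hf =>
      ⟨hC _ ha.1 (hc.contract Γ A a f hf), f.2⟩
    rw [omega_inSub Set.inter_subset_right] at h1
    rw [omega_contract Set.disjoint_sdiff_right, Set.union_sdiff_self,
      hc.omega_eq_add Γ _ hC (A ∪ c Γ e), hc.omega_eq_add Γ _ hC A,
      Set.inter_eq_right.2 Set.subset_union_right, Set.union_sdiff_right,
      add_sub_add_right_eq_sub, Set.inter_comm] at h2
    have h3 := W.add_mem h1 h2
    rwa [add_sub_cancel] at h3

end IsDecomposition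

variable {Γ Γ' : FeynmanGraph T}

/-- Loops and edge weights always split along blocks; only the vertex weights need an assumption. -/
theorem omega_eq_add {A X : Set Γ.E} (hA : ∀ e ∈ A, Γ.blockOf e ⊆ A)
    (h : ∑ᶠ v ∈ verts Γ.ends X, T.vweight (Γ.vtype v) =
      ∑ᶠ v ∈ verts Γ.ends (X ∩ A), T.vweight (Γ.vtype v) +
        ∑ᶠ v ∈ verts Γ.ends (X \ A), T.vweight (Γ.vtype v)) :
    Γ.omega X = Γ.omega (X ∩ A) + Γ.omega (X \ A) := by
  unfold omega
  rw [loops_eq_add hA X, h, ← finsum_mem_inter_add_sdiff A (Set.toFinite X)]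
  push_cast
  ring

theorem omega_eq_add_of_compOf_subset {A : Set Γ.E} (hA : ∀ e ∈ A, Γ.compOf e ⊆ A) (X : Set Γ.E) :
    Γ.omega X = Γ.omega (X ∩ A) + Γ.omega (X \ A) := by
  refine omega_eq_add (fun e he => (blockOf_subset_compOf e).trans (hA e he)) ?_
  rw [← finsum_mem_union _ (Set.toFinite _) (Set.toFinite _), ← verts_union,
    Set.inter_union_sdiff]
  rw [Set.disjoint_left]
  rintro x ⟨e, he, hxe⟩ ⟨f, hf, hxf⟩
  exact hf.2 (hA e he.2 ⟨x, hxe, x, hxf, conn_refl _⟩)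

/-- Blocks share cut vertices, whose weights would be counted more than once if they did not vanish.
-/
theorem omega_eq_add_of_blockOf_subset (hT : ∀ t, T.vweight t = 0) {A : Set Γ.E}
    (hA : ∀ e ∈ A, Γ.blockOf e ⊆ A) (X : Set Γ.E) :
    Γ.omega X = Γ.omega (X ∩ A) + Γ.omega (X \ A) :=
  omega_eq_add hA (by simp [hT])

theorem compOf_sum_inl (e : Γ.E) : (Γ.sum Γ').compOf (.inl e) = Sum.inl '' Γ.compOf e := by
  ext f
  constructor
  · rintro ⟨u, hu, v, hv, huv⟩
    obtain ⟨a, ha, rfl⟩ := Sym2.mem_map.1 hu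
    obtain f | f := f
    · obtain ⟨b, hb, rfl⟩ := Sym2.mem_map.1 hv
      exact ⟨f, ⟨a, ha, b, hb, sum_conn_inl.1 huv⟩, rfl⟩
    · obtain ⟨b, hb, rfl⟩ := Sym2.mem_map.1 hv
      cases conn_sum.1 huv
  · rintro ⟨f, ⟨a, ha, b, hb, hab⟩, rfl⟩
    exact ⟨_, inl_mem_sum_ends.2 ha, _, inl_mem_sum_ends.2 hb, sum_conn_inl.2 hab⟩

theorem isDecomposition_compOf : IsDecomposition (compOf (T := T)) where
  self_mem _ := mem_compOf_self
  symm _ _ _ := mem_compOf_symm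
  trans _ _ _ _ := mem_compOf_trans
  omega_eq_add _ _ := omega_eq_add_of_compOf_subset
  iso i e f := by
    rintro ⟨u, hu, v, hv, huv⟩
    exact ⟨_, i.mem_ends hu, _, i.mem_ends hv, conn_mono (Set.subset_univ _) (i.conn_f huv)⟩
  sub Γ A e f := by
    rintro ⟨u, hu, v, hv, huv⟩
    exact ⟨u, hu, v, hv, conn_mono (Set.subset_univ _) ((Γ.conn_sub A _ u v).1 huv)⟩
  contract Γ A e f := by
    rintro ⟨x, hx, y, hy, hxy⟩
    obtain ⟨u, hu, rfl⟩ := Sym2.mem_map.1 hx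
    obtain ⟨v, hv, rfl⟩ := Sym2.mem_map.1 hy
    exact ⟨u, hu, v, hv, conn_mono (Set.subset_univ _) ((Γ.conn_contract A _ u v).1 hxy)⟩
  sum_inl _ _ := compOf_sum_inl

theorem blockOf_iso (i : Iso Γ Γ') {e f : Γ.E} (h : f ∈ Γ.blockOf e) :
    i.φ f ∈ Γ'.blockOf (i.φ e) := by
  refine fun v => eqvGen_lift i.φ (fun a b => ?_) (h (i.g v))
  rintro ⟨u, hu, ha, hb⟩
  refine .rel _ _ ⟨i.f u, ?_, i.mem_ends ha, i.mem_ends hb⟩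
  rintro rfl
  exact hu (i.gf a u ha).symm

/-- A chain that avoids the class of `v` lifts to one that avoids `v`: where two edges meet in a
contracted vertex, their ends are connected in `A` by a path that misses `v`. -/
theorem blockOf_contract (A : Set Γ.E) {e f : {e // e ∉ A}}
    (h : f ∈ (Γ.contract A).blockOf e) : f.1 ∈ Γ.blockOf e.1 := by
  refine fun v => eqvGen_lift Subtype.val (fun a b => ?_) (h (Quotient.mk _ v))
  rintro ⟨x, hx, ha, hb⟩
  obtain ⟨p, hp, rfl⟩ := Sym2.mem_map.1 ha
  obtain ⟨q, hq, hpq⟩ := Sym2.mem_map.1 hb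
  exact chain_of_conn (Quotient.exact hpq.symm) (fun h => hx (Quotient.sound h)) hp hq

theorem blockOf_sum_inl (e : Γ.E) : (Γ.sum Γ').blockOf (.inl e) = Sum.inl '' Γ.blockOf e := by
  ext f
  constructor
  · intro h
    have h' := blockOf_subset_compOf _ h
    rw [compOf_sum_inl] at h'
    obtain ⟨f, _, rfl⟩ := h'
    refine ⟨f, fun v => ?_, rfl⟩
    have key : ∀ x y : Γ.E ⊕ Γ'.E, chain (Γ.sum Γ').ends (.inl v) x y →
        Sum.LiftRel (chain Γ.ends v) (fun _ _ => True) x y := by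
      intro x y hxy
      change Relation.EqvGen _ _ _ at hxy
      induction hxy with
      | rel x y hxy =>
        obtain ⟨u, hu, hx, hy⟩ := hxy
        obtain x | x := x <;> obtain y | y := y <;>
          obtain ⟨a, ha, rfl⟩ := Sym2.mem_map.1 hx <;>
          obtain ⟨b, hb, hab⟩ := Sym2.mem_map.1 hy
        · cases hab
          exact .inl (chain_of_mem (fun h => hu (congrArg Sum.inl h)) ha hb)
        · cases hab
        · cases hab
        · exact .inr trivial
      | refl x =>
        obtain x | x := x
        · exact .inl (.refl _)
        · exact .inr trivial
      | symm x y _ ih =>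
        cases ih with
        | inl h => exact .inl (.symm _ _ h)
        | inr h => exact .inr trivial
      | trans x y z _ _ ih1 ih2 =>
        cases ih1 with
        | inl h =>
          cases ih2 with
          | inl h' => exact .inl (.trans _ _ _ h h')
        | inr h =>
          cases ih2 with
          | inr h' => exact .inr trivial
    exact Sum.liftRel_inl_inl.1 (key _ _ (h _))
  · rintro ⟨f, hf, rfl⟩ v
    -- If `v` lies in the other summand, its avoidance is no restriction, and `w` can be any vertex.
    obtain ⟨w, hw⟩ : ∃ w : Γ.V, ∀ u, u ≠ w → Sum.inl u ≠ v := by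
      obtain w | w := v
      · exact ⟨w, fun u hu h => hu (Sum.inl_injective h)⟩
      · exact ⟨Γ.nonempty_V.some, fun u _ h => by cases h⟩
    refine eqvGen_lift Sum.inl (fun a b => ?_) (hf w)
    rintro ⟨u, hu, ha, hb⟩
    exact .rel _ _ ⟨.inl u, hw u hu, inl_mem_sum_ends.2 ha, inl_mem_sum_ends.2 hb⟩

theorem isDecomposition_blockOf (hT : ∀ t, T.vweight t = 0) :
    IsDecomposition (blockOf (T := T)) where
  self_mem _ := mem_blockOf_self
  symm _ _ _ := mem_blockOf_symm
  trans _ _ _ _ := mem_blockOf_trans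
  omega_eq_add _ _ := omega_eq_add_of_blockOf_subset hT
  iso i _ _ := blockOf_iso i
  sub _ A _ _ h v := eqvGen_lift (Subtype.val (p := (· ∈ A))) (fun _ _ h => .rel _ _ h) (h v)
  contract _ A _ _ := blockOf_contract A
  sum_inl _ _ := blockOf_sum_inl

end Decomposition

/-- That all components are 1PI is the absence of bridges, so UV divergence is the conjunction of
two Hopf properties. -/
theorem isHopfProperty_uvDivergent : IsHopfProperty (UVDivergent (T := T)) := by
  have h := isHopfProperty_noBridge.and
    (isDecomposition_compOf.isHopfProperty (T := T) (AddSubmonoid.nonneg ℝ))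
  have : UVDivergent (T := T) = fun Γ => Γ.NoBridge ∧ ∀ e, Γ.omega (Γ.compOf e) ∈
      AddSubmonoid.nonneg ℝ := by
    ext Γ
    exact forall_and.trans (and_congr forall_onePI_compOf_iff Iff.rfl)
  rwa [this]

/-- The nonpositive real numbers. -/
def nonpos : AddSubmonoid ℝ where
  carrier := Set.Iic 0
  zero_mem' := le_refl (0 : ℝ)
  add_mem' {a b} (ha : a ≤ 0) (hb : b ≤ 0) := show a + b ≤ 0 from add_nonpos ha hb

theorem isHopfProperty_irDivergent : IsHopfProperty (IRDivergent (T := T)) :=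
  isHopfProperty_scaleless.and (isDecomposition_compOf.isHopfProperty nonpos)

theorem isHopfProperty_irDivergentBlocks (hT : ∀ t, T.vweight t = 0) :
    IsHopfProperty (IRDivergentBlocks (T := T)) :=
  isHopfProperty_scaleless.and ((isDecomposition_blockOf hT).isHopfProperty nonpos)

/-- This turns the scalelessness in the definition of IR divergence into the mass-momentum-spanning
condition on `γ`. -/
theorem scaleless_contract_iff {Γ : FeynmanGraph T} (A : Set Γ.E) :
    (Γ.contract A).Scaleless ↔ ∀ s, Γ.Spanning A s :=
  (isEmpty_subtype _).trans (forall_congr' fun _ => not_not)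

end FeynmanGraph

end Motic

open Motic FeynmanGraph
theorem lemma3p2 (T : PowerCounting) :
    ∃ (S : M T →ₗ[ℚ] M T) (h : IsHopf (coproduct T) (counit T) S),
      -- the UV part
      (Subalgebra.toSubmodule (HUV T) = Submodule.span ℚ (graphs UVDivergent) ∧
        (∃ (Δ : HUV T →ₗ[ℚ] HUV T ⊗[ℚ] HUV T) (ε : HUV T →ₗ[ℚ] ℚ) (S' : HUV T →ₗ[ℚ] HUV T)
          (h' : IsHopf Δ ε S'),
          KernelIsHopfIdeal h h' (rhoUV T) ∧ IsLeftCoaction Δ ε (coactionUV T)) ∧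
        ∀ (Γ : FeynmanGraph T) (hΓ : Γ.IsMotic),
          (HUV T).val.toLinearMap.rTensor (M T) (coactionUV T (graph Γ hΓ)) =
            ∑ᶠ A : {A : Set Γ.E // (Γ.sub A).IsMotic ∧ (Γ.sub A).UVDivergent},
              term Γ hΓ A.1 A.2.1) ∧
      -- the IR part
      (Subalgebra.toSubmodule (HIR T) = Submodule.span ℚ (graphs IRDivergent) ∧
        (∃ (Δ : HIR T →ₗ[ℚ] HIR T ⊗[ℚ] HIR T) (ε : HIR T →ₗ[ℚ] ℚ) (S' : HIR T →ₗ[ℚ] HIR T)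
          (h' : IsHopf Δ ε S'),
          KernelIsHopfIdeal h h' (rhoIR T) ∧ IsRightCoaction Δ ε (coactionIR T)) ∧
        ∀ (Γ : FeynmanGraph T) (hΓ : Γ.IsMotic),
          (HIR T).val.toLinearMap.lTensor (M T) (coactionIR T (graph Γ hΓ)) =
            ∑ᶠ A : {A : Set Γ.E // (Γ.sub A).IsMotic ∧ (∀ s, Γ.Spanning A s) ∧
                ∀ e, (Γ.contract A).omega ((Γ.contract A).compOf e) ≤ 0},
              term Γ hΓ A.1 A.2.1) ∧
      -- the IR part with the graphs decomposed also at their cut vertices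
      ((∀ t, T.vweight t = 0) →
        Subalgebra.toSubmodule (HIRB T) = Submodule.span ℚ (graphs IRDivergentBlocks) ∧
        (∃ (Δ : HIRB T →ₗ[ℚ] HIRB T ⊗[ℚ] HIRB T) (ε : HIRB T →ₗ[ℚ] ℚ)
          (S' : HIRB T →ₗ[ℚ] HIRB T) (h' : IsHopf Δ ε S'),
          KernelIsHopfIdeal h h' (rhoIRB T) ∧ IsRightCoaction Δ ε (coactionIRB T)) ∧
        ∀ (Γ : FeynmanGraph T) (hΓ : Γ.IsMotic),
          (HIRB T).val.toLinearMap.lTensor (M T) (coactionIRB T (graph Γ hΓ)) =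
            ∑ᶠ A : {A : Set Γ.E // (Γ.sub A).IsMotic ∧ (∀ s, Γ.Spanning A s) ∧
                ∀ e, (Γ.contract A).omega ((Γ.contract A).blockOf e) ≤ 0},
              term Γ hΓ A.1 A.2.1) := by
  obtain ⟨S, h⟩ := exists_isHopf T
  refine ⟨S, h, ?_, ?_, fun hT => ?_⟩
  · have hP := isHopfProperty_uvDivergent (T := T)
    obtain ⟨Δ, ε, S', h', h1, h2, _⟩ := hP.exists_isHopf h
    exact ⟨hP.toSubmodule_H, ⟨Δ, ε, S', h', h1, h2⟩, fun Γ hΓ => hP.rTensor_coproduct hΓ⟩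
  · have hP := isHopfProperty_irDivergent (T := T)
    obtain ⟨Δ, ε, S', h', h1, _, h2⟩ := hP.exists_isHopf h
    exact ⟨hP.toSubmodule_H, ⟨Δ, ε, S', h', h1, h2⟩, fun Γ hΓ => hP.lTensor_coproduct hΓ
      fun A => and_congr (scaleless_contract_iff A).symm Iff.rfl⟩
  · have hP := isHopfProperty_irDivergentBlocks hT
    obtain ⟨Δ, ε, S', h', h1, _, h2⟩ := hP.exists_isHopf h
    exact ⟨hP.toSubmodule_H, ⟨Δ, ε, S', h', h1, h2⟩, fun Γ hΓ => hP.lTensor_coproduct hΓ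
      fun A => and_congr (scaleless_contract_iff A).symm Iff.rfl⟩
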